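/- **Theorem (list decoding of multivariate multiplicity codes with constant list size).** Setting. Let $k,s\ge 1$ and $d\ge 0$ be integers, $\mathbb F$ a field, $S\subseteq\mathbb F$ a finite set, and $E=\{e\in\mathbb Z_{\ge 0}^k : e_1+\dots+e_k<s\}$. For $f\in\mathbb F[x_1,\dots,x_k]$ and $e\in\mathbb Z_{\ge0}^k$, the Hasse derivative $\partial_e f$ is the coefficient of $z^e$ in $f(x+z)$. The $k$-variate order-$s$ multiplicity code of degree-$d$ polynomials on the grid $S^k$ consists of the words $\mathrm{Enc}(f):S^k\to\mathbb F^E$, $\mathrm{Enc}(f)(a)=(\partial_e f(a))_{e\in E}$, for $f$ of total degree at most $d$. The agreement of two words is the fraction of points of $S^k$ at which they are equal. Put $\delta=1-\frac{d}{s|S|}$. There is an absolute constant $C\in\mathbb N$ such that for every real $\epsilon\in(0,1)$ and every integer $k\ge 1$ there is an integer $s_0$ such that the following holds for all integers $s\ge s_0$, $d\ge 0$ and $n$ with $d<sn$. There is a randomized algorithm, depending only on $\epsilon,k,s,d,n$, such that for every field $\mathbb F$ whose characteristic is zero or larger than $d$, every $S\subseteq\mathbb F$ with $|S|=n$ (given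 as a list of its elements in any order) and every received word $P:S^k\to\mathbb F^E$: 1. on input $S$ and $P$ the algorithm always uses at most $$C\Bigl(d^{k^2}+|S|^{k^2}+\exp\bigl(C\,\tfrac{k^2}{\epsilon}\log^3\tfrac1\epsilon\bigr)\Bigr)^{C}$$ field operations; 2. with probability at least $2/3$ over its random choices, it outputs exactly the list of all codewords that have agreement at least $1-\delta+\epsilon$ with $P$; 3. the number of these codewords is finite and at most $\exp\bigl(C\,\tfrac{k^2}{\epsilon}\log^2\tfrac1\epsilon\bigr)$. Here an algorithm is a randomized algebraic computation tree: it has one register for each element of $S$ and each entry of $P$, and further registers that initially hold $0$. It may load the constant $1$, add, subtract, multiply and divide register contents, branch on whether a register holds $0$, and output a list of words by naming registers; which tree is executed is determined by a seed drawn uniformly from a finite set. The field operations counted are $+,-,\times,\div$ and the loading of $1$; the random choice, zero tests and output are not counted. The tree itself does not depend on $\mathbb F$, $S$ or $P$. -/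

import Mathlib

namespace MultCode

/-- The Hasse derivative of type `e` of `f ∈ F[x₁, …, x_k]`: the coefficient of `z ^ e` in
`f (x + z)`, where `f (x + z)` is regarded as a polynomial in `z` with coefficients in `F[x]`. -/
noncomputable def hasseDeriv {F : Type*} [Field F] {k : ℕ} (e : Fin k →₀ ℕ)
    (f : MvPolynomial (Fin k) F) : MvPolynomial (Fin k) F :=
  MvPolynomial.coeff e
    (MvPolynomial.aeval
      (fun i : Fin k =>
        (MvPolynomial.C (MvPolynomial.X i) + MvPolynomial.X i :
          MvPolynomial (Fin k) (MvPolynomial (Fin k) F))) f)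

/-- The set of exponent vectors `e` with `‖e‖₁ < s`. -/
abbrev DerivIndex (k s : ℕ) : Type := {e : Fin k →₀ ℕ // e.degree < s}

/-- Words of length `|S| ^ k` (positions are the points of the grid `S ^ k`) over the alphabet
`F ^ E`, where `E = DerivIndex k s`. -/
abbrev Word {F : Type*} (S : Finset F) (k s : ℕ) : Type _ :=
  (Fin k → S) → DerivIndex k s → F

/-- The order-`s` encoding of `f` on the grid `S ^ k`: at a point `a`, all Hasse derivatives of
`f` of order less than `s`, evaluated at `a`. -/
noncomputable def encode {F : Type*} [Field F] (S : Finset F) {k : ℕ} (s : ℕ)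
    (f : MvPolynomial (Fin k) F) : Word S k s :=
  fun a e => MvPolynomial.eval (fun i => (a i : F)) (hasseDeriv e.1 f)

/-- The `k`-variate order-`s` multiplicity code of polynomials of total degree at most `d` on the
grid `S ^ k`. -/
def multiplicityCode {F : Type*} [Field F] (S : Finset F) (k s d : ℕ) : Set (Word S k s) :=
  {c | ∃ f : MvPolynomial (Fin k) F, f.totalDegree ≤ d ∧ c = encode S s f}

/-- The fraction of the points of the grid `S ^ k` on which two words agree. -/
noncomputable def agreement {F : Type*} {S : Finset F} {k s : ℕ} (c P : Word S k s) : ℝ :=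
  ({a : Fin k → S | c a = P a}.ncard : ℝ) / (S.card : ℝ) ^ k

/-- `δ = 1 - d / (s n)`, the relative distance for a set `S` of `n` elements. -/
noncomputable def relDist (s d n : ℕ) : ℝ := 1 - (d : ℝ) / ((s : ℝ) * (n : ℝ))

/-- The codewords whose agreement with the received word `P` is at least `θ`. -/
def closeCodewords {F : Type*} [Field F] (S : Finset F) {k : ℕ} (s d : ℕ) (P : Word S k s)
    (θ : ℝ) : Set (Word S k s) :=
  {c | c ∈ multiplicityCode S k s d ∧ θ ≤ agreement c P}

/-- The four arithmetic operations of a field. -/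
inductive FieldOp : Type
  | add
  | sub
  | mul
  | div

/-- The value of an arithmetic operation (a division by zero returns zero). -/
def FieldOp.eval {F : Type*} [Field F] : FieldOp → F → F → F
  | .add, x, y => x + y
  | .sub, x, y => x - y
  | .mul, x, y => x * y
  | .div, x, y => x / y

/-- Algebraic computation trees with registers named by `R`, each of which holds one field element.
The tree does not mention the field, so that one tree runs over every field, and it can inspect
field elements only through tests for zero.
An output is a list of `J`-indexed vectors of field elements, each given by naming, for every index
in `J`, the register that holds that entry. -/
inductive CompTree (R J : Type) : Type
  /-- Stop, with the given list of vectors of registers as the output. -/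
  | output (l : List (J → R)) : CompTree R J
  /-- Write the constant `1` to register `dst`. -/
  | loadOne (dst : R) (next : CompTree R J) : CompTree R J
  /-- Apply `op` to registers `x` and `y`, and write the result to register `dst`. -/
  | arith (op : FieldOp) (dst x y : R) (next : CompTree R J) : CompTree R J
  /-- Continue with the first subtree if register `x` holds zero, otherwise with the second. -/
  | ifZero (x : R) (thenTree elseTree : CompTree R J) : CompTree R J

namespace CompTree

open Classical in
/-- The list of vectors that a computation tree returns when it is started with the register
contents `mem`. -/
noncomputable def run {F : Type*} [Field F] {R J : Type} :
    CompTree R J → (R → F) → List (J → F)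
  | output l, mem => l.map fun v j => mem (v j)
  | loadOne dst next, mem => next.run (Function.update mem dst 1)
  | arith op dst x y next, mem => next.run (Function.update mem dst (op.eval (mem x) (mem y)))
  | ifZero x t₁ t₂, mem => if mem x = 0 then t₁.run mem else t₂.run mem

open Classical in
/-- The number of field operations (arithmetic operations and loaded constants) executed by a
computation tree started with the register contents `mem`. Tests for zero are not counted; as the
outcome of a test can be remembered, at most one test per input register and one per executed
operation is ever needed. -/
noncomputable def opCount {F : Type*} [Field F] {R J : Type} :
    CompTree R J → (R → F) → ℕ
  | output _, _ => 0
  | loadOne dst next, mem => next.opCount (Function.update mem dst 1) + 1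
  | arith op dst x y next, mem =>
      next.opCount (Function.update mem dst (op.eval (mem x) (mem y))) + 1
  | ifZero x t₁ t₂, mem => if mem x = 0 then t₁.opCount mem else t₂.opCount mem

end CompTree

/-- A randomized computation tree: a seed is drawn uniformly from a finite non-empty set, and the
computation tree that belongs to the seed is executed. -/
structure RandCompTree (R J : Type) where
  /-- The number of seeds. -/
  numSeeds : ℕ
  numSeeds_pos : 0 < numSeeds
  /-- The computation tree executed for a given seed. -/
  tree : Fin numSeeds → CompTree R J

/-- The probability, over the seed, that the executed computation tree satisfies `p`. -/
noncomputable def RandCompTree.prob {R J : Type} (A : RandCompTree R J)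
    (p : CompTree R J → Prop) : ℝ :=
  ({ω : Fin A.numSeeds | p (A.tree ω)}.ncard : ℝ) / (A.numSeeds : ℝ)

/-- The positions of the entries (elements of `F`) of a word, for a set `S` enumerated by
`Fin n`. -/
abbrev EntryIndex (k s n : ℕ) : Type := (Fin k → Fin n) × DerivIndex k s

/-- The registers of a decoder: one for each element of `S`, one for each entry of the received
word, and an unlimited supply of working registers. -/
abbrev DecoderReg (k s n : ℕ) : Type := (Fin n ⊕ EntryIndex k s n) ⊕ ℕ

/-- The initial register contents of a decoder: the elements of `S`, in the order given by the
enumeration `en`, and the entries of the received word `P`. The working registers hold `0`. -/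
def decoderInput {F : Type*} [Field F] {S : Finset F} {k s n : ℕ} (en : Fin n ≃ S)
    (P : Word S k s) : DecoderReg k s n → F :=
  Sum.elim
    (Sum.elim (fun i => (en i : F)) (fun p => P (fun i => en (p.1 i)) p.2))
    (fun _ => 0)

/-- The word on the grid `S ^ k` that a vector of entries describes, for the enumeration `en`. -/
def toWord {F : Type*} {S : Finset F} {k s n : ℕ} (en : Fin n ≃ S)
    (v : EntryIndex k s n → F) : Word S k s :=
  fun a e => v (fun i => en.symm (a i), e)

/-- The set of words that a decoder returns on the received word `P`. -/
def decoded {F : Type*} [Field F] {S : Finset F} {k s n : ℕ} (en : Fin n ≃ S)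
    (P : Word S k s) (t : CompTree (DecoderReg k s n) (EntryIndex k s n)) : Set (Word S k s) :=
  {c | ∃ v ∈ t.run (decoderInput en P), c = toWord en v}

end MultCode

/-! Write R = d/(sn), so that close means agreement at least R + ε on the n^k points of the grid. It
suffices to treat ε ≤ 1/2 in the main argument.

Interpolation. Take m about (2/ε)^k and D about εsn/2, and consider the differential operators Q = ∑
A_e ∂_e with |e| ≤ m and deg A_e ≤ D that formally annihilate the received jets to order s - m at
every grid point. If f is close to the received word, then Q f has degree at most D + d but vanishes
to order s - m wherever f agrees, which is too often by Schwartz–Zippel with multiplicities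
(`mul_sum_vanishing_le`); hence Q f = 0. So all close f lie in the linear space V of common
solutions. Its dimension is at most m (`finrank_solutionSpace_le`): for m + 1 independent solutions
some generalized Wronskian is nonzero (`exists_wronskian_ne_zero`), counting unknowns gives a
nonzero Q that uses only the m + 1 derivatives in the rows of that Wronskian, and such a Q cannot
kill all the solutions.

Pruning. The same Wronskian shows that the code is a subspace design
(`mul_sum_finrank_inf_vanishing_le`): for every U inside V, the dimension of the part of U that
vanishes to order s at a random grid point is on average at most (R + ε/2) dim U. Let A be the
agreement set of a close f. Sampling t points from A multiplies the expected dimension each time by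
at most (R + ε/2)/(R + ε) ≤ 1 - ε/2, so for t about (2/ε) log(2m) at least half of the tuples in A^t
leave only the zero polynomial, and then f is the only element of V that matches the received word
at the tuple. Among all t-tuples of grid points a fraction of at least p = ε^t/2 therefore
determines f (`close_mem_candidateSpace_and_le_card`). Tuples that determine different polynomials
are different, so the list has at most 1/p elements, and about (1/p) log(3/p) random tuples hit all
of these sets with probability at least 2/3 (`closePolys_determined`).

Algorithm. Computing V, solving for a candidate at each sampled tuple, and checking its agreement
are linear algebra and zero tests. Decision trees over arithmetic terms describe the procedure; a
term that has been computed is stored, so the cost of a run is bounded by the number of distinct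
terms it needs (`ZeroTree.compile_spec`). Three regimes need care. If d < s, one jet already
determines f and V is taken to be all polynomials of degree at most d, which keeps the cost
independent of s. If ε > 1/2, the decoder runs with 1/2 instead, and the list has at most one
element. If n = 1, a close codeword can only be the received word itself. -/

namespace MultCode

open MvPolynomial

/-! ### Hasse derivatives, jets at a point, and orders of vanishing -/

section Jets

variable {F : Type*} [Field F] {k : ℕ}

/-- The product of binomial coefficients `∏ i, (v i).choose (e i)`. -/
def multiChoose (v e : Fin k →₀ ℕ) : ℕ := ∏ i, (v i).choose (e i)

theorem multiChoose_add_single (w e : Fin k →₀ ℕ) (i : Fin k) :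
    multiChoose (w + Finsupp.single i 1) e =
      multiChoose w e + if e i = 0 then 0 else multiChoose w (e - Finsupp.single i 1) := by
  have key : ∀ v e' : Fin k →₀ ℕ, multiChoose v e' =
      (v i).choose (e' i) * ∏ j ∈ Finset.univ.erase i, (v j).choose (e' j) := fun v e' =>
    (Finset.mul_prod_erase _ _ (Finset.mem_univ i)).symm
  have h1 : ∏ j ∈ Finset.univ.erase i, ((w + Finsupp.single i 1 : Fin k →₀ ℕ) j).choose (e j) =
      ∏ j ∈ Finset.univ.erase i, (w j).choose (e j) := by
    refine Finset.prod_congr rfl fun j hj => ?_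
    have : i ≠ j := (Finset.ne_of_mem_erase hj).symm
    simp [this]
  have h2 : ∏ j ∈ Finset.univ.erase i, (w j).choose ((e - Finsupp.single i 1 : Fin k →₀ ℕ) j) =
      ∏ j ∈ Finset.univ.erase i, (w j).choose (e j) := by
    refine Finset.prod_congr rfl fun j hj => ?_
    have : i ≠ j := (Finset.ne_of_mem_erase hj).symm
    simp [this]
  rw [key, key w e, key w (e - _), h1, h2]
  rcases h : e i with _ | j
  · simp
  · simp [h, Nat.choose_succ_succ]
    ring

/-- Trinomial revision in each coordinate. It is the constant in the composition law
`hasseDeriv_hasseDeriv`. -/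
theorem multiChoose_mul (w u e : Fin k →₀ ℕ) :
    multiChoose (w + u) u * multiChoose (w + u + e) e =
      multiChoose (u + e) e * multiChoose (w + u + e) (u + e) := by
  simp only [multiChoose, ← Finset.prod_mul_distrib]
  refine Finset.prod_congr rfl fun i _ => ?_
  have h := Nat.choose_mul (n := w i + u i + e i) (k := u i + e i) (s := e i) (by omega)
  have h1 : w i + u i + e i - e i = w i + u i := by omega
  have h2 : u i + e i - e i = u i := by omega
  rw [h1, h2] at h
  simp only [Finsupp.coe_add, Pi.add_apply]
  rw [mul_comm, ← h, mul_comm]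

/-- The polynomial `f (x + z)` in `z` with coefficients in `F[x]`. -/
noncomputable def taylorExpand :
    MvPolynomial (Fin k) F →ₐ[F] MvPolynomial (Fin k) (MvPolynomial (Fin k) F) :=
  aeval (fun i => C (X i) + X i)

theorem hasseDeriv_eq (e : Fin k →₀ ℕ) (f : MvPolynomial (Fin k) F) :
    hasseDeriv e f = coeff e (taylorExpand f) := rfl

theorem hasseDeriv_add (e : Fin k →₀ ℕ) (f g : MvPolynomial (Fin k) F) :
    hasseDeriv e (f + g) = hasseDeriv e f + hasseDeriv e g := by
  simp [hasseDeriv_eq]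

theorem hasseDeriv_smul (e : Fin k →₀ ℕ) (c : F) (f : MvPolynomial (Fin k) F) :
    hasseDeriv e (c • f) = c • hasseDeriv e f := by
  simp [hasseDeriv_eq]

/-- The Hasse derivative as a linear map. -/
noncomputable def hasseDerivₗ (e : Fin k →₀ ℕ) :
    MvPolynomial (Fin k) F →ₗ[F] MvPolynomial (Fin k) F where
  toFun := hasseDeriv e
  map_add' := hasseDeriv_add e
  map_smul' := hasseDeriv_smul e

theorem hasseDerivₗ_apply (e : Fin k →₀ ℕ) (f : MvPolynomial (Fin k) F) :
    hasseDerivₗ e f = hasseDeriv e f := rfl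

/-- Multiplication by a variable turns f(x+z) into (x_i + z_i) f(x+z), so each coefficient in z
picks up two contributions, which Pascal's rule recombines. No division occurs, so the formula holds
in every characteristic. -/
theorem coeff_hasseDeriv (f : MvPolynomial (Fin k) F) :
    ∀ e u : Fin k →₀ ℕ,
      coeff u (hasseDeriv e f) = (multiChoose (u + e) e : F) * coeff (u + e) f := by
  induction f using MvPolynomial.induction_on with
  | C c =>
    intro e u
    have h : hasseDeriv e (C c : MvPolynomial (Fin k) F) = if 0 = e then C c else 0 := by
      have h' : taylorExpand (C c : MvPolynomial (Fin k) F) = C (C c) := by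
        rw [taylorExpand, aeval_C, MvPolynomial.algebraMap_apply, MvPolynomial.algebraMap_eq]
      rw [hasseDeriv_eq, h', coeff_C]
    rw [h, coeff_C]
    split_ifs with h1 h2 h2
    · subst h1; simp at h2; subst h2; simp [multiChoose]
    · subst h1; rw [coeff_C]; simp at h2; simp [h2]
    · exfalso; apply h1
      have := h2.symm
      rw [add_eq_zero] at this
      exact this.2.symm
    · simp
  | add f g hf hg =>
    intro e u
    rw [hasseDeriv_add, coeff_add, hf, hg, coeff_add, mul_add]
  | mul_X f i hf =>
    intro e u
    have h : hasseDeriv e (f * X i) = hasseDeriv e f * X i +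
        if i ∈ e.support then hasseDeriv (e - Finsupp.single i 1) f else 0 := by
      simp only [hasseDeriv_eq, map_mul]
      rw [show taylorExpand (X i : MvPolynomial (Fin k) F) = C (X i) + X i by
        simp [taylorExpand], mul_add, coeff_add, mul_comm _ (C (X i)), coeff_C_mul, coeff_mul_X',
        mul_comm (X i)]
    rw [h, coeff_add, coeff_mul_X', coeff_mul_X']
    have hif : coeff u (if i ∈ e.support then hasseDeriv (e - Finsupp.single i 1) f else 0) =
        if i ∈ e.support then coeff u (hasseDeriv (e - Finsupp.single i 1) f) else 0 := by
      split_ifs <;> simp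
    rw [hif, hf, hf]
    simp only [Finsupp.mem_support_iff, Finsupp.coe_add, Pi.add_apply]
    by_cases hw : u i + e i = 0
    · simp [Nat.eq_zero_of_add_eq_zero hw]
    · obtain ⟨w, hw'⟩ : ∃ w, u + e = w + Finsupp.single i 1 := by
        refine ⟨u + e - Finsupp.single i 1, ?_⟩
        ext j
        by_cases hj : i = j
        · subst hj; simp; omega
        · simp [hj]
      have e1 : u i ≠ 0 → u - Finsupp.single i 1 + e = w := by
        intro h0
        ext j
        have := DFunLike.congr_fun hw' j
        by_cases hj : i = j
        · subst hj; simp at this ⊢; omega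
        · simp [hj] at this ⊢; omega
      have e2 : e i ≠ 0 → u + (e - Finsupp.single i 1) = w := by
        intro h0
        ext j
        have := DFunLike.congr_fun hw' j
        by_cases hj : i = j
        · subst hj; simp at this ⊢; omega
        · simp [hj] at this ⊢; omega
      -- If u_i = 0 then w_i = e_i - 1, and the binomial coefficient at w supplies the zero.
      have e3 : (if u i ≠ 0 then (multiChoose (u - Finsupp.single i 1 + e) e : F) *
          coeff (u - Finsupp.single i 1 + e) f else 0) = multiChoose w e * coeff w f := by
        by_cases h0 : u i = 0
        · have hwi : w i + 1 = e i := by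
            have := DFunLike.congr_fun hw' i
            simp at this; omega
          have : multiChoose w e = 0 := by
            refine Finset.prod_eq_zero (Finset.mem_univ i) ?_
            exact Nat.choose_eq_zero_of_lt (by omega)
          simp [this, h0]
        · rw [if_pos h0, e1 h0]
      have e4 : (if e i ≠ 0 then (multiChoose (u + (e - Finsupp.single i 1))
          (e - Finsupp.single i 1) : F) * coeff (u + (e - Finsupp.single i 1)) f else 0) =
          (if e i = 0 then 0 else multiChoose w (e - Finsupp.single i 1) : ℕ) * coeff w f := by
        by_cases h0 : e i = 0
        · simp [h0]
        · rw [if_pos h0, if_neg h0, e2 h0]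
      rw [e3, e4, if_pos hw, hw', multiChoose_add_single, add_tsub_cancel_right]
      push_cast
      ring

theorem hasseDeriv_hasseDeriv (u e : Fin k →₀ ℕ) (f : MvPolynomial (Fin k) F) :
    hasseDeriv u (hasseDeriv e f) = (multiChoose (u + e) e : F) • hasseDeriv (u + e) f := by
  ext w
  rw [coeff_hasseDeriv, coeff_hasseDeriv, coeff_smul, coeff_hasseDeriv, ← mul_assoc, smul_eq_mul,
    ← mul_assoc, ← add_assoc]
  rw [← Nat.cast_mul, ← Nat.cast_mul, multiChoose_mul w u e]

theorem hasseDeriv_eq_zero_of_totalDegree_lt {e : Fin k →₀ ℕ} {f : MvPolynomial (Fin k) F}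
    (h : f.totalDegree < e.degree) : hasseDeriv e f = 0 := by
  ext u
  rw [coeff_hasseDeriv, coeff_eq_zero_of_totalDegree_lt, mul_zero, coeff_zero]
  refine h.trans_le ?_
  rw [← Finsupp.degree_apply, map_add]
  omega

theorem totalDegree_le_of_coeff {f : MvPolynomial (Fin k) F} {d : ℕ}
    (h : ∀ u : Fin k →₀ ℕ, d < u.degree → coeff u f = 0) : f.totalDegree ≤ d := by
  refine Finset.sup_le fun u hu => ?_
  by_contra hlt
  rw [mem_support_iff] at hu
  exact hu (h u (by simpa [Finsupp.degree_apply, Finsupp.sum] using hlt))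

theorem coeff_eq_zero_of_degree {f : MvPolynomial (Fin k) F} {d : ℕ} (hf : f.totalDegree ≤ d)
    {u : Fin k →₀ ℕ} (hu : d < u.degree) : coeff u f = 0 :=
  coeff_eq_zero_of_totalDegree_lt (hf.trans_lt (by simpa [Finsupp.degree_apply] using hu))

theorem totalDegree_hasseDeriv_le (e : Fin k →₀ ℕ) (f : MvPolynomial (Fin k) F) :
    (hasseDeriv e f).totalDegree ≤ f.totalDegree := by
  refine totalDegree_le_of_coeff fun u hu => ?_
  rw [coeff_hasseDeriv, coeff_eq_zero_of_degree le_rfl, mul_zero]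
  rw [map_add]; omega

/-- The translation `f ↦ f (x + a)`. -/
noncomputable def translate (a : Fin k → F) :
    MvPolynomial (Fin k) F →ₐ[F] MvPolynomial (Fin k) F :=
  aeval (fun i => X i + C (a i))

theorem translate_neg_translate (a : Fin k → F) (f : MvPolynomial (Fin k) F) :
    translate (-a) (translate a f) = f := by
  have : (translate (-a)).comp (translate a) = AlgHom.id F _ := by
    ext i
    simp [translate]
  exact DFunLike.congr_fun this f

theorem translate_translate_neg (a : Fin k → F) (f : MvPolynomial (Fin k) F) :
    translate a (translate (-a) f) = f := by
  simpa using translate_neg_translate (-a) f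

/-- The coefficient of `z ^ e` in `f (a + z)`. -/
noncomputable def jet (a : Fin k → F) (e : Fin k →₀ ℕ) : MvPolynomial (Fin k) F →ₗ[F] F :=
  (lcoeff F e).comp (translate a).toLinearMap

theorem jet_apply (a : Fin k → F) (e : Fin k →₀ ℕ) (f : MvPolynomial (Fin k) F) :
    jet a e f = coeff e (translate a f) := rfl

/-- Evaluating the coefficients at a commutes with expanding in z. The entries of a codeword thus
become Taylor coefficients, which are linear functionals of f. -/
theorem eval_hasseDeriv (a : Fin k → F) (e : Fin k →₀ ℕ) (f : MvPolynomial (Fin k) F) :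
    eval a (hasseDeriv e f) = jet a e f := by
  have h : (MvPolynomial.mapAlgHom (σ := Fin k) (MvPolynomial.aeval a : _ →ₐ[F] F)).comp
      taylorExpand = translate a := by
    ext i
    simp [taylorExpand, translate, add_comm]
  rw [jet_apply, ← h, hasseDeriv_eq, AlgHom.comp_apply, mapAlgHom_apply, coeff_map]
  rfl

theorem jet_hasseDeriv (a : Fin k → F) (u e : Fin k →₀ ℕ) (f : MvPolynomial (Fin k) F) :
    jet a u (hasseDeriv e f) = (multiChoose (u + e) e : F) * jet a (u + e) f := by
  rw [← eval_hasseDeriv, hasseDeriv_hasseDeriv, smul_eval, eval_hasseDeriv]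

theorem jet_mul (a : Fin k → F) (u : Fin k →₀ ℕ) (f g : MvPolynomial (Fin k) F) :
    jet a u (f * g) = ∑ p ∈ Finset.HasAntidiagonal.antidiagonal u, jet a p.1 f * jet a p.2 g := by
  simp only [jet_apply, map_mul, coeff_mul]

theorem jet_eq_zero_of_degree {d : ℕ} {f : MvPolynomial (Fin k) F} (hf : f.totalDegree ≤ d)
    (a : Fin k → F) {e : Fin k →₀ ℕ} (he : d < e.degree) : jet a e f = 0 := by
  rw [← eval_hasseDeriv, hasseDeriv_eq_zero_of_totalDegree_lt (hf.trans_lt he), map_zero]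

theorem totalDegree_translate_le (a : Fin k → F) (f : MvPolynomial (Fin k) F) :
    (translate a f).totalDegree ≤ f.totalDegree :=
  totalDegree_le_of_coeff fun _ hu => jet_eq_zero_of_degree le_rfl a hu

/-- This closed form, built from binomials and powers only, is what the decoder evaluates. -/
theorem jet_monomial (a : Fin k → F) (e μ : Fin k →₀ ℕ) :
    jet a e (monomial μ 1) = ∏ i, (((μ i).choose (e i) : ℕ) : F) * a i ^ (μ i - e i) := by
  have h : hasseDeriv e (monomial μ (1 : F)) = monomial (μ - e) (multiChoose μ e : F) := by
    ext u
    rw [coeff_hasseDeriv, coeff_monomial, coeff_monomial]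
    by_cases h1 : μ = u + e
    · subst h1; simp
    · rw [if_neg h1, mul_zero]
      split_ifs with h2
      · obtain ⟨i, hi⟩ : ∃ i, μ i < e i := by
          by_contra hcon
          push Not at hcon
          apply h1
          rw [← h2]
          ext i
          have := hcon i
          simp; omega
        have : multiChoose μ e = 0 :=
          Finset.prod_eq_zero (Finset.mem_univ i) (Nat.choose_eq_zero_of_lt hi)
        simp [this]
      · rfl
  rw [← eval_hasseDeriv, h, eval_monomial, Finsupp.prod_fintype _ _ (by simp)]
  simp [multiChoose, Finset.prod_mul_distrib]

/-- `f` vanishes at `a` to order at least `n`. -/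
def VanishesTo (a : Fin k → F) (n : ℕ) (f : MvPolynomial (Fin k) F) : Prop :=
  ∀ e : Fin k →₀ ℕ, e.degree < n → jet a e f = 0

theorem VanishesTo.mul {a : Fin k → F} {n m : ℕ} {f g : MvPolynomial (Fin k) F}
    (hf : VanishesTo a n f) (hg : VanishesTo a m g) : VanishesTo a (n + m) (f * g) := by
  intro e he
  rw [jet_mul]
  refine Finset.sum_eq_zero fun p hp => ?_
  have hp' : p.1.degree + p.2.degree = e.degree := by
    rw [← map_add, Finset.HasAntidiagonal.mem_antidiagonal.1 hp]
  by_cases h : p.1.degree < n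
  · rw [hf _ h, zero_mul]
  · rw [hg _ (by omega), mul_zero]

theorem VanishesTo.smul {a : Fin k → F} {n : ℕ} {f : MvPolynomial (Fin k) F}
    (hf : VanishesTo a n f) (c : F) : VanishesTo a n (c • f) := fun e he => by
  rw [map_smul, hf e he, smul_zero]

theorem VanishesTo.sum {ι : Type*} {s : Finset ι} {a : Fin k → F} {n : ℕ}
    {f : ι → MvPolynomial (Fin k) F} (hf : ∀ i ∈ s, VanishesTo a n (f i)) :
    VanishesTo a n (∑ i ∈ s, f i) := fun e he => by
  rw [map_sum]
  exact Finset.sum_eq_zero fun i hi => hf i hi e he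

theorem VanishesTo.prod {ι : Type*} {s : Finset ι} {a : Fin k → F} {n : ι → ℕ}
    {f : ι → MvPolynomial (Fin k) F} (hf : ∀ i ∈ s, VanishesTo a (n i) (f i)) :
    VanishesTo a (∑ i ∈ s, n i) (∏ i ∈ s, f i) := by
  classical
  induction s using Finset.induction_on with
  | empty => intro e he; simp at he
  | insert i s hi ih =>
    rw [Finset.sum_insert hi, Finset.prod_insert hi]
    exact (hf i (by simp)).mul (ih fun j hj => hf j (by simp [hj]))

/-- By the composition law, the order-u jet of ∂_e f is a multiple of the order-(u+e) jet of f. -/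
theorem VanishesTo.hasseDeriv {a : Fin k → F} {n : ℕ} {f : MvPolynomial (Fin k) F}
    (hf : VanishesTo a n f) (e : Fin k →₀ ℕ) : VanishesTo a (n - e.degree) (hasseDeriv e f) := by
  intro u hu
  rw [jet_hasseDeriv, hf, mul_zero]
  rw [map_add]; omega

theorem encode_eq (S : Finset F) (s : ℕ) (f : MvPolynomial (Fin k) F) (a : Fin k → S)
    (e : DerivIndex k s) : encode S s f a e = jet (fun i => (a i : F)) e.1 f :=
  eval_hasseDeriv _ _ _

end Jets

/-! ### Schwartz–Zippel with multiplicities -/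

section SchwartzZippel

/-- Apply a linear functional to the coefficients of a polynomial. -/
noncomputable def mapCoeff {F R : Type*} [Field F] [CommRing R] [Algebra F R] (l : R →ₗ[F] F)
    (q : Polynomial R) : Polynomial F :=
  ∑ j ∈ Finset.range (q.natDegree + 1), Polynomial.monomial j (l (q.coeff j))

section MapCoeff

variable {F R : Type*} [Field F] [CommRing R] [Algebra F R] (l : R →ₗ[F] F)

theorem coeff_mapCoeff (q : Polynomial R) (j : ℕ) :
    (mapCoeff l q).coeff j = l (q.coeff j) := by
  simp only [mapCoeff, Polynomial.finsetSum_coeff, Polynomial.coeff_monomial]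
  rw [Finset.sum_ite_eq' (Finset.range (q.natDegree + 1)) j]
  split_ifs with h
  · rfl
  · rw [Polynomial.coeff_eq_zero_of_natDegree_lt, map_zero]
    simpa using h

/-- A shift of the variable by a scalar of F mixes the coefficients F-linearly, so it commutes with
a functional that is linear but not multiplicative. -/
theorem mapCoeff_comp (q : Polynomial R) (b : F) :
    mapCoeff l (q.comp (Polynomial.X + Polynomial.C (algebraMap F R b))) =
      (mapCoeff l q).comp (Polynomial.X + Polynomial.C b) := by
  induction q using Polynomial.induction_on' with
  | add p q hp hq =>
    have hadd : ∀ p q : Polynomial R, mapCoeff l (p + q) = mapCoeff l p + mapCoeff l q := by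
      intro p q
      ext j
      simp [coeff_mapCoeff]
    rw [Polynomial.add_comp, hadd, hadd, Polynomial.add_comp, hp, hq]
  | monomial n r =>
    have h1 : mapCoeff l (Polynomial.monomial n r) = Polynomial.monomial n (l r) := by
      ext j
      rw [coeff_mapCoeff, Polynomial.coeff_monomial, Polynomial.coeff_monomial]
      split_ifs <;> simp
    have h2 : (Polynomial.X + Polynomial.C (algebraMap F R b)) ^ n =
        ((Polynomial.X + Polynomial.C b) ^ n).map (algebraMap F R) := by
      simp
    rw [h1, Polynomial.monomial_comp, Polynomial.monomial_comp, h2]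
    ext j
    rw [coeff_mapCoeff, Polynomial.coeff_C_mul, Polynomial.coeff_C_mul, Polynomial.coeff_map,
      mul_comm, ← Algebra.smul_def, map_smul, smul_eq_mul, mul_comm]

end MapCoeff

variable {F : Type*} [Field F] {k : ℕ}

/-- Lets a multivariate translation be carried out in two stages: the last k variables inside the
coefficients, then the first variable as a univariate shift. -/
theorem finSuccEquiv_translate (b : F) (y : Fin k → F) (f : MvPolynomial (Fin (k + 1)) F) :
    finSuccEquiv F k (translate (Fin.cons b y) f) =
      ((finSuccEquiv F k f).map (translate y : MvPolynomial (Fin k) F →ₐ[F] _).toRingHom).comp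
        (Polynomial.X + Polynomial.C (algebraMap F _ b)) := by
  have hC : ∀ c : F, finSuccEquiv F k (C c) = Polynomial.C (C c) := fun c =>
    (finSuccEquiv F k).commutes c
  have htC : ∀ (m : ℕ) (a : Fin m → F) (c : F), translate a (C c) = C c := fun m a c =>
    (translate a).commutes c
  have htX : ∀ (m : ℕ) (a : Fin m → F) (i : Fin m), translate a (X i) = X i + C (a i) :=
    fun m a i => aeval_X _ _
  have key : ((finSuccEquiv F k).toAlgHom.toRingHom.comp (translate (Fin.cons b y) : _ →+* _)) =
      ((Polynomial.compRingHom (Polynomial.X + Polynomial.C (algebraMap F _ b))).comp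
        (Polynomial.mapRingHom (translate y : MvPolynomial (Fin k) F →ₐ[F] _).toRingHom)).comp
        (finSuccEquiv F k).toAlgHom.toRingHom := by
    refine MvPolynomial.ringHom_ext (fun c => ?_) fun i => ?_
    · simp only [RingHom.comp_apply, RingHom.coe_coe, AlgEquiv.coe_toAlgHom, htC, hC, Polynomial.coe_mapRingHom,
        Polynomial.map_C, Polynomial.coe_compRingHom_apply, Polynomial.C_comp,
        AlgHom.toRingHom_eq_coe]
    · refine Fin.cases ?_ (fun i => ?_) i
      · simp only [RingHom.comp_apply, AlgHom.toRingHom_eq_coe, RingHom.coe_coe,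
          AlgEquiv.coe_toAlgHom, htX, map_add, hC, finSuccEquiv_X_zero,
          Polynomial.coe_mapRingHom, Polynomial.map_X, Polynomial.coe_compRingHom_apply,
          Polynomial.X_comp, Fin.cons_zero, MvPolynomial.algebraMap_eq]
      · simp only [RingHom.comp_apply, AlgHom.toRingHom_eq_coe, RingHom.coe_coe,
          AlgEquiv.coe_toAlgHom, htX, map_add, hC, finSuccEquiv_X_succ,
          Polynomial.coe_mapRingHom, Polynomial.map_C, Polynomial.coe_compRingHom_apply,
          Polynomial.C_comp, Fin.cons_succ]
  exact RingHom.congr_fun key f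

theorem sum_le_natDegree_of_pow_dvd {n : ℕ} {x : Fin n → F} (hx : Function.Injective x)
    {h : Polynomial F} (h0 : h ≠ 0) (ν : Fin n → ℕ)
    (hν : ∀ b, (Polynomial.X - Polynomial.C (x b)) ^ ν b ∣ h) : ∑ b, ν b ≤ h.natDegree := by
  have hdvd : ∏ b, (Polynomial.X - Polynomial.C (x b)) ^ ν b ∣ h := by
    refine Finset.prod_dvd_of_coprime ?_ fun b _ => hν b
    intro i _ j _ hij
    exact (Polynomial.pairwise_coprime_X_sub_C hx hij).pow
  have := Polynomial.natDegree_le_of_dvd hdvd h0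
  rw [Polynomial.natDegree_prod_of_monic _ _ fun b _ => (Polynomial.monic_X_sub_C _).pow _] at this
  simpa using this

/-- Translation is invertible, so some Taylor coefficient at the point survives; one of least order
is taken. -/
theorem exists_jet_ne_zero {f : MvPolynomial (Fin k) F} (hf : f ≠ 0) (a : Fin k → F) :
    ∃ e : Fin k →₀ ℕ, jet a e f ≠ 0 ∧ VanishesTo a e.degree f := by
  classical
  have hex : ∃ m, ∃ e : Fin k →₀ ℕ, e.degree = m ∧ jet a e f ≠ 0 := by
    have h0 : translate a f ≠ 0 := fun h => hf (by
      rw [← translate_neg_translate a f, h, map_zero])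
    obtain ⟨e, he⟩ := MvPolynomial.ne_zero_iff.1 h0
    exact ⟨_, e, rfl, he⟩
  obtain ⟨e, he, hne⟩ := Nat.find_spec hex
  refine ⟨e, hne, fun u hu => ?_⟩
  by_contra hcon
  exact Nat.find_min hex (hu.trans_eq he) ⟨u, rfl, hcon⟩

/-- **Schwartz–Zippel with multiplicities** on a grid: the total order of vanishing of a nonzero
polynomial of degree at most `D` on a grid of `n ^ k` points is at most `D * n ^ (k - 1)`. -/
theorem mul_sum_vanishing_le {n : ℕ} {x : Fin n → F} (hx : Function.Injective x) :
    ∀ {k D : ℕ} {f : MvPolynomial (Fin k) F}, f ≠ 0 → f.totalDegree ≤ D →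
      ∀ ν : (Fin k → Fin n) → ℕ, (∀ a, VanishesTo (fun i => x (a i)) (ν a) f) →
        n * ∑ a, ν a ≤ D * n ^ k := by
  intro k
  induction k with
  | zero =>
    intro D f hf _ ν hν
    have h0 : ∀ a, ν a = 0 := by
      intro a
      by_contra hpos
      obtain ⟨e, he, -⟩ := exists_jet_ne_zero hf (fun i => x (a i))
      apply he
      apply hν a
      have : e = 0 := Subsingleton.elim _ _
      rw [this]; simp; omega
    simp [h0]
  | succ k ih =>
    intro D f hf hD ν hν
    set p := finSuccEquiv F k f with hp
    have hp0 : p ≠ 0 := by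
      rw [hp]; simpa using hf
    have hlead : p.coeff p.natDegree ≠ 0 := by
      simpa using hp0
    have hdeg : (p.coeff p.natDegree).totalDegree + p.natDegree ≤ D :=
      (totalDegree_coeff_finSuccEquiv_add_le f _ hlead).trans hD
    -- At each point of the smaller grid, a least-order jet under which the leading coefficient
    -- survives. The induction hypothesis bounds the sum of these orders.
    choose e' he' hvan using fun a' : Fin k → Fin n =>
      exists_jet_ne_zero hlead (fun i => x (a' i))
    have hrow : ∀ a' : Fin k → Fin n,
        ∑ b, ν (Fin.cons b a') ≤ n * (e' a').degree + p.natDegree := by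
      intro a'
      set y : Fin k → F := fun i => x (a' i)
      -- Applying that jet to every coefficient leaves a univariate polynomial. It is nonzero
      -- because the leading coefficient survives, and it inherits the zeros of f on the line with
      -- orders lowered by at most |e'|.
      set h : Polynomial F := mapCoeff (jet y (e' a')) p with hh
      have hcoeff : ∀ j, h.coeff j = jet y (e' a') (p.coeff j) := coeff_mapCoeff _ _
      have h0 : h ≠ 0 := by
        intro hz
        apply he' a'
        rw [← hcoeff, hz, Polynomial.coeff_zero]
      have hdegh : h.natDegree ≤ p.natDegree := by
        refine Polynomial.natDegree_le_iff_coeff_eq_zero.2 fun j hj => ?_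
        rw [hcoeff, Polynomial.coeff_eq_zero_of_natDegree_lt hj, map_zero]
      have hdvd : ∀ b, (Polynomial.X - Polynomial.C (x b)) ^ (ν (Fin.cons b a') - (e' a').degree)
          ∣ h := by
        intro b
        have hX : Polynomial.X ^ (ν (Fin.cons b a') - (e' a').degree) ∣
            h.comp (Polynomial.X + Polynomial.C (x b)) := by
          rw [Polynomial.X_pow_dvd_iff]
          intro j hj
          have h1 : h = mapCoeff (lcoeff F (e' a'))
              (p.map (translate y : MvPolynomial (Fin k) F →ₐ[F] _).toRingHom) := by
            ext j
            rw [hcoeff, coeff_mapCoeff, Polynomial.coeff_map]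
            rfl
          rw [h1, ← mapCoeff_comp, ← finSuccEquiv_translate, coeff_mapCoeff, lcoeff_apply,
            finSuccEquiv_coeff_coeff, ← jet_apply]
          have hpt : (fun i => x ((Fin.cons b a' : Fin (k + 1) → Fin n) i)) =
              (Fin.cons (x b) y : Fin (k + 1) → F) := by
            ext i
            refine Fin.cases ?_ (fun i => ?_) i <;> simp [y]
          have := hν (Fin.cons b a')
          rw [hpt] at this
          apply this
          have hdc : (Finsupp.cons j (e' a')).degree = j + (e' a').degree := by
            simp [Finsupp.degree_eq_sum, Fin.sum_univ_succ]
          rw [hdc]; omega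
        have := (Polynomial.compRingHom (Polynomial.X - Polynomial.C (x b))).map_dvd hX
        simpa [Polynomial.comp_assoc] using this
      have hsum := sum_le_natDegree_of_pow_dvd hx h0 _ hdvd
      -- The truncated subtraction is harmless: ν ≤ |e'| + (ν - |e'|) holds in all cases.
      calc ∑ b, ν (Fin.cons b a')
          ≤ ∑ b, ((e' a').degree + (ν (Fin.cons b a') - (e' a').degree)) :=
            Finset.sum_le_sum fun b _ => by omega
        _ = n * (e' a').degree + ∑ b, (ν (Fin.cons b a') - (e' a').degree) := by
            rw [Finset.sum_add_distrib]; simp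
        _ ≤ _ := by omega
    have hih := ih hlead le_rfl (fun a' => (e' a').degree) hvan
    have hsplit : ∑ a, ν a = ∑ a' : Fin k → Fin n, ∑ b, ν (Fin.cons b a') := by
      rw [← (Fin.consEquiv (fun _ => Fin n)).sum_comp, Fintype.sum_prod_type, Finset.sum_comm]
      rfl
    calc n * ∑ a, ν a ≤ n * ∑ a' : Fin k → Fin n, (n * (e' a').degree + p.natDegree) := by
          rw [hsplit]
          exact Nat.mul_le_mul_left _ (Finset.sum_le_sum fun a' _ => hrow a')
      _ = n * (n * ∑ a' : Fin k → Fin n, (e' a').degree) + n * (n ^ k * p.natDegree) := by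
          rw [Finset.sum_add_distrib, ← Finset.mul_sum, mul_add]; simp
      _ ≤ n * ((p.coeff p.natDegree).totalDegree * n ^ k) + n * (n ^ k * p.natDegree) := by
          gcongr
      _ = ((p.coeff p.natDegree).totalDegree + p.natDegree) * n ^ (k + 1) := by ring
      _ ≤ D * n ^ (k + 1) := Nat.mul_le_mul_right _ hdeg

end SchwartzZippel

/-! ### The generalized Wronskian criterion -/

section Wronskian

variable {F : Type*} [Field F] {k : ℕ}

theorem hasseDeriv_zero (f : MvPolynomial (Fin k) F) : hasseDeriv 0 f = f := by
  ext u
  rw [coeff_hasseDeriv]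
  simp [multiChoose]

theorem hasseDeriv_single_mul (i : Fin k) (f g : MvPolynomial (Fin k) F) :
    hasseDeriv (Finsupp.single i 1) (f * g) =
      f * hasseDeriv (Finsupp.single i 1) g + hasseDeriv (Finsupp.single i 1) f * g := by
  have h : hasseDeriv (Finsupp.single i 1) (f * g) =
      ∑ p ∈ Finset.HasAntidiagonal.antidiagonal (Finsupp.single i 1),
        hasseDeriv p.1 f * hasseDeriv p.2 g := by
    simp only [hasseDeriv_eq, map_mul, coeff_mul]
  rw [h, Finsupp.antidiagonal_single, Finset.sum_map, Finset.Nat.antidiagonal_succ]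
  simp [hasseDeriv_zero]

theorem hasseDeriv_single_hasseDeriv (i : Fin k) (e : Fin k →₀ ℕ) (f : MvPolynomial (Fin k) F) :
    hasseDeriv (Finsupp.single i 1) (hasseDeriv e f) =
      ((e i + 1 : ℕ) : F) • hasseDeriv (e + Finsupp.single i 1) f := by
  rw [hasseDeriv_hasseDeriv, add_comm (Finsupp.single i 1) e]
  congr 2
  rw [multiChoose, ← Finset.mul_prod_erase _ _ (Finset.mem_univ i), Finset.prod_eq_one]
  · simp
  · intro j hj
    simp [(Finset.ne_of_mem_erase hj).symm]

/-- The relations for all e together say ∑ c_j(x) f_j(x+z) = 0. Substituting z - x for z gives ∑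
c_j(x) f_j(z) = 0, and comparing coefficients in x leaves linear relations over F between the f_j.
-/
theorem eq_zero_of_sum_mul_hasseDeriv_eq_zero {ι : Type*} [Fintype ι]
    {f : ι → MvPolynomial (Fin k) F} (hf : LinearIndependent F f)
    {c : ι → MvPolynomial (Fin k) F} (h : ∀ e, ∑ j, c j * hasseDeriv e (f j) = 0) : c = 0 := by
  let φ : MvPolynomial (Fin k) (MvPolynomial (Fin k) F) →+*
      MvPolynomial (Fin k) (MvPolynomial (Fin k) F) := eval₂Hom C (fun i => X i - C (X i))
  have hφC : ∀ g, φ (C g) = C g := fun g => eval₂Hom_C _ _ g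
  have hφX : ∀ i, φ (X i) = X i - C (X i) := fun i => eval₂Hom_X' _ _ i
  have hφ : ∀ g : MvPolynomial (Fin k) F, φ (taylorExpand g) = map C g := by
    have key : φ.comp (taylorExpand (F := F) (k := k) : _ →+* _) = map C := by
      refine MvPolynomial.ringHom_ext (fun a => ?_) fun i => ?_
      · have : taylorExpand (C a : MvPolynomial (Fin k) F) = C (C a) := by
          rw [taylorExpand, aeval_C, MvPolynomial.algebraMap_apply, MvPolynomial.algebraMap_eq]
        rw [RingHom.comp_apply, RingHom.coe_coe, this, hφC, map_C]
      · have : taylorExpand (X i : MvPolynomial (Fin k) F) = C (X i) + X i := aeval_X _ _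
        rw [RingHom.comp_apply, RingHom.coe_coe, this, map_add, hφC, hφX, map_X]
        ring
    exact fun g => RingHom.congr_fun key g
  have h1 : ∑ j, C (c j) * taylorExpand (f j) = 0 := by
    ext1 e
    rw [coeff_sum, coeff_zero, ← h e]
    exact Finset.sum_congr rfl fun j _ => by rw [coeff_C_mul, hasseDeriv_eq]
  have h2 : ∑ j, C (c j) * map C (f j) =
      (0 : MvPolynomial (Fin k) (MvPolynomial (Fin k) F)) := by
    have := congrArg φ h1
    rw [map_sum, map_zero] at this
    rw [← this]
    refine Finset.sum_congr rfl fun j _ => ?_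
    rw [map_mul, hφ, hφC]
  ext1 j
  ext1 ν
  have h3 : ∑ j, coeff ν (c j) • f j = 0 := by
    ext1 μ
    have := congrArg (fun q => coeff ν (coeff μ q)) h2
    simp only [coeff_sum, coeff_C_mul, coeff_map, coeff_zero] at this
    rw [coeff_sum, coeff_zero, ← this]
    exact Finset.sum_congr rfl fun j _ => by
      rw [coeff_smul, smul_eq_mul, mul_comm (c j), coeff_C_mul, mul_comm]
  exact Fintype.linearIndependent_iff.1 hf _ h3 j

/-- The generalized Wronskian criterion, for characteristic zero or larger than the degree. -/
theorem exists_wronskian_ne_zero {d : ℕ} (hchar : ringChar F = 0 ∨ d < ringChar F) :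
    ∀ {r : ℕ} {f : Fin r → MvPolynomial (Fin k) F}, LinearIndependent F f →
      (∀ j, (f j).totalDegree ≤ d) → ∃ e : Fin r → (Fin k →₀ ℕ), (∀ i, (e i).degree < r) ∧
        (Matrix.of fun i j => hasseDeriv (e i) (f j)).det ≠ 0 := by
  intro r
  induction r with
  | zero => intro f _ _; exact ⟨fun i => i.elim0, fun i => i.elim0, by simp⟩
  | succ r ih =>
    intro f hf hd
    obtain ⟨e', he', hdet⟩ := ih (f := fun j => f j.succ)
      (hf.comp _ (Fin.succ_injective r)) (fun j => hd _)
    by_contra hcon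
    push Not at hcon
    -- The cofactors of a row prepended to the nonsingular r-rowed Wronskian. If all Wronskians with
    -- r + 1 rows vanish, expansion along that row gives a relation for every order up to r.
    set c : Fin (r + 1) → MvPolynomial (Fin k) F := fun j => (-1) ^ (j : ℕ) *
      (Matrix.of fun i l : Fin r => hasseDeriv (e' i) (f (j.succAbove l))).det with hc
    have hc0 : c 0 ≠ 0 := by simpa [hc] using hdet
    have hrel : ∀ e : Fin k →₀ ℕ, e.degree < r + 1 → ∑ j, c j * hasseDeriv e (f j) = 0 := by
      intro e he
      have h := hcon (Fin.cons e e') (by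
        intro i
        refine Fin.cases ?_ (fun i => ?_) i
        · simpa using he
        · simpa using (he' i).trans (Nat.lt_succ_self r))
      rw [Matrix.det_succ_row_zero] at h
      rw [← h]
      refine Finset.sum_congr rfl fun j _ => ?_
      rw [hc, mul_right_comm]
      rfl
    have hD : ∀ i e, hasseDeriv (Finsupp.single i 1) (∑ j, c j * hasseDeriv e (f j)) =
        ∑ j, hasseDeriv (Finsupp.single i 1) (c j) * hasseDeriv e (f j) +
        ((e i + 1 : ℕ) : F) • ∑ j, c j * hasseDeriv (e + Finsupp.single i 1) (f j) := by
      intro i e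
      rw [← hasseDerivₗ_apply, map_sum, Finset.smul_sum, ← Finset.sum_add_distrib]
      refine Finset.sum_congr rfl fun j _ => ?_
      rw [hasseDerivₗ_apply, hasseDeriv_single_mul, hasseDeriv_single_hasseDeriv, mul_smul_comm,
        add_comm]
    -- The orders of the rows e'_t are below r, so the relations at e'_t and at e'_t + i both hold.
    -- Differentiating the former shows that ∂_i c satisfies the same r equations as c; since these
    -- have a nonsingular coefficient matrix, ∂_i c is proportional to c.
    have hprop : ∀ i j, c 0 * hasseDeriv (Finsupp.single i 1) (c j) =
        hasseDeriv (Finsupp.single i 1) (c 0) * c j := by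
      intro i
      have hz : (fun l : Fin r => c 0 * hasseDeriv (Finsupp.single i 1) (c l.succ) -
          hasseDeriv (Finsupp.single i 1) (c 0) * c l.succ) = 0 := by
        refine Matrix.eq_zero_of_mulVec_eq_zero hdet ?_
        ext1 t
        have hdeg : (e' t + Finsupp.single i 1 : Fin k →₀ ℕ).degree < r + 1 := by
          have := he' t
          rw [map_add, Finsupp.degree_single]; omega
        have h1 := hrel (e' t) ((he' t).trans (Nat.lt_succ_self r))
        have h2 : ∑ j, hasseDeriv (Finsupp.single i 1) (c j) * hasseDeriv (e' t) (f j) = 0 := by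
          have := hD i (e' t)
          rwa [h1, hrel _ hdeg, smul_zero, add_zero, ← hasseDerivₗ_apply, map_zero, eq_comm] at this
        rw [Fin.sum_univ_succ] at h1 h2
        simp only [Matrix.mulVec, dotProduct, Matrix.of_apply, Pi.zero_apply]
        have h3 : ∀ l : Fin r, hasseDeriv (e' t) (f l.succ) *
            (c 0 * hasseDeriv (Finsupp.single i 1) (c l.succ) -
              hasseDeriv (Finsupp.single i 1) (c 0) * c l.succ) =
            c 0 * (hasseDeriv (Finsupp.single i 1) (c l.succ) * hasseDeriv (e' t) (f l.succ)) -
            hasseDeriv (Finsupp.single i 1) (c 0) * (c l.succ * hasseDeriv (e' t) (f l.succ)) :=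
          fun l => by ring
        simp only [h3]
        rw [Finset.sum_sub_distrib, ← Finset.mul_sum, ← Finset.mul_sum]
        linear_combination c 0 * h2 - hasseDeriv (Finsupp.single i 1) (c 0) * h1
      intro j
      refine Fin.cases ?_ (fun l => ?_) j
      · ring
      · exact sub_eq_zero.1 (congrFun hz l)
    -- Proportionality lets the relation be differentiated without new terms, so it passes to all
    -- orders by induction.
    have hall : ∀ (N : ℕ) (e : Fin k →₀ ℕ), e.degree = N → ∑ j, c j * hasseDeriv e (f j) = 0 := by
      intro N
      induction N with
      | zero => intro e he; exact hrel e (by omega)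
      | succ N ihN =>
        intro e he
        obtain ⟨i, hi⟩ : ∃ i, e i ≠ 0 := by
          by_contra hz
          push Not at hz
          have : e = 0 := by ext i; simpa using hz i
          simp [this] at he
        obtain ⟨v, rfl⟩ : ∃ v, e = v + Finsupp.single i 1 := by
          refine ⟨e - Finsupp.single i 1, ?_⟩
          ext j
          by_cases hj : i = j
          · subst hj; simp; omega
          · simp [hj]
        rw [map_add, Finsupp.degree_single] at he
        have h1 := ihN v (by omega)
        have h2 := hD i v
        rw [h1, ← hasseDerivₗ_apply, map_zero] at h2
        have h3 : c 0 * ∑ j, hasseDeriv (Finsupp.single i 1) (c j) * hasseDeriv v (f j) = 0 := by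
          rw [Finset.mul_sum]
          simp only [← mul_assoc, hprop]
          simp only [mul_assoc]
          rw [← Finset.mul_sum, h1, mul_zero]
        rw [(mul_eq_zero.1 h3).resolve_left hc0, zero_add] at h2
        rcases smul_eq_zero.1 h2.symm with h4 | h4
        -- The factor v_i + 1 vanishes in F only if the characteristic is positive and divides it;
        -- the derivative then has order larger than d and kills every f_j.
        · have h5 : d < (v + Finsupp.single i 1).degree := by
            have hdvd := (ringChar.spec F _).1 h4
            have hle := Nat.le_of_dvd (Nat.succ_pos _) hdvd
            have hvi : v i ≤ v.degree := Finsupp.le_degree i v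
            rw [map_add, Finsupp.degree_single]
            rcases hchar with h | h
            · rw [h] at hdvd
              have := zero_dvd_iff.1 hdvd
              omega
            · omega
          refine Finset.sum_eq_zero fun j _ => ?_
          rw [hasseDeriv_eq_zero_of_totalDegree_lt ((hd j).trans_lt h5), mul_zero]
        · exact h4
    exact hc0 (congrFun (eq_zero_of_sum_mul_hasseDeriv_eq_zero hf fun e => hall _ e rfl) 0)

end Wronskian

/-! ### Multiplicity codes are subspace designs -/

section Design

variable {F : Type*} [Field F] {k : ℕ}

/-- The polynomials that vanish at `a` to order at least `s`. -/
def vanishing (a : Fin k → F) (s : ℕ) : Submodule F (MvPolynomial (Fin k) F) where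
  carrier := {f | VanishesTo a s f}
  add_mem' hf hg e he := by rw [map_add, hf e he, hg e he, add_zero]
  zero_mem' e _ := map_zero _
  smul_mem' c _ hf := hf.smul c

theorem mem_vanishing {a : Fin k → F} {s : ℕ} {f : MvPolynomial (Fin k) F} :
    f ∈ vanishing a s ↔ VanishesTo a s f := Iff.rfl

theorem VanishesTo.zero_order (a : Fin k → F) (f : MvPolynomial (Fin k) F) : VanishesTo a 0 f :=
  fun _ h => absurd h (Nat.not_lt_zero _)

theorem totalDegree_det_le {r d : ℕ} (M : Matrix (Fin r) (Fin r) (MvPolynomial (Fin k) F))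
    (hM : ∀ i j, (M i j).totalDegree ≤ d) : M.det.totalDegree ≤ r * d := by
  rw [Matrix.det_apply]
  refine totalDegree_finsetSum_le fun σ _ => ?_
  have h1 : (∏ i, M (σ i) i).totalDegree ≤ r * d := by
    refine (totalDegree_finsetProd _ _).trans ?_
    refine (Finset.sum_le_sum fun i _ => hM (σ i) i).trans ?_
    simp
  rcases Int.units_eq_one_or (Equiv.Perm.sign σ) with h | h
  · simpa [h] using h1
  · simpa [h] using h1

/-- Each term of the Leibniz expansion contains exactly one factor from every column in J. -/
theorem VanishesTo.det {r q : ℕ} {a : Fin k → F} {M : Matrix (Fin r) (Fin r) (MvPolynomial (Fin k) F)}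
    {J : Finset (Fin r)} (hM : ∀ i, ∀ j ∈ J, VanishesTo a q (M i j)) :
    VanishesTo a (J.card * q) M.det := by
  classical
  rw [Matrix.det_apply]
  refine VanishesTo.sum fun σ _ => ?_
  have h1 : VanishesTo a (J.card * q) (∏ i, M (σ i) i) := by
    have h2 := VanishesTo.prod (s := Finset.univ) (a := a) (n := fun i => if i ∈ J then q else 0)
      (f := fun i => M (σ i) i) (by
        intro i _
        split_ifs with h
        · exact hM _ _ h
        · exact VanishesTo.zero_order _ _)
    rwa [Finset.sum_ite_mem, Finset.univ_inter, Finset.sum_const, smul_eq_mul] at h2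
  rcases Int.units_eq_one_or (Equiv.Perm.sign σ) with h | h
  · simpa [h] using h1
  · simpa [h] using h1.smul (-1)

theorem exists_basis_subset_submodule {M : Type*} [AddCommGroup M] [Module F M]
    [FiniteDimensional F M] {r : ℕ} (hr : Module.finrank F M = r) (W : Submodule F M) :
    ∃ (g : Module.Basis (Fin r) F M) (J : Finset (Fin r)), J.card = Module.finrank F W ∧
      ∀ j ∈ J, g j ∈ W := by
  classical
  obtain ⟨W', hW'⟩ := W.exists_isCompl
  let b := ((Module.finBasis F W).prod (Module.finBasis F W')).map (W.prodEquivOfIsCompl W' hW')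
  have hcard : Fintype.card (Fin (Module.finrank F W) ⊕ Fin (Module.finrank F W')) =
      Fintype.card (Fin r) := by
    rw [← Module.finrank_eq_card_basis b, hr, Fintype.card_fin]
  let σ := Fintype.equivOfCardEq hcard
  refine ⟨b.reindex σ, Finset.univ.image fun i => σ (Sum.inl i), ?_, ?_⟩
  · exact (Finset.card_image_of_injective Finset.univ
      (σ.injective.comp Sum.inl_injective)).trans (by simp)
  · intro j hj
    obtain ⟨i, -, rfl⟩ := Finset.mem_image.1 hj
    simp [b]

/-- The subspace design property of multiplicity codes on a grid. -/
theorem mul_sum_finrank_inf_vanishing_le {n d s : ℕ} {x : Fin n → F}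
    (hx : Function.Injective x) (hchar : ringChar F = 0 ∨ d < ringChar F)
    (U : Submodule F (MvPolynomial (Fin k) F)) [FiniteDimensional F U]
    (hU : ∀ f ∈ U, f.totalDegree ≤ d) :
    n * ∑ a : Fin k → Fin n,
        Module.finrank F (U ⊓ vanishing (fun i => x (a i)) s : Submodule F _) *
          (s - (Module.finrank F U - 1)) ≤ Module.finrank F U * d * n ^ k := by
  classical
  set r := Module.finrank F U with hr
  let f := Module.finBasisOfFinrankEq F U hr.symm
  have hf : LinearIndependent F (fun j => (f j : MvPolynomial (Fin k) F)) :=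
    f.linearIndependent.map' U.subtype (Submodule.ker_subtype U)
  obtain ⟨e, he, hdet⟩ := exists_wronskian_ne_zero hchar hf fun j => hU _ (f j).2
  refine mul_sum_vanishing_le hx hdet (totalDegree_det_le _ fun i j => ?_) _ fun a => ?_
  · exact (totalDegree_hasseDeriv_le _ _).trans (hU _ (f j).2)
  set y : Fin k → F := fun i => x (a i)
  -- At each point, pass to a basis adapted to the subspace of polynomials vanishing there to order
  -- s. The change of basis is constant, so it only scales the Wronskian; its rows use derivatives
  -- of order at most r - 1, so each adapted column still vanishes to order s - (r - 1).
  obtain ⟨g, J, hJ, hg⟩ := exists_basis_subset_submodule hr.symm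
    ((vanishing y s).comap U.subtype)
  have hJ' : J.card = Module.finrank F (U ⊓ vanishing y s : Submodule F _) := by
    rw [hJ, ← Submodule.map_comap_subtype, Submodule.finrank_map_subtype_eq]
  set H : Matrix (Fin r) (Fin r) (MvPolynomial (Fin k) F) :=
    Matrix.of fun i j => hasseDeriv (e i) (g j : MvPolynomial (Fin k) F) with hH
  have hmul : (Matrix.of fun i j => hasseDeriv (e i) (f j : MvPolynomial (Fin k) F)) =
      H * (g.toMatrix f).map C := by
    ext1 i j
    have h1 : (f j : MvPolynomial (Fin k) F) = ∑ l, g.toMatrix f l j • (g l : MvPolynomial _ F) := by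
      have := congrArg Subtype.val (g.sum_toMatrix_smul_self f j)
      rw [← this, Submodule.coe_sum]
      rfl
    rw [Matrix.mul_apply, Matrix.of_apply, h1, ← hasseDerivₗ_apply, map_sum]
    refine Finset.sum_congr rfl fun l _ => ?_
    rw [map_smul, Matrix.map_apply, hH, Matrix.of_apply, mul_comm, ← smul_eq_C_mul,
      hasseDerivₗ_apply]
  rw [hmul, Matrix.det_mul, ← hJ', ← add_zero (J.card * _)]
  refine VanishesTo.mul (VanishesTo.det fun i j hj => ?_) (VanishesTo.zero_order _ _)
  have h1 : VanishesTo y s (g j : MvPolynomial (Fin k) F) := hg j hj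
  intro u hu
  refine h1.hasseDeriv (e i) u (hu.trans_le ?_)
  have := he i
  omega

end Design

/-! ### Pruning a subspace by random points -/

section Sampling

variable {F M : Type*} [Field F] [AddCommGroup M] [Module F M]

/-- Each intersection is again a subspace of V, so the hypothesis applies afresh and every further
point contributes one factor B. -/
theorem sum_finrank_inf_iInf_le {Y : Type*} [Fintype Y] {V : Submodule F M} {W : Y → Submodule F M}
    {B : ℝ} (hB : ∀ U ≤ V, ∑ a, (Module.finrank F (U ⊓ W a : Submodule F M) : ℝ) ≤
      B * Module.finrank F U) (hB0 : 0 ≤ B) (t : ℕ) :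
    ∀ U ≤ V, ∑ τ : Fin t → Y, (Module.finrank F (U ⊓ ⨅ i, W (τ i) : Submodule F M) : ℝ) ≤
      B ^ t * Module.finrank F U := by
  induction t with
  | zero =>
    intro U _
    simp only [pow_zero, one_mul, Finset.univ_unique, Finset.sum_singleton]
    rw [iInf_of_empty, inf_top_eq]
  | succ t ih =>
    intro U hU
    rw [← (Fin.consEquiv (fun _ => Y)).sum_comp, Fintype.sum_prod_type]
    calc _ = ∑ a, ∑ τ : Fin t → Y,
          (Module.finrank F ((U ⊓ W a) ⊓ ⨅ i, W (τ i) : Submodule F M) : ℝ) := by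
          refine Finset.sum_congr rfl fun a _ => Finset.sum_congr rfl fun τ _ => ?_
          have : (⨅ i, W ((Fin.consEquiv fun _ => Y) (a, τ) i)) = W a ⊓ ⨅ i, W (τ i) :=
            le_antisymm
              (le_inf (iInf_le _ 0) (le_iInf fun i => iInf_le_of_le i.succ le_rfl))
              (le_iInf (Fin.cases inf_le_left fun i => inf_le_right.trans (iInf_le _ i)))
          rw [this, inf_assoc]
      _ ≤ ∑ a, B ^ t * (Module.finrank F (U ⊓ W a : Submodule F M) : ℝ) :=
          Finset.sum_le_sum fun a _ => ih _ (inf_le_left.trans hU)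
      _ ≤ B ^ t * (B * Module.finrank F U) := by
          rw [← Finset.mul_sum]
          exact mul_le_mul_of_nonneg_left (hB U hU) (pow_nonneg hB0 t)
      _ = _ := by ring

/-- Markov's inequality: a tuple with nonzero intersection contributes at least one to the sum of
the dimensions. -/
theorem le_card_tuples_inf_eq_bot {Y : Type*} [Fintype Y] [DecidableEq Y] (A : Finset Y)
    {V : Submodule F M}
    [FiniteDimensional F V] {W : Y → Submodule F M} {B : ℝ}
    (hB : ∀ U ≤ V, ∑ a, (Module.finrank F (U ⊓ W a : Submodule F M) : ℝ) ≤
      B * Module.finrank F U) (hB0 : 0 ≤ B) (t : ℕ) :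
    (A.card : ℝ) ^ t - B ^ t * Module.finrank F V ≤
      {τ : Fin t → Y | (∀ i, τ i ∈ A) ∧ V ⊓ ⨅ i, W (τ i) = ⊥}.ncard := by
  classical
  -- The points are drawn from A alone; dropping the nonnegative terms outside A keeps the bound B.
  have h1 := sum_finrank_inf_iInf_le (Y := A) (V := V) (W := fun a => W a) (B := B) (by
    intro U hU
    refine le_trans ?_ (hB U hU)
    rw [Finset.sum_coe_sort A fun a => (Module.finrank F (U ⊓ W a : Submodule F M) : ℝ)]
    exact Finset.sum_le_univ_sum_of_nonneg fun a => Nat.cast_nonneg _) hB0 t V le_rfl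
  have h2 : ((Finset.univ.filter fun τ : Fin t → A => V ⊓ ⨅ i, W (τ i) ≠ ⊥).card : ℝ) ≤
      ∑ τ : Fin t → A, (Module.finrank F (V ⊓ ⨅ i, W (τ i) : Submodule F M) : ℝ) := by
    rw [Finset.card_filter, Nat.cast_sum]
    refine Finset.sum_le_sum fun τ _ => ?_
    split_ifs with h
    · have : FiniteDimensional F (V ⊓ ⨅ i, W (τ i) : Submodule F M) :=
        Submodule.finiteDimensional_of_le inf_le_left
      have := Submodule.one_le_finrank_iff.2 h
      exact_mod_cast this
    · simp
  have h3 : (Finset.univ.filter fun τ : Fin t → A => V ⊓ ⨅ i, W (τ i) = ⊥).card +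
      (Finset.univ.filter fun τ : Fin t → A => V ⊓ ⨅ i, W (τ i) ≠ ⊥).card = A.card ^ t := by
    rw [Finset.card_filter_add_card_filter_not]
    simp
  have h4 : (Finset.univ.filter fun τ : Fin t → A => V ⊓ ⨅ i, W (τ i) = ⊥).card ≤
      {τ : Fin t → Y | (∀ i, τ i ∈ A) ∧ V ⊓ ⨅ i, W (τ i) = ⊥}.ncard := by
    rw [← Set.ncard_coe_finset]
    refine Set.ncard_le_ncard_of_injOn (fun τ i => (τ i : Y)) ?_ ?_ (Set.toFinite _)
    · intro τ hτ
      exact ⟨fun i => (τ i).2, by simpa using hτ⟩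
    · intro τ _ τ' _ h
      ext i
      exact congrFun h i
  have h3' : ((Finset.univ.filter fun τ : Fin t → A => V ⊓ ⨅ i, W (τ i) = ⊥).card : ℝ) +
      (Finset.univ.filter fun τ : Fin t → A => V ⊓ ⨅ i, W (τ i) ≠ ⊥).card = (A.card : ℝ) ^ t := by
    exact_mod_cast h3
  have h4' : ((Finset.univ.filter fun τ : Fin t → A => V ⊓ ⨅ i, W (τ i) = ⊥).card : ℝ) ≤
      {τ : Fin t → Y | (∀ i, τ i ∈ A) ∧ V ⊓ ⨅ i, W (τ i) = ⊥}.ncard := by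
    exact_mod_cast h4
  linarith

end Sampling

/-! ### Interpolating differential operators and their solution space -/

section Interpolation

theorem DerivIndex.coord_lt {k s : ℕ} (e : DerivIndex k s) (i : Fin k) : e.1 i < s :=
  (Finsupp.le_degree i e.1).trans_lt e.2

/-- An exponent vector as a vector of bounded coordinates. -/
def DerivIndex.toFun {k s : ℕ} (e : DerivIndex k s) : Fin k → Fin s :=
  fun i => ⟨e.1 i, e.coord_lt i⟩

theorem DerivIndex.toFun_injective {k s : ℕ} :
    Function.Injective (DerivIndex.toFun : DerivIndex k s → Fin k → Fin s) := by
  intro e e' h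
  apply Subtype.ext
  ext i
  exact congrArg Fin.val (congrFun h i)

noncomputable instance (k s : ℕ) : Fintype (DerivIndex k s) :=
  Fintype.ofInjective _ DerivIndex.toFun_injective

theorem card_derivIndex_le (k s : ℕ) : Fintype.card (DerivIndex k s) ≤ s ^ k := by
  simpa using Fintype.card_le_of_injective _ (DerivIndex.toFun_injective (k := k) (s := s))

/-- Stars and bars: a slack coordinate turns the inequality on the degree into an equality. -/
theorem card_derivIndex (k s : ℕ) :
    Fintype.card (DerivIndex k (s + 1)) = (s + k).choose k := by
  have e1 : {P : Fin (k + 1) → ℕ // ∑ i, P i = s} ≃ DerivIndex k (s + 1) :=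
    { toFun := fun P => ⟨Finsupp.equivFunOnFinite.symm fun i => P.1 i.succ, by
        have := P.2
        rw [Fin.sum_univ_succ] at this
        rw [Finsupp.degree_eq_sum]
        simp only [Finsupp.coe_equivFunOnFinite_symm]
        omega⟩
      invFun := fun e => ⟨Fin.cons (s - e.1.degree) e.1, by
        have := e.2
        rw [Fin.sum_univ_succ, Fin.cons_zero]
        simp only [Fin.cons_succ]
        rw [← Finsupp.degree_eq_sum]
        omega⟩
      left_inv := fun P => by
        apply Subtype.ext
        ext i
        refine Fin.cases ?_ (fun i => ?_) i
        · have := P.2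
          rw [Fin.sum_univ_succ] at this
          simp only [Fin.cons_zero]
          rw [Finsupp.degree_eq_sum]
          simp only [Finsupp.coe_equivFunOnFinite_symm]
          omega
        · simp
      right_inv := fun e => by
        apply Subtype.ext
        ext i
        simp }
  rw [← Fintype.card_congr ((Sym.equivNatSumOfFintype (Fin (k + 1)) s).trans e1),
    Sym.card_sym_eq_choose, Fintype.card_fin, ← Nat.choose_symm_of_eq_add]
  · congr 1; omega
  · omega

variable {F : Type*} [Field F] {k : ℕ}

/-- The polynomial of degree less than `b` with given coefficients. -/
noncomputable def polyOf {b : ℕ} : (DerivIndex k b → F) →ₗ[F] MvPolynomial (Fin k) F :=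
  Fintype.linearCombination F fun κ => monomial κ.1 1

theorem polyOf_apply {b : ℕ} (c : DerivIndex k b → F) :
    polyOf c = ∑ κ, c κ • monomial κ.1 (1 : F) := rfl

theorem coeff_polyOf {b : ℕ} (c : DerivIndex k b → F) (κ : DerivIndex k b) :
    coeff κ.1 (polyOf c) = c κ := by
  classical
  rw [polyOf_apply, coeff_sum, Finset.sum_eq_single κ]
  · simp
  · intro κ' _ h
    simp only [coeff_smul, coeff_monomial]
    rw [if_neg (fun h' => h (Subtype.ext h')), smul_zero]
  · simp

theorem totalDegree_polyOf_le {d : ℕ} (c : DerivIndex k (d + 1) → F) :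
    (polyOf c).totalDegree ≤ d := by
  rw [polyOf_apply]
  refine totalDegree_finsetSum_le fun κ _ => (totalDegree_smul_le _ _).trans ?_
  rw [totalDegree_monomial _ one_ne_zero]
  exact Nat.lt_succ_iff.1 κ.2

theorem polyOf_coeff {d : ℕ} {f : MvPolynomial (Fin k) F} (hf : f.totalDegree ≤ d) :
    polyOf (fun κ : DerivIndex k (d + 1) => coeff κ.1 f) = f := by
  ext u
  by_cases hu : u.degree < d + 1
  · exact coeff_polyOf (fun κ : DerivIndex k (d + 1) => coeff κ.1 f) ⟨u, hu⟩
  · rw [coeff_eq_zero_of_degree hf (by omega),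
      coeff_eq_zero_of_degree (totalDegree_polyOf_le _) (by omega)]

theorem jet_polyOf {b : ℕ} (a : Fin k → F) (u : Fin k →₀ ℕ) (c : DerivIndex k b → F) :
    jet a u (polyOf c) = ∑ κ, c κ * jet a u (monomial κ.1 1) := by
  simp [polyOf_apply]

/-- The contribution of the monomial `x ^ μ` of `A_e` to the order-`u` jet at `a` of `∑ A_e ∂_e f`,
where the jets of `f` at `a` are given by `y`. -/
noncomputable def interpCoeff (a : Fin k → F) (u e μ : Fin k →₀ ℕ) (y : (Fin k →₀ ℕ) → F) : F :=
  ∑ p ∈ Finset.HasAntidiagonal.antidiagonal u,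
    jet a p.1 (monomial μ 1) * ((multiChoose (p.2 + e) e : F) * y (p.2 + e))

/-- The differential operator `f ↦ ∑ A_e ∂_e f` whose coefficients `A_e` are given by `Q`. -/
noncomputable def diffOp {m b : ℕ} (Q : DerivIndex k m × DerivIndex k b → F)
    (f : MvPolynomial (Fin k) F) : MvPolynomial (Fin k) F :=
  ∑ e, polyOf (fun μ => Q (e, μ)) * hasseDeriv e.1 f

theorem jet_diffOp {m b : ℕ} (Q : DerivIndex k m × DerivIndex k b → F)
    (f : MvPolynomial (Fin k) F) (a : Fin k → F) (u : Fin k →₀ ℕ) :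
    jet a u (diffOp Q f) = ∑ p, Q p * interpCoeff a u p.1.1 p.2.1 fun v => jet a v f := by
  rw [diffOp, map_sum, Fintype.sum_prod_type]
  refine Finset.sum_congr rfl fun e _ => ?_
  simp only [jet_mul, jet_polyOf, jet_hasseDeriv, interpCoeff, Finset.sum_mul, Finset.mul_sum]
  rw [Finset.sum_comm]
  refine Finset.sum_congr rfl fun μ _ => Finset.sum_congr rfl fun p _ => by ring

/-- Only jets of order at most |u| + |e| enter. This is why operators of order m are tested to order
s - m, where the received word still supplies every jet needed. -/
theorem interpCoeff_congr {a : Fin k → F} {u e : Fin k →₀ ℕ} (μ : Fin k →₀ ℕ)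
    {y y' : (Fin k →₀ ℕ) → F} {s : ℕ} (hs : u.degree + e.degree < s)
    (h : ∀ v : Fin k →₀ ℕ, v.degree < s → y v = y' v) :
    interpCoeff a u e μ y = interpCoeff a u e μ y' := by
  refine Finset.sum_congr rfl fun p hp => ?_
  rw [h]
  have : p.1.degree + p.2.degree = u.degree := by
    rw [← map_add, Finset.HasAntidiagonal.mem_antidiagonal.1 hp]
  rw [map_add]; omega

theorem totalDegree_diffOp_le {m D d : ℕ} (Q : DerivIndex k m × DerivIndex k (D + 1) → F)
    {f : MvPolynomial (Fin k) F} (hf : f.totalDegree ≤ d) : (diffOp Q f).totalDegree ≤ D + d :=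
  totalDegree_finsetSum_le fun _ _ => (totalDegree_mul _ _).trans
    (add_le_add (totalDegree_polyOf_le _) ((totalDegree_hasseDeriv_le _ _).trans hf))

variable {n : ℕ} (x : Fin n → F)

/-- The operators of order at most `m` with coefficients of degree at most `D` that annihilate the
received jets `P` to order `s - m` at all grid points. -/
def interpolants (m D s : ℕ) (P : (Fin k → Fin n) → (Fin k →₀ ℕ) → F) :
    Set (DerivIndex k (m + 1) × DerivIndex k (D + 1) → F) :=
  {Q | ∀ (a : Fin k → Fin n) (u : DerivIndex k (s - m)),
    ∑ p, Q p * interpCoeff (fun i => x (a i)) u.1 p.1.1 p.2.1 (P a) = 0}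

/-- The polynomials of degree at most `d` that are annihilated to order `s - m` at all grid points
by all interpolating operators. -/
def solutionSpace (m D s d : ℕ) (P : (Fin k → Fin n) → (Fin k →₀ ℕ) → F) :
    Submodule F (MvPolynomial (Fin k) F) where
  carrier := {f | f.totalDegree ≤ d ∧ ∀ Q ∈ interpolants x m D s P, ∀ (a : Fin k → Fin n)
    (u : DerivIndex k (s - m)), jet (fun i => x (a i)) u.1 (diffOp Q f) = 0}
  add_mem' := by
    rintro f g ⟨hf, hf'⟩ ⟨hg, hg'⟩
    refine ⟨(totalDegree_add _ _).trans (max_le hf hg), fun Q hQ a u => ?_⟩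
    have : diffOp Q (f + g) = diffOp Q f + diffOp Q g := by
      simp [diffOp, hasseDeriv_add, mul_add, Finset.sum_add_distrib]
    rw [this, map_add, hf' Q hQ, hg' Q hQ, add_zero]
  zero_mem' := by
    refine ⟨by simp, fun Q hQ a u => ?_⟩
    have : diffOp Q (0 : MvPolynomial (Fin k) F) = 0 := by
      simp [diffOp, ← hasseDerivₗ_apply]
    rw [this, map_zero]
  smul_mem' := by
    rintro c f ⟨hf, hf'⟩
    refine ⟨(totalDegree_smul_le _ _).trans hf, fun Q hQ a u => ?_⟩
    have : diffOp Q (c • f) = c • diffOp Q f := by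
      simp [diffOp, hasseDeriv_smul, Finset.smul_sum]
    rw [this, map_smul, hf' Q hQ, smul_zero]

variable {x}

/-- Otherwise Q f, of degree at most D + d, would vanish to order s - m at every point of A, against
Schwartz–Zippel. -/
theorem diffOp_eq_zero (hx : Function.Injective x) {m D s d : ℕ}
    {f : MvPolynomial (Fin k) F} (hf : f.totalDegree ≤ d)
    {Q : DerivIndex k (m + 1) × DerivIndex k (D + 1) → F} {A : Finset (Fin k → Fin n)}
    (hA : (D + d) * n ^ k < n * (A.card * (s - m)))
    (h : ∀ a ∈ A, ∀ u : DerivIndex k (s - m), jet (fun i => x (a i)) u.1 (diffOp Q f) = 0) :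
    diffOp Q f = 0 := by
  classical
  by_contra h0
  have := mul_sum_vanishing_le hx h0 (totalDegree_diffOp_le Q hf)
    (fun a => if a ∈ A then s - m else 0) (by
      intro a
      split_ifs with ha
      · exact fun e he => h a ha ⟨e, he⟩
      · exact VanishesTo.zero_order _ _)
  rw [Finset.sum_ite_mem, Finset.univ_inter, Finset.sum_const, smul_eq_mul] at this
  omega

/-- Where f agrees with the received word, Q f inherits the interpolation conditions. These points
suffice for Q f = 0 identically, so the conditions at all other points hold as well. -/
theorem mem_solutionSpace (hx : Function.Injective x) {m D s d : ℕ}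
    {P : (Fin k → Fin n) → (Fin k →₀ ℕ) → F}
    {f : MvPolynomial (Fin k) F} (hf : f.totalDegree ≤ d) {A : Finset (Fin k → Fin n)}
    (hA : (D + d) * n ^ k < n * (A.card * (s - m)))
    (h : ∀ a ∈ A, ∀ v : Fin k →₀ ℕ, v.degree < s → jet (fun i => x (a i)) v f = P a v) :
    f ∈ solutionSpace x m D s d P := by
  refine ⟨hf, fun Q hQ a u => ?_⟩
  rw [diffOp_eq_zero hx hf hA, map_zero]
  intro a ha u
  rw [jet_diffOp, ← hQ a u]
  refine Finset.sum_congr rfl fun p _ => ?_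
  rw [interpCoeff_congr p.2.1 (s := s) _ (h a ha)]
  have h1 := p.1.2
  have h2 := u.2
  omega

/-- Given m + 1 independent solutions, fix the orders of a nonzero Wronskian of them. `hcard` yields
a nonzero interpolating operator supported on these orders alone, and `hD` makes it kill all the
solutions. Its coefficients then lie in the left kernel of a nonsingular matrix. -/
theorem finrank_solutionSpace_le (hx : Function.Injective x) {m D s d : ℕ}
    (hchar : ringChar F = 0 ∨ d < ringChar F) (P : (Fin k → Fin n) → (Fin k →₀ ℕ) → F)
    (hD : (D + d) * n ^ k < n * (n ^ k * (s - m)))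
    (hcard : n ^ k * Fintype.card (DerivIndex k (s - m)) <
      (m + 1) * Fintype.card (DerivIndex k (D + 1))) :
    Module.finrank F (solutionSpace x m D s d P) ≤ m := by
  classical
  by_contra hlt
  push Not at hlt
  obtain ⟨f, hf⟩ := exists_linearIndependent_of_le_finrank (R := F)
    (M := solutionSpace x m D s d P) (n := m + 1) hlt
  have hf' : LinearIndependent F fun j => (f j : MvPolynomial (Fin k) F) :=
    hf.map' (solutionSpace x m D s d P).subtype (Submodule.ker_subtype _)
  obtain ⟨e, he, hdet⟩ := exists_wronskian_ne_zero hchar hf' fun j => (f j).2.1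
  let M : Matrix ((Fin k → Fin n) × DerivIndex k (s - m)) (Fin (m + 1) × DerivIndex k (D + 1)) F :=
    Matrix.of fun r c => interpCoeff (fun i => x (r.1 i)) r.2.1 (e c.1) c.2.1 (P r.1)
  obtain ⟨c, hcker, hc0⟩ := (Submodule.ne_bot_iff _).1
    (LinearMap.ker_ne_bot_of_finrank_lt (f := Matrix.toLin' M) (by simpa using hcard))
  let e' : Fin (m + 1) → DerivIndex k (m + 1) := fun i => ⟨e i, he i⟩
  -- Summing over all i with the given order makes it unnecessary to know that the chosen orders are
  -- distinct.
  let Q : DerivIndex k (m + 1) × DerivIndex k (D + 1) → F :=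
    fun p => ∑ i, if e' i = p.1 then c (i, p.2) else 0
  have hsum : ∀ g : DerivIndex k (m + 1) → DerivIndex k (D + 1) → F,
      ∑ p : DerivIndex k (m + 1) × DerivIndex k (D + 1), Q p * g p.1 p.2 =
        ∑ q : Fin (m + 1) × DerivIndex k (D + 1), c q * g (e' q.1) q.2 := by
    intro g
    simp only [Q, Finset.sum_mul, ite_mul, zero_mul, Fintype.sum_prod_type]
    calc _ = ∑ μ, ∑ e, ∑ i, (if e' i = e then c (i, μ) * g e μ else 0) := Finset.sum_comm
      _ = ∑ μ, ∑ i, ∑ e, (if e' i = e then c (i, μ) * g e μ else 0) :=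
          Finset.sum_congr rfl fun μ _ => Finset.sum_comm
      _ = ∑ μ, ∑ i, c (i, μ) * g (e' i) μ := by simp
      _ = _ := Finset.sum_comm
  have hQ : Q ∈ interpolants x m D s P := by
    intro a u
    rw [hsum fun e μ => interpCoeff (fun i => x (a i)) u.1 e.1 μ.1 (P a)]
    have := congrFun (LinearMap.mem_ker.1 hcker) (a, u)
    rw [Matrix.toLin'_apply] at this
    simp only [Matrix.mulVec, dotProduct, Pi.zero_apply, M, Matrix.of_apply] at this
    rw [← this]
    exact Finset.sum_congr rfl fun q _ => mul_comm _ _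
  have hzero : ∀ j, diffOp Q (f j : MvPolynomial (Fin k) F) = 0 := fun j =>
    diffOp_eq_zero hx (f j).2.1 (A := Finset.univ) (s := s) (by simpa using hD)
      fun a _ u => (f j).2.2 Q hQ a u
  have hop : ∀ g, diffOp Q g = ∑ i, polyOf (fun μ => c (i, μ)) * hasseDeriv (e i) g := by
    intro g
    have h1 : ∀ e₀, polyOf (fun μ => Q (e₀, μ)) =
        ∑ i, if e' i = e₀ then polyOf (fun μ => c (i, μ)) else 0 := by
      intro e₀
      have : (fun μ => Q (e₀, μ)) = ∑ i, if e' i = e₀ then (fun μ => c (i, μ)) else 0 := by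
        ext μ
        rw [Finset.sum_apply]
        refine Finset.sum_congr rfl fun i _ => ?_
        split_ifs <;> simp_all
      rw [this, map_sum]
      refine Finset.sum_congr rfl fun i _ => ?_
      split_ifs <;> simp
    simp only [diffOp, h1, Finset.sum_mul, ite_mul, zero_mul]
    rw [Finset.sum_comm]
    simp [e']
  have hp : (fun i => polyOf fun μ => c (i, μ)) = 0 := by
    refine Matrix.eq_zero_of_vecMul_eq_zero hdet ?_
    ext1 j
    rw [Pi.zero_apply, ← hzero j, hop]
    rfl
  apply hc0
  ext1 ⟨i, μ⟩
  rw [← coeff_polyOf (fun μ => c (i, μ)) μ, congrFun hp i]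
  simp

end Interpolation

/-! ### Choice of parameters, and tuples that determine a close polynomial -/

section GoodTuples

variable {F : Type*} [Field F] {k n : ℕ}

/-- A space of polynomials of degree at most `d` that contains all polynomials whose encoding is
close to the received jets `P`. -/
noncomputable def candidateSpace (x : Fin n → F) (m D s d : ℕ)
    (P : (Fin k → Fin n) → (Fin k →₀ ℕ) → F) : Submodule F (MvPolynomial (Fin k) F) :=
  if d < s then LinearMap.range (polyOf : (DerivIndex k (d + 1) → F) →ₗ[F] _)
  else solutionSpace x m D s d P

/-- The order of the operators used for interpolation. -/
noncomputable def interpOrder (ε : ℝ) (k : ℕ) : ℕ := ⌈(2 / ε) ^ k⌉₊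

/-- The degree of the coefficients used for interpolation. -/
noncomputable def interpDegree (ε : ℝ) (s n : ℕ) : ℕ := ⌊ε * n * s / 2⌋₊

/-- The number of points that are sampled in order to determine a candidate. -/
noncomputable def tupleLength (ε : ℝ) (k : ℕ) : ℕ :=
  ⌈2 / ε * Real.log (2 * interpOrder ε k)⌉₊ + 1

theorem le_interpOrder (ε : ℝ) (k : ℕ) : (2 / ε) ^ k ≤ interpOrder ε k := Nat.le_ceil _

theorem le_interpOrder_self {ε : ℝ} (h0 : 0 < ε) (h1 : ε ≤ 1 / 2) (k : ℕ) :
    k ≤ interpOrder ε k := by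
  have h2 : (2 : ℝ) ≤ 2 / ε := by rw [le_div_iff₀ h0]; linarith
  have h3 : (k : ℝ) ≤ interpOrder ε k := by
    refine le_trans ?_ (le_interpOrder ε k)
    refine le_trans ?_ (pow_le_pow_left₀ (by norm_num) h2 k)
    exact_mod_cast (Nat.lt_two_pow_self).le
  exact_mod_cast h3

theorem one_le_interpOrder {ε : ℝ} (h0 : 0 < ε) (k : ℕ) : 1 ≤ interpOrder ε k :=
  Nat.one_le_ceil_iff.2 (by positivity)

/-- After multiplication by k!, both binomial coefficients are compared with k-th powers. The
inequality k ≤ m absorbs the shift by k, and what remains is (ns)^k = (2/ε)^k (εns/2)^k <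
(m+1)(D+1)^k. -/
theorem mul_card_derivIndex_lt {ε : ℝ} (h0 : 0 < ε) (h1 : ε ≤ 1 / 2) {s : ℕ} (hn : 1 ≤ n)
    (hs : interpOrder ε k < s) :
    n ^ k * Fintype.card (DerivIndex k (s - interpOrder ε k)) <
      (interpOrder ε k + 1) * Fintype.card (DerivIndex k (interpDegree ε s n + 1)) := by
  set m := interpOrder ε k with hm
  set D := interpDegree ε s n with hD
  have hkm : k ≤ m := le_interpOrder_self h0 h1 k
  obtain ⟨q, hq⟩ : ∃ q, s - m = q + 1 := ⟨s - m - 1, by omega⟩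
  rw [hq, card_derivIndex, card_derivIndex]
  refine lt_of_mul_lt_mul_left (a := k.factorial) ?_ (Nat.zero_le _)
  have e1 : k.factorial * (n ^ k * (q + k).choose k) ≤ n ^ k * s ^ k := by
    calc k.factorial * (n ^ k * (q + k).choose k) = n ^ k * (q + k).descFactorial k := by
          rw [Nat.descFactorial_eq_factorial_mul_choose]; ring
      _ ≤ n ^ k * s ^ k := by
          refine Nat.mul_le_mul_left _ ((Nat.descFactorial_le_pow _ _).trans ?_)
          exact Nat.pow_le_pow_left (by omega) k
  have e2 : (m + 1) * (D + 1) ^ k ≤ k.factorial * ((m + 1) * (D + k).choose k) := by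
    calc (m + 1) * (D + 1) ^ k ≤ (m + 1) * (D + k).descFactorial k := by
          refine Nat.mul_le_mul_left _ ?_
          have := Nat.pow_sub_le_descFactorial (D + k) k
          rwa [show D + k + 1 - k = D + 1 by omega] at this
      _ = _ := by rw [Nat.descFactorial_eq_factorial_mul_choose]; ring
  refine lt_of_le_of_lt e1 (lt_of_lt_of_le ?_ e2)
  have hDr : ε * n * s / 2 ≤ (D : ℝ) + 1 := (Nat.lt_floor_add_one _).le
  have hmr : (2 / ε) ^ k < (m : ℝ) + 1 := (le_interpOrder ε k).trans_lt (by simp [hm])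
  have hnr : (1 : ℝ) ≤ n := by exact_mod_cast hn
  have hsr : (0 : ℝ) < s := by exact_mod_cast (by omega : 0 < s)
  have : ((n ^ k * s ^ k : ℕ) : ℝ) < ((m + 1) * (D + 1) ^ k : ℕ) := by
    push_cast
    calc (n : ℝ) ^ k * s ^ k = (2 / ε) ^ k * (ε * n * s / 2) ^ k := by
          rw [← mul_pow, ← mul_pow]
          congr 1
          field_simp
      _ < ((m : ℝ) + 1) * (ε * n * s / 2) ^ k := by
          refine mul_lt_mul_of_pos_right hmr ?_
          positivity
      _ ≤ ((m : ℝ) + 1) * (D + 1) ^ k := by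
          refine mul_le_mul_of_nonneg_left ?_ (by positivity)
          exact pow_le_pow_left₀ (by positivity) hDr k
  exact_mod_cast this

/-- The margin εns on the right pays for D ≤ εns/2 and for the loss of m orders of vanishing, since
4m ≤ εs. -/
theorem interpDegree_add_lt {ε : ℝ} (h0 : 0 < ε) (h1 : ε ≤ 1 / 2) {s d m : ℕ} (hm : 1 ≤ m)
    (hn : 1 ≤ n) (hs : 4 * m / ε ≤ s) (hd : d < s * n) :
    (interpDegree ε s n : ℝ) + d < n * ((d / (s * n) + ε) * (s - m)) := by
  have hmr : (1 : ℝ) ≤ m := by exact_mod_cast hm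
  have hnr : (1 : ℝ) ≤ n := by exact_mod_cast hn
  have hsr : (0 : ℝ) < s := lt_of_lt_of_le (by positivity) hs
  have hdr : (d : ℝ) < s * n := by exact_mod_cast hd
  have hD : (interpDegree ε s n : ℝ) ≤ ε * n * s / 2 := Nat.floor_le (by positivity)
  have h2 : (d : ℝ) / s * m < n * m := by
    have : (d : ℝ) / s < n := by rw [div_lt_iff₀ hsr]; linarith
    exact mul_lt_mul_of_pos_right this (by linarith)
  have h3 : 4 * (m : ℝ) ≤ ε * s := by
    rw [div_le_iff₀ h0] at hs; linarith
  have h4 : (n : ℝ) * ((d / (s * n) + ε) * (s - m)) =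
      d - d / s * m + ε * n * s - ε * (n * m) := by
    field_simp
    ring
  rw [h4]
  have h5 : ε * (n * m) ≤ 1 / 2 * (n * m) := mul_le_mul_of_nonneg_right h1 (by positivity)
  have h6 : n * (4 * (m : ℝ)) ≤ n * (ε * s) := mul_le_mul_of_nonneg_left h3 (by positivity)
  nlinarith [mul_pos (show (0 : ℝ) < n by linarith) (show (0 : ℝ) < m by linarith)]

theorem interpOrder_mul_pow_le {ε : ℝ} (h0 : 0 < ε) (h1 : ε ≤ 1 / 2) (k : ℕ) :
    (interpOrder ε k : ℝ) * (1 - ε / 2) ^ tupleLength ε k ≤ 1 / 2 := by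
  set m := interpOrder ε k with hm
  have hmr : (1 : ℝ) ≤ m := by exact_mod_cast one_le_interpOrder h0 k
  have ht : 2 / ε * Real.log (2 * m) ≤ tupleLength ε k := by
    rw [tupleLength]
    push_cast
    exact (Nat.le_ceil _).trans (by rw [← hm]; linarith)
  have h2 : (1 - ε / 2) ^ tupleLength ε k ≤ Real.exp (-(ε / 2) * tupleLength ε k) := by
    have := pow_le_pow_left₀ (by linarith) (Real.one_sub_le_exp_neg (ε / 2)) (tupleLength ε k)
    rwa [← Real.exp_nat_mul, mul_comm] at this
  have h3 : Real.exp (-(ε / 2) * tupleLength ε k) ≤ (2 * m : ℝ)⁻¹ := by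
    rw [← Real.exp_log (show (0 : ℝ) < ((2 : ℝ) * m)⁻¹ by positivity), Real.exp_le_exp, Real.log_inv]
    have : ε / 2 * (2 / ε * Real.log (2 * m)) ≤ ε / 2 * tupleLength ε k :=
      mul_le_mul_of_nonneg_left ht (by positivity)
    have h4 : ε / 2 * (2 / ε * Real.log (2 * m)) = Real.log (2 * m) := by field_simp
    linarith
  calc (m : ℝ) * (1 - ε / 2) ^ tupleLength ε k ≤ m * (2 * m : ℝ)⁻¹ :=
        mul_le_mul_of_nonneg_left (h2.trans h3) (by positivity)
    _ = 1 / 2 := by field_simp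

theorem vanishing_inf_range_polyOf {d s : ℕ} (hds : d < s) (a : Fin k → F)
    {f : MvPolynomial (Fin k) F} (hf : f.totalDegree ≤ d) (hv : VanishesTo a s f) : f = 0 := by
  by_contra h
  obtain ⟨e, he, -⟩ := exists_jet_ne_zero h a
  by_cases hes : e.degree < s
  · exact he (hv e hes)
  · exact he (jet_eq_zero_of_degree hf a (by omega))

theorem mem_range_polyOf {d : ℕ} {f : MvPolynomial (Fin k) F} :
    f ∈ LinearMap.range (polyOf : (DerivIndex k (d + 1) → F) →ₗ[F] _) ↔ f.totalDegree ≤ d :=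
  ⟨by rintro ⟨c, rfl⟩; exact totalDegree_polyOf_le c, fun h => ⟨_, polyOf_coeff h⟩⟩

theorem totalDegree_le_of_mem_candidateSpace {x : Fin n → F} {m D s d : ℕ}
    {P : (Fin k → Fin n) → (Fin k →₀ ℕ) → F} {f : MvPolynomial (Fin k) F}
    (hf : f ∈ candidateSpace x m D s d P) : f.totalDegree ≤ d := by
  unfold candidateSpace at hf
  split_ifs at hf
  · exact mem_range_polyOf.1 hf
  · exact hf.1

instance (x : Fin n → F) (m D s d : ℕ) (P : (Fin k → Fin n) → (Fin k →₀ ℕ) → F) :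
    FiniteDimensional F (candidateSpace x m D s d P) :=
  Submodule.finiteDimensional_of_le
    (S₂ := LinearMap.range (polyOf : (DerivIndex k (d + 1) → F) →ₗ[F] _))
    fun _ hf => mem_range_polyOf.2 (totalDegree_le_of_mem_candidateSpace hf)

/-- A polynomial that is close to the received word lies in the candidate space, and it is
determined there by its agreement with a random tuple of points with good probability. -/
theorem close_mem_candidateSpace_and_le_card [DecidableEq (Fin k → Fin n)] {x : Fin n → F}
    (hx : Function.Injective x) {ε : ℝ} (h0 : 0 < ε) (h1 : ε ≤ 1 / 2) {s d : ℕ} (hn : 1 ≤ n)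
    (hs : 4 * interpOrder ε k / ε ≤ s) (hd : d < s * n)
    (hchar : ringChar F = 0 ∨ d < ringChar F) (P : (Fin k → Fin n) → (Fin k →₀ ℕ) → F)
    {f : MvPolynomial (Fin k) F} (hf : f.totalDegree ≤ d) {A : Finset (Fin k → Fin n)}
    (hA : ((d : ℝ) / (s * n) + ε) * n ^ k ≤ A.card)
    (h : ∀ a ∈ A, ∀ v : Fin k →₀ ℕ, v.degree < s → jet (fun i => x (a i)) v f = P a v) :
    f ∈ candidateSpace x (interpOrder ε k) (interpDegree ε s n) s d P ∧
    ε ^ tupleLength ε k / 2 * ((n : ℝ) ^ k) ^ tupleLength ε k ≤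
      {τ : Fin (tupleLength ε k) → (Fin k → Fin n) | (∀ i, τ i ∈ A) ∧
        candidateSpace x (interpOrder ε k) (interpDegree ε s n) s d P ⊓
          ⨅ i, vanishing (fun j => x (τ i j)) s = ⊥}.ncard := by
  set m := interpOrder ε k with hm
  set D := interpDegree ε s n with hD
  set t := tupleLength ε k with ht
  set V := candidateSpace x m D s d P with hV
  have hmr : (1 : ℝ) ≤ m := by exact_mod_cast one_le_interpOrder h0 k
  have hnr : (1 : ℝ) ≤ n := by exact_mod_cast hn
  have hsr : (0 : ℝ) < s := lt_of_lt_of_le (by positivity) hs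
  have hdr : (d : ℝ) < s * n := by exact_mod_cast hd
  have hN : (0 : ℝ) < (n : ℝ) ^ k := by positivity
  have hR : (0 : ℝ) ≤ (d : ℝ) / (s * n) := by positivity
  have hAN : (A.card : ℝ) ≤ (n : ℝ) ^ k := by
    have := A.card_le_univ
    simp only [Fintype.card_fun, Fintype.card_fin] at this
    exact_mod_cast this
  -- An agreement fraction cannot exceed one.
  have hR1 : (d : ℝ) / (s * n) + ε ≤ 1 := by
    by_contra hcon
    push Not at hcon
    nlinarith
  have hεA : (ε * n ^ k) ^ t ≤ (A.card : ℝ) ^ t :=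
    pow_le_pow_left₀ (by positivity) (le_trans (by gcongr; linarith) hA) t
  have hfin : ∀ B : ℝ, 0 ≤ B → (∀ U ≤ V, ∑ a : Fin k → Fin n,
      (Module.finrank F (U ⊓ vanishing (fun j => x (a j)) s : Submodule F _) : ℝ) ≤
      B * Module.finrank F U) → B ^ t * Module.finrank F V ≤ (A.card : ℝ) ^ t / 2 →
      ε ^ t / 2 * ((n : ℝ) ^ k) ^ t ≤ {τ : Fin t → (Fin k → Fin n) | (∀ i, τ i ∈ A) ∧
        V ⊓ ⨅ i, vanishing (fun j => x (τ i j)) s = ⊥}.ncard := by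
    intro B hB0 hB hBt
    have := le_card_tuples_inf_eq_bot A (W := fun a => vanishing (fun j => x (a j)) s) hB hB0 t
    refine le_trans ?_ this
    rw [mul_pow] at hεA
    linarith
  -- A polynomial of degree below s that vanishes to order s at a point is zero. One point prunes
  -- everything, so the design bound holds with B = 0.
  by_cases hds : d < s
  · have hV' : V = LinearMap.range (polyOf : (DerivIndex k (d + 1) → F) →ₗ[F] _) := by
      rw [hV, candidateSpace, if_pos hds]
    refine ⟨by rw [hV']; exact mem_range_polyOf.2 hf, hfin 0 le_rfl ?_ ?_⟩
    · intro U hU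
      rw [zero_mul]
      refine (Finset.sum_eq_zero fun a _ => ?_).le
      have : U ⊓ vanishing (fun j => x (a j)) s = ⊥ := by
        rw [Submodule.eq_bot_iff]
        rintro g ⟨hg1, hg2⟩
        exact vanishing_inf_range_polyOf hds _ (mem_range_polyOf.1 (hV' ▸ hU hg1)) hg2
      rw [this]; simp
    -- The summand 1 in `tupleLength` guarantees a positive exponent, so that 0^t = 0.
    · rw [ht, tupleLength, pow_succ, mul_zero, zero_mul]; positivity
  · have hV' : V = solutionSpace x m D s d P := by
      rw [hV, candidateSpace, if_neg hds]
    have hms : 4 * (m : ℝ) ≤ ε * s := by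
      rw [div_le_iff₀ h0] at hs; linarith
    have hms' : (m : ℝ) < s := by nlinarith
    have hmsn : m < s := by exact_mod_cast hms'
    have hcastsub : ((s - m : ℕ) : ℝ) = s - m := by rw [Nat.cast_sub hmsn.le]
    have hAdeg : (D + d) * n ^ k < n * (A.card * (s - m)) := by
      have h2 := interpDegree_add_lt h0 h1 (one_le_interpOrder h0 k) hn hs hd
      have : (((D + d) * n ^ k : ℕ) : ℝ) < ((n * (A.card * (s - m)) : ℕ) : ℝ) := by
        push_cast
        rw [hcastsub]
        calc ((D : ℝ) + d) * n ^ k < n * ((d / (s * n) + ε) * (s - m)) * n ^ k :=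
              mul_lt_mul_of_pos_right h2 hN
          _ = n * (((d / (s * n) + ε) * n ^ k) * (s - m)) := by ring
          _ ≤ _ := by
              refine mul_le_mul_of_nonneg_left ?_ (by positivity)
              exact mul_le_mul_of_nonneg_right hA (by linarith)
      exact_mod_cast this
    have hgrid : (D + d) * n ^ k < n * (n ^ k * (s - m)) := by
      refine hAdeg.trans_le ?_
      gcongr
      exact_mod_cast hAN
    have hrank : Module.finrank F V ≤ m := by
      rw [hV']
      exact finrank_solutionSpace_le hx hchar P hgrid (mul_card_derivIndex_lt h0 h1 hn hmsn)
    refine ⟨by rw [hV']; exact mem_solutionSpace hx hf hAdeg h,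
      hfin ((d / (s * n) + ε / 2) * n ^ k) (by positivity) ?_ ?_⟩
    · intro U hU
      have : FiniteDimensional F U := Submodule.finiteDimensional_of_le hU
      have hUm : Module.finrank F U ≤ m := (Submodule.finrank_mono hU).trans hrank
      have h2 := mul_sum_finrank_inf_vanishing_le (s := s) hx hchar U
        fun g hg => totalDegree_le_of_mem_candidateSpace (hU hg)
      set r := Module.finrank F U
      set T := ∑ a : Fin k → Fin n,
        (Module.finrank F (U ⊓ vanishing (fun j => x (a j)) s : Submodule F _) : ℝ) with hT
      have hT0 : 0 ≤ T := Finset.sum_nonneg fun _ _ => Nat.cast_nonneg _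
      have h3 : n * (T * (s - m)) ≤ r * d * n ^ k := by
        have h4 : ((n * ∑ a : Fin k → Fin n,
            Module.finrank F (U ⊓ vanishing (fun i => x (a i)) s : Submodule F _) *
              (s - (r - 1)) : ℕ) : ℝ) ≤ (r * d * n ^ k : ℕ) := by exact_mod_cast h2
        push_cast at h4
        refine le_trans ?_ h4
        rw [← Finset.sum_mul]
        refine mul_le_mul_of_nonneg_left ?_ (by positivity)
        refine mul_le_mul_of_nonneg_left ?_ hT0
        rw [← hcastsub]
        exact_mod_cast (by omega : s - m ≤ s - (r - 1))
      have hsm : (0 : ℝ) < s - m := by linarith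
      have hnsm : (0 : ℝ) < n * (s - m) := by positivity
      -- Replacing s by s - m in the design bound costs little: at most nm + εnm/2 is lost, and
      -- εns/2 ≥ 2nm covers it.
      have h5 : (d : ℝ) ≤ (d / (s * n) + ε / 2) * (n * (s - m)) := by
        have h6 : (d / (s * n) + ε / 2) * (n * (s - m)) =
            d - d / s * m + ε / 2 * n * s - ε / 2 * n * m := by
          field_simp
          ring
        have h7 : (d : ℝ) / s * m ≤ n * m := by
          have : (d : ℝ) / s ≤ n := by rw [div_le_iff₀ hsr]; linarith
          exact mul_le_mul_of_nonneg_right this (by linarith)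
        have h8 : n * (4 * (m : ℝ)) ≤ n * (ε * s) := mul_le_mul_of_nonneg_left hms (by positivity)
        have h9 : ε * (n * m) ≤ 1 / 2 * (n * m) := mul_le_mul_of_nonneg_right h1 (by positivity)
        have h10 : 0 < (n : ℝ) * m := by positivity
        rw [h6]
        nlinarith
      refine le_of_mul_le_mul_right (a := (n * (s - m) : ℝ)) ?_ hnsm
      calc T * (n * (s - m)) = n * (T * (s - m)) := by ring
        _ ≤ r * d * n ^ k := h3
        _ = (r * n ^ k) * d := by ring
        _ ≤ (r * n ^ k) * ((d / (s * n) + ε / 2) * (n * (s - m))) :=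
            mul_le_mul_of_nonneg_left h5 (by positivity)
        _ = _ := by ring
    -- The difference of (1 - ε/2)(R + ε) and R + ε/2 is (ε/2)(1 - R - ε), which is nonnegative
    -- because R + ε ≤ 1.
    · have h2 : (d / (s * n) + ε / 2) * (n : ℝ) ^ k ≤ (1 - ε / 2) * A.card := by
        calc (d / (s * n) + ε / 2) * (n : ℝ) ^ k
            ≤ ((1 - ε / 2) * (d / (s * n) + ε)) * n ^ k := by
              refine mul_le_mul_of_nonneg_right ?_ hN.le
              nlinarith
          _ = (1 - ε / 2) * ((d / (s * n) + ε) * n ^ k) := by ring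
          _ ≤ _ := mul_le_mul_of_nonneg_left hA (by linarith)
      have h3 := pow_le_pow_left₀ (by positivity) h2 t
      have h4 := interpOrder_mul_pow_le h0 h1 k
      calc ((d / (s * n) + ε / 2) * (n : ℝ) ^ k) ^ t * Module.finrank F V
          ≤ ((1 - ε / 2) * A.card) ^ t * m := by
            refine mul_le_mul h3 (by exact_mod_cast hrank) (by positivity) ?_
            exact pow_nonneg (mul_nonneg (by linarith) (by positivity)) t
        _ = (m * (1 - ε / 2) ^ t) * (A.card : ℝ) ^ t := by rw [mul_pow]; ring
        _ ≤ 1 / 2 * (A.card : ℝ) ^ t := mul_le_mul_of_nonneg_right h4 (by positivity)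
        _ = _ := by ring

end GoodTuples

/-! ### Arithmetic terms and their evaluation with memory -/

/-- Arithmetic terms over variables in `R`. -/
inductive FieldTerm (R : Type) : Type
  | zero
  | one
  | var (r : R)
  | op (o : FieldOp) (x y : FieldTerm R)

namespace FieldTerm

variable {R : Type} {F : Type*} [Field F]

/-- The value of a term. -/
def eval (mem : R → F) : FieldTerm R → F
  | zero => 0
  | one => 1
  | var r => mem r
  | op o x y => o.eval (eval mem x) (eval mem y)

/-- A term is available given the terms in `S` if it is zero, a variable, or a member of `S`. -/
def Avail (S : Set (FieldTerm R)) : FieldTerm R → Prop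
  | zero => True
  | var _ => True
  | one => one ∈ S
  | op o x y => op o x y ∈ S

theorem Avail.mono {S S' : Set (FieldTerm R)} (h : S ⊆ S') {t : FieldTerm R} (ht : Avail S t) :
    Avail S' t := by
  cases t with
  | zero => trivial
  | var => trivial
  | one => exact h ht
  | op => exact h ht

/-- A set of terms that is closed under passing to (nontrivial) subterms. -/
def Closed (S : Set (FieldTerm R)) : Prop :=
  ∀ o x y, op o x y ∈ S → Avail S x ∧ Avail S y

open Classical in
/-- The register that holds the value of a term once the terms in `K` have been computed. -/
noncomputable def reg (K : List (FieldTerm R)) : FieldTerm R → R ⊕ ℕ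
  | zero => Sum.inr 0
  | var r => Sum.inl r
  | t => Sum.inr (K.idxOf t + 1)

open Classical in
/-- Compute a term, given that the terms in `K` have been computed, and continue. -/
noncomputable def compute {J : Type} : FieldTerm R → List (FieldTerm R) →
    (List (FieldTerm R) → CompTree (R ⊕ ℕ) J) → CompTree (R ⊕ ℕ) J
  | zero, K, c => c K
  | var _, K, c => c K
  | one, K, c =>
    if one ∈ K then c K else .loadOne (Sum.inr (K.length + 1)) (c (K ++ [one]))
  | op o x y, K, c =>
    if op o x y ∈ K then c K else compute x K fun K₁ => compute y K₁ fun K₂ =>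
      if op o x y ∈ K₂ then c K₂ else
        .arith o (Sum.inr (K₂.length + 1)) (reg K₂ x) (reg K₂ y) (c (K₂ ++ [op o x y]))

/-- Compute all terms of a list, given that the terms in `K` have been computed, and continue. -/
noncomputable def computeAll {J : Type} : List (FieldTerm R) → List (FieldTerm R) →
    (List (FieldTerm R) → CompTree (R ⊕ ℕ) J) → CompTree (R ⊕ ℕ) J
  | [], K, c => c K
  | t :: l, K, c => compute t K fun K' => computeAll l K' c

open Classical in
/-- The registers hold the input and the values of the terms in `K`. -/
def Holds (mem₀ : R → F) (K : List (FieldTerm R)) (mem : R ⊕ ℕ → F) : Prop :=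
  (∀ r, mem (Sum.inl r) = mem₀ r) ∧ mem (Sum.inr 0) = 0 ∧
    ∀ t ∈ K, mem (Sum.inr (K.idxOf t + 1)) = eval mem₀ t

theorem Holds.reg {mem₀ : R → F} {K : List (FieldTerm R)} {mem : R ⊕ ℕ → F}
    (h : Holds mem₀ K mem) {t : FieldTerm R} (ht : Avail {t | t ∈ K} t) :
    mem (reg K t) = eval mem₀ t := by
  cases t with
  | zero => exact h.2.1
  | var r => exact h.1 r
  | one => exact h.2.2 _ ht
  | op => exact h.2.2 _ ht

theorem Holds.snoc {mem₀ : R → F} {K : List (FieldTerm R)} {mem : R ⊕ ℕ → F}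
    (h : Holds mem₀ K mem) {t : FieldTerm R} (ht : t ∉ K) [inst : DecidableEq (R ⊕ ℕ)] :
    Holds mem₀ (K ++ [t]) (Function.update mem (Sum.inr (K.length + 1)) (eval mem₀ t)) := by
  classical
  refine ⟨fun r => ?_, ?_, fun u hu => ?_⟩
  · rw [Function.update_of_ne (by simp)]; exact h.1 r
  · rw [Function.update_of_ne (by simp)]; exact h.2.1
  · by_cases huK : u ∈ K
    · rw [List.idxOf_append_of_mem huK, Function.update_of_ne]
      · exact h.2.2 u huK
      · have := List.idxOf_lt_length_of_mem huK
        simp only [ne_eq, Sum.inr.injEq]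
        omega
    · have hut : u = t := by simpa [huK] using hu
      subst hut
      rw [List.idxOf_append_of_notMem huK]
      simp

/-- The effect of computing additional terms. -/
def Computed (mem₀ : R → F) (G : Set (FieldTerm R)) (K : List (FieldTerm R)) (mem : R ⊕ ℕ → F)
    (T : Set (FieldTerm R)) {J : Type}
    (comp : (List (FieldTerm R) → CompTree (R ⊕ ℕ) J) → CompTree (R ⊕ ℕ) J) : Prop :=
  ∃ K' mem', Holds mem₀ K' mem' ∧ K'.Nodup ∧ (∀ t ∈ K', t ∈ G) ∧ (∀ t ∈ K, t ∈ K') ∧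
    (∀ t ∈ T, Avail {t | t ∈ K'} t) ∧
    ∀ c, (comp c).run mem = (c K').run mem' ∧
      (comp c).opCount mem + K.length = (c K').opCount mem' + K'.length

/-- Every executed operation appends exactly one new term to the list of known terms, so the
operation count is the growth of that list. Register 0 of the working registers is never written and
serves as the constant zero; the term at position i of the list lives in register i + 1. -/
theorem computed_compute {mem₀ : R → F} {G : Set (FieldTerm R)} (hG : Closed G) {J : Type}
    (t : FieldTerm R) : ∀ {K : List (FieldTerm R)} {mem : R ⊕ ℕ → F}, Holds mem₀ K mem → K.Nodup →
      (∀ t ∈ K, t ∈ G) → Avail G t → Computed mem₀ G K mem {t} (compute (J := J) t K) := by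
  induction t with
  | zero =>
    intro K mem h hn hK _
    refine ⟨K, mem, h, hn, hK, fun _ h => h, ?_, fun c => ⟨rfl, rfl⟩⟩
    rintro t rfl; trivial
  | var r =>
    intro K mem h hn hK _
    refine ⟨K, mem, h, hn, hK, fun _ h => h, ?_, fun c => ⟨rfl, rfl⟩⟩
    rintro t rfl; trivial
  | one =>
    intro K mem h hn hK hav
    by_cases hmem : (one : FieldTerm R) ∈ K
    · refine ⟨K, mem, h, hn, hK, fun _ h => h, ?_, fun c => ?_⟩
      · rintro t rfl; exact hmem
      · simp [compute, hmem]
    · refine ⟨K ++ [one], _, h.snoc hmem (inst := fun _ _ => Classical.propDecidable _), ?_, ?_,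
        fun t ht => List.mem_append_left _ ht, ?_, fun c => ?_⟩
      · rw [List.nodup_append]
        exact ⟨hn, by simp, fun a ha b hb hab =>
          hmem (by rw [← List.mem_singleton.1 hb, ← hab]; exact ha)⟩
      · intro t ht
        rcases List.mem_append.1 ht with h | h
        · exact hK t h
        · rw [List.mem_singleton.1 h]; exact hav
      · rintro t rfl
        exact List.mem_append_right _ (List.mem_singleton.2 rfl)
      · simp only [compute, if_neg hmem, CompTree.run, CompTree.opCount, List.length_append,
          List.length_singleton, eval]
        exact ⟨trivial, by omega⟩
  | op o x y ihx ihy =>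
    intro K mem h hn hK hav
    by_cases hmem : op o x y ∈ K
    · refine ⟨K, mem, h, hn, hK, fun _ h => h, ?_, fun c => ?_⟩
      · rintro t rfl; exact hmem
      · simp [compute, hmem]
    · obtain ⟨hx, hy⟩ := hG o x y hav
      obtain ⟨K₁, mem₁, h₁, hn₁, hK₁, hs₁, hx₁, hc₁⟩ := ihx h hn hK hx
      obtain ⟨K₂, mem₂, h₂, hn₂, hK₂, hs₂, hy₂, hc₂⟩ := ihy h₁ hn₁ hK₁ hy
      by_cases hmem₂ : op o x y ∈ K₂
      · refine ⟨K₂, mem₂, h₂, hn₂, hK₂, fun t ht => hs₂ t (hs₁ t ht), ?_, fun c => ?_⟩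
        · rintro t rfl; exact hmem₂
        · simp only [compute, if_neg hmem]
          rw [(hc₁ _).1, (hc₁ _).2, (hc₂ _).1, (hc₂ _).2, if_pos hmem₂]
          exact ⟨rfl, rfl⟩
      · refine ⟨K₂ ++ [op o x y], _,
          h₂.snoc hmem₂ (inst := fun _ _ => Classical.propDecidable _), ?_, ?_,
          fun t ht => List.mem_append_left _ (hs₂ t (hs₁ t ht)), ?_, fun c => ?_⟩
        · rw [List.nodup_append]
          exact ⟨hn₂, by simp, fun a ha b hb hab =>
          hmem₂ (by rw [← List.mem_singleton.1 hb, ← hab]; exact ha)⟩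
        · intro t ht
          rcases List.mem_append.1 ht with h | h
          · exact hK₂ t h
          · rw [List.mem_singleton.1 h]; exact hav
        · rintro t rfl
          exact List.mem_append_right _ (List.mem_singleton.2 rfl)
        · have ex : mem₂ (FieldTerm.reg K₂ x) = eval mem₀ x :=
            h₂.reg ((hx₁ x rfl).mono fun t ht => hs₂ t ht)
          have ey : mem₂ (FieldTerm.reg K₂ y) = eval mem₀ y := h₂.reg (hy₂ y rfl)
          simp only [compute, if_neg hmem]
          rw [(hc₁ _).1, (hc₁ _).2, (hc₂ _).1, (hc₂ _).2, if_neg hmem₂]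
          simp only [CompTree.run, CompTree.opCount, List.length_append, List.length_singleton,
            eval, ex, ey]
          exact ⟨trivial, by omega⟩

theorem computed_computeAll {mem₀ : R → F} {G : Set (FieldTerm R)} (hG : Closed G) {J : Type}
    (l : List (FieldTerm R)) : ∀ {K : List (FieldTerm R)} {mem : R ⊕ ℕ → F}, Holds mem₀ K mem →
      K.Nodup → (∀ t ∈ K, t ∈ G) → (∀ t ∈ l, Avail G t) →
        Computed mem₀ G K mem {t | t ∈ l} (computeAll (J := J) l K) := by
  induction l with
  | nil =>
    intro K mem h hn hK _
    exact ⟨K, mem, h, hn, hK, fun _ h => h, by simp, fun c => ⟨rfl, rfl⟩⟩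
  | cons t l ih =>
    intro K mem h hn hK hav
    obtain ⟨K₁, mem₁, h₁, hn₁, hK₁, hs₁, hx₁, hc₁⟩ :=
      computed_compute hG (J := J) t h hn hK (hav t (by simp))
    obtain ⟨K₂, mem₂, h₂, hn₂, hK₂, hs₂, hy₂, hc₂⟩ :=
      ih h₁ hn₁ hK₁ fun u hu => hav u (by simp [hu])
    refine ⟨K₂, mem₂, h₂, hn₂, hK₂, fun t ht => hs₂ t (hs₁ t ht), ?_, fun c => ?_⟩
    · intro u hu
      rcases List.mem_cons.1 hu with rfl | hu
      · exact (hx₁ _ rfl).mono fun t ht => hs₂ t ht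
      · exact hy₂ u hu
    · simp only [computeAll]
      rw [(hc₁ _).1, (hc₁ _).2, (hc₂ _).1, (hc₂ _).2]
      exact ⟨rfl, rfl⟩

end FieldTerm

/-! ### Decision trees and their compilation -/

/-- Decision trees that branch on whether terms vanish. -/
inductive ZeroTree (R : Type) (α : Type) : Type
  | ret (a : α)
  | test (t : FieldTerm R) (thenTree elseTree : ZeroTree R α)

namespace ZeroTree

variable {R α β : Type} {F : Type*} [Field F]

/-- Sequential composition. -/
def bind : ZeroTree R α → (α → ZeroTree R β) → ZeroTree R β
  | ret a, f => f a
  | test t m₁ m₂, f => test t (bind m₁ f) (bind m₂ f)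

open Classical in
/-- The result of a decision tree. -/
noncomputable def run (mem : R → F) : ZeroTree R α → α
  | ret a => a
  | test t m₁ m₂ => if t.eval mem = 0 then run mem m₁ else run mem m₂

open Classical in
/-- The terms that are tested. -/
noncomputable def tests (mem : R → F) : ZeroTree R α → List (FieldTerm R)
  | ret _ => []
  | test t m₁ m₂ => t :: if t.eval mem = 0 then tests mem m₁ else tests mem m₂

theorem run_bind (mem : R → F) (m : ZeroTree R α) (f : α → ZeroTree R β) :
    (m.bind f).run mem = (f (m.run mem)).run mem := by
  induction m with
  | ret a => rfl
  | test t m₁ m₂ h₁ h₂ =>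
    simp only [bind, run]
    split_ifs
    · exact h₁
    · exact h₂

theorem tests_bind (mem : R → F) (m : ZeroTree R α) (f : α → ZeroTree R β) :
    (m.bind f).tests mem = m.tests mem ++ (f (m.run mem)).tests mem := by
  induction m with
  | ret a => rfl
  | test t m₁ m₂ h₁ h₂ =>
    simp only [bind, run, tests]
    split_ifs
    · simp [h₁]
    · simp [h₂]

/-- The computation tree of a decision tree. -/
noncomputable def compile {J : Type} [Fintype J] :
    ZeroTree R (List (J → FieldTerm R)) → List (FieldTerm R) → CompTree (R ⊕ ℕ) J
  | ret l, K =>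
    FieldTerm.computeAll (l.flatMap fun v => (Finset.univ : Finset J).toList.map v) K fun K' =>
      .output (l.map fun v j => FieldTerm.reg K' (v j))
  | test t m₁ m₂, K => t.compute K fun K' =>
      .ifZero (FieldTerm.reg K' t) (compile m₁ K') (compile m₂ K')

/-- The known terms form a duplicate-free list inside G, and each operation lengthens it by one;
hence at most |G| operations. G only has to contain the terms tested or returned on the actual run,
so it may depend on the input although the compiled tree does not. -/
theorem compile_spec {J : Type} [Fintype J] {mem₀ : R → F} {G : Finset (FieldTerm R)}
    (hG : FieldTerm.Closed (G : Set (FieldTerm R))) (m : ZeroTree R (List (J → FieldTerm R))) :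
    ∀ {K : List (FieldTerm R)} {mem : R ⊕ ℕ → F}, FieldTerm.Holds mem₀ K mem → K.Nodup →
      (∀ t ∈ K, t ∈ G) → (∀ t ∈ m.tests mem₀, t.Avail G) →
      (∀ v ∈ m.run mem₀, ∀ j, (v j).Avail G) →
      (m.compile K).run mem = (m.run mem₀).map (fun v j => (v j).eval mem₀) ∧
        (m.compile K).opCount mem + K.length ≤ G.card := by
  have hlen : ∀ K : List (FieldTerm R), K.Nodup → (∀ t ∈ K, t ∈ G) → K.length ≤ G.card := by
    classical
    intro K hn hK
    rw [← List.toFinset_card_of_nodup hn]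
    exact Finset.card_le_card fun t ht => hK t (by simpa using ht)
  induction m with
  | ret l =>
    intro K mem h hn hK _ hv
    obtain ⟨K', mem', h', hn', hK', -, hav, hc⟩ := FieldTerm.computed_computeAll hG (J := J)
      (l.flatMap fun v => (Finset.univ : Finset J).toList.map v) h hn hK (by
        intro t ht
        obtain ⟨v, hv1, hv2⟩ := List.mem_flatMap.1 ht
        obtain ⟨j, -, rfl⟩ := List.mem_map.1 hv2
        exact hv v hv1 j)
    simp only [compile]
    rw [(hc _).1, (hc _).2]
    simp only [CompTree.run, CompTree.opCount, run, List.map_map]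
    refine ⟨List.map_congr_left fun v hv1 => ?_, by simpa using hlen K' hn' hK'⟩
    ext1 j
    exact h'.reg (hav _ (List.mem_flatMap.2 ⟨v, hv1, List.mem_map.2 ⟨j, by simp, rfl⟩⟩))
  | test t m₁ m₂ ih₁ ih₂ =>
    intro K mem h hn hK ht hv
    simp only [tests, run] at ht hv
    obtain ⟨K', mem', h', hn', hK', -, hav, hc⟩ := FieldTerm.computed_compute hG (J := J)
      t h hn hK (ht t (by simp))
    simp only [compile]
    rw [(hc _).1, (hc _).2]
    have e := h'.reg (hav t rfl)
    simp only [CompTree.run, CompTree.opCount, run]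
    by_cases h0 : t.eval mem₀ = 0
    · simp only [h0, if_true] at ht hv ⊢
      rw [if_pos (e.trans h0), if_pos (e.trans h0)]
      exact ih₁ h' hn' hK' (fun t ht' => ht t (by simp [ht'])) hv
    · simp only [h0, if_false] at ht hv ⊢
      rw [if_neg (fun h1 => h0 (e.symm.trans h1)), if_neg (fun h1 => h0 (e.symm.trans h1))]
      exact ih₂ h' hn' hK' (fun t ht' => ht t (by simp [ht'])) hv

end ZeroTree

/-! ### Cost accounting by counting new terms -/

namespace FieldTerm

variable {R : Type} {F : Type*} [Field F]

/-- A closed superset of `G` with at most `T` more terms has property `P`. -/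
def Ext (G : Finset (FieldTerm R)) (T : ℕ) (P : Finset (FieldTerm R) → Prop) : Prop :=
  ∃ G' : Finset (FieldTerm R), G ⊆ G' ∧ Closed (G' : Set (FieldTerm R)) ∧
    G'.card ≤ G.card + T ∧ P G'

section Ext

variable {G : Finset (FieldTerm R)} {P Q : Finset (FieldTerm R) → Prop} {T T' : ℕ}

theorem Ext.pure (hG : Closed (G : Set (FieldTerm R))) (h : P G) : Ext G T P :=
  ⟨G, subset_rfl, hG, by omega, h⟩

theorem Ext.bind (h : Ext G T P)
    (h' : ∀ G', G ⊆ G' → Closed (G' : Set (FieldTerm R)) → P G' → Ext G' T' Q) :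
    Ext G (T + T') Q := by
  obtain ⟨G₁, hs₁, hc₁, hn₁, hP⟩ := h
  obtain ⟨G₂, hs₂, hc₂, hn₂, hQ⟩ := h' G₁ hs₁ hc₁ hP
  exact ⟨G₂, hs₁.trans hs₂, hc₂, by omega, hQ⟩

theorem Ext.imp (h : Ext G T P) (hT : T ≤ T') (hPQ : ∀ G', G ⊆ G' → P G' → Q G') :
    Ext G T' Q := by
  obtain ⟨G₁, hs₁, hc₁, hn₁, hP⟩ := h
  exact ⟨G₁, hs₁, hc₁, by omega, hPQ G₁ hs₁ hP⟩

theorem Avail.mono' {G G' : Finset (FieldTerm R)} (h : G ⊆ G') {t : FieldTerm R}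
    (ht : Avail G t) : Avail (G' : Set (FieldTerm R)) t :=
  ht.mono (Finset.coe_subset.2 h)

theorem ext_one (hG : Closed (G : Set (FieldTerm R))) :
    Ext G 1 fun G' => Avail (G' : Set (FieldTerm R)) one := by
  classical
  refine ⟨insert one G, Finset.subset_insert _ _, ?_, Finset.card_insert_le _ _,
    Finset.mem_coe.2 (Finset.mem_insert_self _ _)⟩
  intro o x y h
  have : op o x y ∈ G := by simpa using h
  exact ⟨(hG o x y this).1.mono' (Finset.subset_insert _ _),
    (hG o x y this).2.mono' (Finset.subset_insert _ _)⟩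

theorem ext_op (hG : Closed (G : Set (FieldTerm R))) (o : FieldOp) {x y : FieldTerm R}
    (hx : Avail (G : Set (FieldTerm R)) x) (hy : Avail (G : Set (FieldTerm R)) y) :
    Ext G 1 fun G' => Avail (G' : Set (FieldTerm R)) (op o x y) := by
  classical
  refine ⟨insert (op o x y) G, Finset.subset_insert _ _, ?_, Finset.card_insert_le _ _,
    Finset.mem_coe.2 (Finset.mem_insert_self _ _)⟩
  intro o' x' y' h
  rcases Finset.mem_insert.1 (Finset.mem_coe.1 h) with h | h
  · injection h with h1 h2 h3
    subst h2 h3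
    exact ⟨hx.mono' (Finset.subset_insert _ _), hy.mono' (Finset.subset_insert _ _)⟩
  · exact ⟨(hG o' x' y' h).1.mono' (Finset.subset_insert _ _),
      (hG o' x' y' h).2.mono' (Finset.subset_insert _ _)⟩

/-- The cost bound c must hold over every larger closed set, because earlier members of the list
have already added terms; monotonicity of P preserves what they achieved. -/
theorem ext_list {ι : Type*} {P : ι → Finset (FieldTerm R) → Prop}
    (hP : ∀ i G G', G ⊆ G' → P i G → P i G') {c : ℕ} (l : List ι) :
    ∀ {G : Finset (FieldTerm R)}, Closed (G : Set (FieldTerm R)) →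
      (∀ i ∈ l, ∀ G', G ⊆ G' → Closed (G' : Set (FieldTerm R)) → Ext G' c (P i)) →
      Ext G (l.length * c) fun G' => ∀ i ∈ l, P i G' := by
  induction l with
  | nil => intro G hG _; exact Ext.pure hG (by simp)
  | cons i l ih =>
    intro G hG h
    have h1 := h i (by simp) G subset_rfl hG
    refine (h1.bind (T' := l.length * c) (Q := fun G' => ∀ j ∈ i :: l, P j G')
      fun G₁ hs₁ hc₁ hP₁ => ?_).imp (by rw [List.length_cons]; ring_nf; rfl) fun _ _ h => h
    refine (ih hc₁ fun j hj G' hG' => h j (by simp [hj]) G' (hs₁.trans hG')).imp le_rfl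
      fun G₂ hs₂ hP₂ => ?_
    intro j hj
    rcases List.mem_cons.1 hj with rfl | hj
    · exact hP _ _ _ hs₂ hP₁
    · exact hP₂ j hj

theorem ext_finset {ι : Type*} {P : ι → Finset (FieldTerm R) → Prop}
    (hP : ∀ i G G', G ⊆ G' → P i G → P i G') {c : ℕ} (s : Finset ι)
    (hG : Closed (G : Set (FieldTerm R)))
    (h : ∀ i ∈ s, ∀ G', G ⊆ G' → Closed (G' : Set (FieldTerm R)) → Ext G' c (P i)) :
    Ext G (s.card * c) fun G' => ∀ i ∈ s, P i G' := by
  have := ext_list hP s.toList hG (fun i hi => h i (by simpa using hi))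
  rw [Finset.length_toList] at this
  exact this.imp le_rfl fun G' _ h i hi => h i (by simpa using hi)

end Ext

section Terms

variable {G : Finset (FieldTerm R)}

/-- The sum of a list of terms. -/
def sumList : List (FieldTerm R) → FieldTerm R
  | [] => zero
  | t :: l => op .add t (sumList l)

/-- The product of a list of terms. -/
def prodList : List (FieldTerm R) → FieldTerm R
  | [] => one
  | t :: l => op .mul t (prodList l)

/-- The sum of a family of terms. -/
noncomputable def sumOver {ι : Type*} (s : Finset ι) (t : ι → FieldTerm R) : FieldTerm R :=
  sumList (s.toList.map t)

/-- The product of a family of terms. -/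
noncomputable def prodOver {ι : Type*} (s : Finset ι) (t : ι → FieldTerm R) : FieldTerm R :=
  prodList (s.toList.map t)

theorem eval_sumList (mem : R → F) (l : List (FieldTerm R)) :
    eval mem (sumList l) = (l.map (eval mem)).sum := by
  induction l with
  | nil => rfl
  | cons t l ih => simp [sumList, eval, FieldOp.eval, ih]

theorem eval_prodList (mem : R → F) (l : List (FieldTerm R)) :
    eval mem (prodList l) = (l.map (eval mem)).prod := by
  induction l with
  | nil => rfl
  | cons t l ih => simp [prodList, eval, FieldOp.eval, ih]

theorem eval_sumOver (mem : R → F) {ι : Type*} (s : Finset ι) (t : ι → FieldTerm R) :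
    eval mem (sumOver s t) = ∑ i ∈ s, eval mem (t i) := by
  rw [sumOver, eval_sumList, List.map_map, ← Finset.sum_map_toList]
  rfl

theorem eval_prodOver (mem : R → F) {ι : Type*} (s : Finset ι) (t : ι → FieldTerm R) :
    eval mem (prodOver s t) = ∏ i ∈ s, eval mem (t i) := by
  rw [prodOver, eval_prodList, List.map_map, ← Finset.prod_map_toList]
  rfl

theorem ext_sumList (l : List (FieldTerm R)) : ∀ {G : Finset (FieldTerm R)},
    Closed (G : Set (FieldTerm R)) → (∀ t ∈ l, Avail (G : Set (FieldTerm R)) t) →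
      Ext G l.length fun G' => Avail (G' : Set (FieldTerm R)) (sumList l) := by
  induction l with
  | nil => intro G hG _; exact Ext.pure hG trivial
  | cons t l ih =>
    intro G hG h
    exact (ih hG fun u hu => h u (by simp [hu])).bind fun G' hs hc hl =>
      ext_op hc _ ((h t (by simp)).mono' hs) hl

theorem ext_prodList (l : List (FieldTerm R)) : ∀ {G : Finset (FieldTerm R)},
    Closed (G : Set (FieldTerm R)) → (∀ t ∈ l, Avail (G : Set (FieldTerm R)) t) →
      Ext G (l.length + 1) fun G' => Avail (G' : Set (FieldTerm R)) (prodList l) := by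
  induction l with
  | nil => intro G hG _; exact ext_one hG
  | cons t l ih =>
    intro G hG h
    exact (ih hG fun u hu => h u (by simp [hu])).bind fun G' hs hc hl =>
      ext_op hc _ ((h t (by simp)).mono' hs) hl

theorem ext_sumOver {ι : Type*} {s : Finset ι} {t : ι → FieldTerm R} {c : ℕ}
    (hG : Closed (G : Set (FieldTerm R)))
    (h : ∀ i ∈ s, ∀ G', G ⊆ G' → Closed (G' : Set (FieldTerm R)) →
      Ext G' c fun G'' => Avail (G'' : Set (FieldTerm R)) (t i)) :
    Ext G (s.card * c + s.card) fun G' => Avail (G' : Set (FieldTerm R)) (sumOver s t) := by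
  refine (ext_finset (fun _ _ _ hs h => h.mono' hs) s hG h).bind fun G' _ hc hP => ?_
  refine (ext_sumList _ hc ?_).imp (by simp) fun _ _ h => h
  intro u hu
  obtain ⟨i, hi, rfl⟩ := List.mem_map.1 hu
  exact hP i (by simpa using hi)

theorem ext_prodOver {ι : Type*} {s : Finset ι} {t : ι → FieldTerm R} {c : ℕ}
    (hG : Closed (G : Set (FieldTerm R)))
    (h : ∀ i ∈ s, ∀ G', G ⊆ G' → Closed (G' : Set (FieldTerm R)) →
      Ext G' c fun G'' => Avail (G'' : Set (FieldTerm R)) (t i)) :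
    Ext G (s.card * c + (s.card + 1)) fun G' =>
      Avail (G' : Set (FieldTerm R)) (prodOver s t) := by
  refine (ext_finset (fun _ _ _ hs h => h.mono' hs) s hG h).bind fun G' _ hc hP => ?_
  refine (ext_prodList _ hc ?_).imp (by simp) fun _ _ h => h
  intro u hu
  obtain ⟨i, hi, rfl⟩ := List.mem_map.1 hu
  exact hP i (by simpa using hi)

/-- The dot product of two vectors of terms. -/
noncomputable def dot {ι : Type*} [Fintype ι] (v w : ι → FieldTerm R) : FieldTerm R :=
  sumOver Finset.univ fun i => op .mul (v i) (w i)

theorem eval_dot (mem : R → F) {ι : Type*} [Fintype ι] (v w : ι → FieldTerm R) :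
    eval mem (dot v w) = ∑ i, eval mem (v i) * eval mem (w i) := by
  rw [dot, eval_sumOver]; rfl

theorem ext_dot {ι : Type*} [Fintype ι] {v w : ι → FieldTerm R}
    (hG : Closed (G : Set (FieldTerm R))) (hv : ∀ i, Avail (G : Set (FieldTerm R)) (v i))
    (hw : ∀ i, Avail (G : Set (FieldTerm R)) (w i)) :
    Ext G (2 * Fintype.card ι) fun G' => Avail (G' : Set (FieldTerm R)) (dot v w) :=
  (ext_sumOver hG fun i _ _ hs hc => ext_op hc .mul ((hv i).mono' hs) ((hw i).mono' hs)).imp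
    (by rw [Finset.card_univ]; omega) fun _ _ h => h

/-- A power of a term. -/
def powTerm (x : FieldTerm R) : ℕ → FieldTerm R
  | 0 => one
  | j + 1 => op .mul (powTerm x j) x

theorem eval_powTerm (mem : R → F) (x : FieldTerm R) (j : ℕ) :
    eval mem (powTerm x j) = eval mem x ^ j := by
  induction j with
  | zero => simp [powTerm, eval]
  | succ j ih => simp [powTerm, eval, FieldOp.eval, ih, pow_succ]

theorem ext_powTerm (hG : Closed (G : Set (FieldTerm R))) {x : FieldTerm R}
    (hx : Avail (G : Set (FieldTerm R)) x) (j : ℕ) :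
    Ext G (j + 1) fun G' => Avail (G' : Set (FieldTerm R)) (powTerm x j) := by
  induction j with
  | zero => exact ext_one hG
  | succ j ih => exact ih.bind fun G' hs hc h => ext_op hc _ h (hx.mono' hs)

/-- A binomial coefficient, computed by Pascal's rule. -/
def binTerm : ℕ → ℕ → FieldTerm R
  | _, 0 => one
  | 0, _ + 1 => zero
  | a + 1, b + 1 => op .add (binTerm a b) (binTerm a (b + 1))

theorem eval_binTerm (mem : R → F) : ∀ a b : ℕ, eval mem (binTerm a b) = (a.choose b : F)
  | a, 0 => by cases a <;> simp [binTerm, eval]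
  | 0, b + 1 => by simp [binTerm, eval]
  | a + 1, b + 1 => by
    simp [binTerm, eval, FieldOp.eval, eval_binTerm mem a, Nat.choose_succ_succ]

/-- Keeping a whole row of Pascal's triangle up to column b makes every entry of the next row cost a
single addition. As a tree the term is exponentially large, but shared subterms are counted once. -/
theorem ext_binTerm (hG : Closed (G : Set (FieldTerm R))) (a b : ℕ) :
    Ext G ((a + 1) * (b + 1)) fun G' => ∀ j ≤ b, Avail (G' : Set (FieldTerm R)) (binTerm a j) := by
  induction a with
  | zero =>
    refine (ext_one hG).imp (by omega) fun G' _ h j _ => ?_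
    cases j with
    | zero => exact h
    | succ j => trivial
  | succ a ih =>
    have : (a + 1 + 1) * (b + 1) = (a + 1) * (b + 1) + (b + 1) * 1 := by ring
    rw [this]
    refine ih.bind fun G' hs hc h => ?_
    refine (ext_list (P := fun j G => Avail (G : Set (FieldTerm R)) (binTerm (a + 1) j))
      (fun _ _ _ hs h => h.mono' hs) (c := 1)
      (List.range (b + 1)) hc ?_).imp (by simp) fun G'' _ h' j hj => h' j (by simp; omega)
    intro j hj G₁ hs₁ hc₁
    have hj' : j ≤ b := by simp at hj; omega
    cases j with
    | zero => exact ext_one hc₁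
    | succ j => exact ext_op hc₁ _ ((h j (by omega)).mono' hs₁) ((h (j + 1) hj').mono' hs₁)

end Terms

end FieldTerm

/-! ### Gaussian elimination by decision trees -/

namespace ZeroTree

open FieldTerm

variable {R α β : Type} {F : Type*} [Field F]

/-- Specification of a decision tree: when the terms in `G` are available, at most `T` further
terms have to be computed, and the result and the terms then available are as described. -/
def Spec (mem : R → F) (m : ZeroTree R α) (G : Finset (FieldTerm R)) (T : ℕ)
    (post : α → Finset (FieldTerm R) → Prop) : Prop :=
  Ext G T fun G' => (∀ t ∈ m.tests mem, Avail (G' : Set (FieldTerm R)) t) ∧ post (m.run mem) G'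

variable {mem : R → F} {G : Finset (FieldTerm R)}

theorem spec_ret {a : α} {T : ℕ} {post : α → Finset (FieldTerm R) → Prop}
    (h : Ext G T (post a)) : Spec mem (ret a) G T post :=
  h.imp le_rfl fun _ _ h => ⟨by simp [tests], h⟩

theorem Spec.bind {m : ZeroTree R α} {f : α → ZeroTree R β} {T T' : ℕ}
    {p : α → Finset (FieldTerm R) → Prop} {q : β → Finset (FieldTerm R) → Prop}
    (h : Spec mem m G T p)
    (h' : ∀ a G', G ⊆ G' → Closed (G' : Set (FieldTerm R)) → p a G' → Spec mem (f a) G' T' q) :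
    Spec mem (m.bind f) G (T + T') q := by
  refine Ext.bind h fun G' hs hc hP => (h' _ G' hs hc hP.2).imp le_rfl fun G'' hs' hQ => ?_
  rw [tests_bind, run_bind]
  refine ⟨fun t ht => ?_, hQ.2⟩
  rcases List.mem_append.1 ht with ht | ht
  · exact (hP.1 t ht).mono' hs'
  · exact hQ.1 t ht

theorem Spec.imp {m : ZeroTree R α} {T T' : ℕ} {p q : α → Finset (FieldTerm R) → Prop}
    (h : Spec mem m G T p) (hT : T ≤ T') (hpq : ∀ a G', G ⊆ G' → p a G' → q a G') :
    Spec mem m G T' q :=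
  Ext.imp h hT fun G' hs hP => ⟨hP.1, hpq _ G' hs hP.2⟩

/-- The first element of a list whose term does not vanish. -/
def findFirst (f : β → FieldTerm R) : List β → ZeroTree R (Option β)
  | [] => ret none
  | b :: l => test (f b) (findFirst f l) (ret (some b))

theorem findFirst_spec (mem : R → F) (f : β → FieldTerm R) (l : List β) :
    ((findFirst f l).run mem = none → ∀ b ∈ l, (f b).eval mem = 0) ∧
    (∀ b, (findFirst f l).run mem = some b → b ∈ l ∧ (f b).eval mem ≠ 0) ∧
    ∀ t ∈ (findFirst f l).tests mem, ∃ b ∈ l, t = f b := by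
  induction l with
  | nil => simp [findFirst, run, tests]
  | cons b l ih =>
    obtain ⟨h1, h2, h3⟩ := ih
    simp only [findFirst, run, tests]
    by_cases h0 : (f b).eval mem = 0
    · simp only [h0, if_true]
      refine ⟨fun h => ?_, fun c hc => ?_, fun t ht => ?_⟩
      · simpa [h0] using h1 h
      · exact ⟨by simp [(h2 c hc).1], (h2 c hc).2⟩
      · rcases List.mem_cons.1 ht with rfl | ht
        · exact ⟨b, by simp, rfl⟩
        · obtain ⟨c, hc, rfl⟩ := h3 t ht
          exact ⟨c, by simp [hc], rfl⟩
    · simp only [h0, if_false]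
      refine ⟨by simp, fun c hc => ?_, fun t ht => ?_⟩
      · obtain rfl := Option.some.inj hc
        exact ⟨by simp, h0⟩
      · exact ⟨b, by simp, by simpa using ht⟩

/-- Subtract a multiple of `p` from `b` so that the result is orthogonal to `row`. -/
noncomputable def eliminate {ι : Type} [Fintype ι] (row p b : ι → FieldTerm R) : ι → FieldTerm R :=
  fun i => op .sub (b i) (op .mul (op .div (dot row b) (dot row p)) (p i))

/-- Vectors that span the solutions of a linear equation in the span of given vectors. -/
noncomputable def kernelStep {ι : Type} [Fintype ι] (row : ι → FieldTerm R)
    (B : List (ι → FieldTerm R)) : ZeroTree R (List (ι → FieldTerm R)) :=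
  (findFirst (dot row) B).bind fun
    | none => ret B
    | some p => ret (B.map (eliminate row p))

/-- Vectors that span the solutions of a system of linear equations in the span of given
vectors. -/
noncomputable def kernelFrom {ι : Type} [Fintype ι] :
    List (ι → FieldTerm R) → List (ι → FieldTerm R) → ZeroTree R (List (ι → FieldTerm R))
  | [], B => ret B
  | row :: rows, B => (kernelStep row B).bind (kernelFrom rows)

open Classical in
/-- The standard basis vectors. -/
noncomputable def unitVectors (R ι : Type) [Fintype ι] : List (ι → FieldTerm R) :=
  (Finset.univ : Finset ι).toList.map fun i j => if j = i then one else zero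

/-- Vectors that span the solutions of a system of linear equations. -/
noncomputable def kernel {ι : Type} [Fintype ι] (rows : List (ι → FieldTerm R)) :
    ZeroTree R (List (ι → FieldTerm R)) :=
  kernelFrom rows (unitVectors R ι)

/-- The span of the values of a list of vectors. -/
def spanOf {ι : Type} (mem : R → F) (B : List (ι → FieldTerm R)) : Submodule F (ι → F) :=
  Submodule.span F {v | ∃ b ∈ B, v = fun i => (b i).eval mem}

/-- Elimination is the projection onto the kernel of the row along the pivot p. It maps the span
into itself because p lies in the span, and it fixes every solution. -/
theorem spanOf_map_eliminate {ι : Type} [Fintype ι] (mem : R → F) (row p : ι → FieldTerm R)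
    (B : List (ι → FieldTerm R)) (hp : p ∈ B) (h0 : (dot row p).eval mem ≠ 0) (v : ι → F) :
    v ∈ spanOf mem (B.map (eliminate row p)) ↔
      v ∈ spanOf mem B ∧ ∑ i, (row i).eval mem * v i = 0 := by
  let ℓ : (ι → F) →ₗ[F] F := Fintype.linearCombination F fun i => (row i).eval mem
  have hℓ : ∀ v, ℓ v = ∑ i, (row i).eval mem * v i := fun v => by
    simp [ℓ, Fintype.linearCombination_apply, mul_comm]
  let pv : ι → F := fun i => (p i).eval mem
  have hpv : ℓ pv ≠ 0 := by rw [hℓ, ← eval_dot]; exact h0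
  let E : (ι → F) →ₗ[F] (ι → F) := LinearMap.id - ((ℓ pv)⁻¹ • ℓ).smulRight pv
  have hE : ∀ v, E v = v - ((ℓ pv)⁻¹ * ℓ v) • pv := fun v => by simp [E]
  have hspan : spanOf mem (B.map (eliminate row p)) = (spanOf mem B).map E := by
    rw [spanOf, spanOf, Submodule.map_span]
    congr 1
    ext w
    have hval : ∀ b : ι → FieldTerm R, (fun i => (eliminate row p b i).eval mem) =
        E fun i => (b i).eval mem := by
      intro b
      ext i
      rw [hE]
      simp only [eliminate, FieldTerm.eval, FieldOp.eval, eval_dot, hℓ, Pi.sub_apply,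
        Pi.smul_apply, smul_eq_mul, pv, div_eq_mul_inv]
      ring
    constructor
    · rintro ⟨b', hb', rfl⟩
      obtain ⟨b, hb, rfl⟩ := List.mem_map.1 hb'
      exact ⟨_, ⟨b, hb, rfl⟩, (hval b).symm⟩
    · rintro ⟨_, ⟨b, hb, rfl⟩, rfl⟩
      exact ⟨_, List.mem_map.2 ⟨b, hb, rfl⟩, (hval b).symm⟩
  have hpmem : pv ∈ spanOf mem B := Submodule.subset_span ⟨p, hp, rfl⟩
  rw [hspan, ← hℓ]
  constructor
  · rintro ⟨w, hw, rfl⟩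
    refine ⟨?_, ?_⟩
    · rw [hE]
      exact Submodule.sub_mem _ hw (Submodule.smul_mem _ _ hpmem)
    · rw [hE, map_sub, map_smul, smul_eq_mul]
      field_simp
      ring
  · rintro ⟨hv, hv0⟩
    exact ⟨v, hv, by rw [hE, hv0]; simp⟩

theorem kernelStep_spec {ι : Type} [Fintype ι] (mem : R → F) {row : ι → FieldTerm R}
    {B : List (ι → FieldTerm R)} (hG : Closed (G : Set (FieldTerm R)))
    (hrow : ∀ i, Avail (G : Set (FieldTerm R)) (row i))
    (hB : ∀ b ∈ B, ∀ i, Avail (G : Set (FieldTerm R)) (b i)) :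
    Spec mem (kernelStep row B) G (B.length * (4 * Fintype.card ι + 1)) fun B' G' =>
      B'.length = B.length ∧ (∀ b ∈ B', ∀ i, Avail (G' : Set (FieldTerm R)) (b i)) ∧
      ∀ v, v ∈ spanOf mem B' ↔ v ∈ spanOf mem B ∧ ∑ i, (row i).eval mem * v i = 0 := by
  obtain ⟨h1, h2, h3⟩ := findFirst_spec mem (dot row) B
  have hdots : Ext G (B.length * (2 * Fintype.card ι)) fun G' =>
      ∀ b ∈ B, Avail (G' : Set (FieldTerm R)) (dot row b) :=
    ext_list (fun _ _ _ hs h => h.mono' hs) B hG fun b hb G' hs hc =>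
      ext_dot hc (fun i => (hrow i).mono' hs) fun i => (hB b hb i).mono' hs
  have hfind : Spec mem (findFirst (dot row) B) G (B.length * (2 * Fintype.card ι)) fun o G' =>
      o = (findFirst (dot row) B).run mem ∧
        ∀ b ∈ B, Avail (G' : Set (FieldTerm R)) (dot row b) := by
    refine hdots.imp le_rfl fun G' _ h => ⟨fun t ht => ?_, rfl, h⟩
    obtain ⟨b, hb, rfl⟩ := h3 t ht
    exact h b hb
  have hT : B.length * (4 * Fintype.card ι + 1) = B.length * (2 * Fintype.card ι) +
      B.length * (1 + Fintype.card ι * 2) := by ring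
  rw [hT]
  refine hfind.bind fun o G₁ hs₁ hc₁ => ?_
  rintro ⟨ho, hd⟩
  match o, ho with
  | none, ho =>
    refine spec_ret (Ext.pure hc₁ ⟨rfl, fun b hb i => (hB b hb i).mono' hs₁, fun v => ?_⟩)
    refine ⟨fun hv => ⟨hv, ?_⟩, fun hv => hv.1⟩
    refine Submodule.span_induction (p := fun v _ => ∑ i, (row i).eval mem * v i = 0)
      ?_ (by simp) ?_ ?_ hv
    · rintro _ ⟨b, hb, rfl⟩
      rw [← eval_dot]
      exact h1 ho.symm b hb
    · intro x y _ _ hx hy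
      simp only [Pi.add_apply, mul_add, Finset.sum_add_distrib, hx, hy, add_zero]
    · intro c x _ hx
      simp only [Pi.smul_apply, smul_eq_mul, mul_left_comm _ c, ← Finset.mul_sum, hx, mul_zero]
  | some p, ho =>
    obtain ⟨hp, h0⟩ := h2 p ho.symm
    refine spec_ret ?_
    refine (ext_list (P := fun b G => ∀ i, Avail (G : Set (FieldTerm R)) (eliminate row p b i))
      (c := 1 + Fintype.card ι * 2)
      (fun _ _ _ hs h i => (h i).mono' hs) B hc₁ fun b hb G₂ hs₂ hc₂ => ?_).imp le_rfl
        fun G₂ _ h => ⟨by simp, ?_, fun v => spanOf_map_eliminate mem row p B hp h0 v⟩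
    · refine (ext_op hc₂ .div ((hd b hb).mono' hs₂) ((hd p hp).mono' hs₂)).bind
        fun G₃ hs₃ hc₃ hdiv => ?_
      refine (ext_finset (P := fun i G => Avail (G : Set (FieldTerm R)) (eliminate row p b i))
        (fun _ _ _ hs h => h.mono' hs) Finset.univ hc₃ (c := 2) fun i _ G₄ hs₄ hc₄ => ?_).imp
        le_rfl fun G₄ _ h i => h i (Finset.mem_univ i)
      have hs := hs₁.trans (hs₂.trans (hs₃.trans hs₄))
      exact (ext_op hc₄ .mul (hdiv.mono' hs₄) ((hB p hp i).mono' hs)).bind fun G₅ hs₅ hc₅ hm =>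
        ext_op hc₅ .sub ((hB b hb i).mono' (hs.trans hs₅)) hm
    · intro b' hb'
      obtain ⟨b, hb, rfl⟩ := List.mem_map.1 hb'
      exact h b hb

theorem kernelFrom_spec {ι : Type} [Fintype ι] (mem : R → F) (rows : List (ι → FieldTerm R)) :
    ∀ {G : Finset (FieldTerm R)} {B : List (ι → FieldTerm R)}, Closed (G : Set (FieldTerm R)) →
      (∀ row ∈ rows, ∀ i, Avail (G : Set (FieldTerm R)) (row i)) →
      (∀ b ∈ B, ∀ i, Avail (G : Set (FieldTerm R)) (b i)) →
    Spec mem (kernelFrom rows B) G (rows.length * (B.length * (4 * Fintype.card ι + 1)))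
      fun B' G' =>
      B'.length = B.length ∧ (∀ b ∈ B', ∀ i, Avail (G' : Set (FieldTerm R)) (b i)) ∧
      ∀ v, v ∈ spanOf mem B' ↔ v ∈ spanOf mem B ∧
        ∀ row ∈ rows, ∑ i, (row i).eval mem * v i = 0 := by
  induction rows with
  | nil =>
    intro G B hG _ hB
    exact spec_ret (Ext.pure hG ⟨rfl, hB, by simp⟩)
  | cons row rows ih =>
    intro G B hG hrows hB
    rw [List.length_cons, Nat.succ_mul, add_comm]
    refine (kernelStep_spec mem hG (hrows row (by simp)) hB).bind fun B₁ G₁ hs₁ hc₁ => ?_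
    rintro ⟨hl, hB₁, hsp⟩
    rw [← hl]
    refine (ih hc₁ (fun r hr i => (hrows r (by simp [hr]) i).mono' hs₁) hB₁).imp le_rfl
      fun B₂ G₂ _ h => ⟨h.1.trans rfl, h.2.1, fun v => ?_⟩
    rw [h.2.2, hsp, and_assoc, List.forall_mem_cons]

/-- The pivot is not removed but becomes the zero vector, so the list keeps the length of the
standard basis. It spans the solutions without being a basis, which is all that is used later. -/
theorem kernel_spec {ι : Type} [Fintype ι] (mem : R → F) (rows : List (ι → FieldTerm R))
    (hG : Closed (G : Set (FieldTerm R)))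
    (hrows : ∀ row ∈ rows, ∀ i, Avail (G : Set (FieldTerm R)) (row i)) :
    Spec mem (kernel rows) G
      (1 + rows.length * (Fintype.card ι * (4 * Fintype.card ι + 1))) fun B G' =>
      B.length = Fintype.card ι ∧ (∀ b ∈ B, ∀ i, Avail (G' : Set (FieldTerm R)) (b i)) ∧
      ∀ v, v ∈ spanOf mem B ↔ ∀ row ∈ rows, ∑ i, (row i).eval mem * v i = 0 := by
  classical
  have hlen : (unitVectors R ι).length = Fintype.card ι := by simp [unitVectors]
  refine (ext_one hG).bind fun G₁ hs₁ hc₁ hone => ?_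
  have hB : ∀ b ∈ unitVectors R ι, ∀ i, Avail (G₁ : Set (FieldTerm R)) (b i) := by
    intro b hb i
    obtain ⟨j, -, rfl⟩ := List.mem_map.1 hb
    dsimp only
    split_ifs
    · exact hone
    · trivial
  have := kernelFrom_spec mem rows hc₁ (fun r hr i => (hrows r hr i).mono' hs₁) hB
  rw [hlen] at this
  refine Ext.imp this le_rfl fun G' _ h => ⟨h.1, h.2.1, h.2.2.1, fun v => ?_⟩
  refine (h.2.2.2 v).trans ?_
  rw [and_iff_right]
  have hv : v = ∑ i, v i • Pi.single i (1 : F) := by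
    ext j; simp [Finset.sum_apply, Pi.single_apply]
  rw [hv]
  refine Submodule.sum_mem _ fun i _ => Submodule.smul_mem _ _ (Submodule.subset_span ?_)
  refine ⟨_, List.mem_map.2 ⟨i, by simp, rfl⟩, ?_⟩
  ext j
  by_cases hj : j = i
  · subst hj; simp [FieldTerm.eval]
  · simp [hj, FieldTerm.eval]

end ZeroTree

/-! ### Iteration of procedures over lists -/

namespace ZeroTree

open FieldTerm

variable {R β γ : Type} {F : Type*} [Field F] {mem : R → F} {G : Finset (FieldTerm R)}

theorem Spec.ofExt {α : Type} {m : ZeroTree R α} {T T' : ℕ} {P : Finset (FieldTerm R) → Prop}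
    {q : α → Finset (FieldTerm R) → Prop} (h : Ext G T P)
    (h' : ∀ G', G ⊆ G' → Closed (G' : Set (FieldTerm R)) → P G' → Spec mem m G' T' q) :
    Spec mem m G (T + T') q :=
  Ext.bind h h'

/-- Run a procedure for all elements of a list and concatenate the results. -/
def collect (f : β → ZeroTree R (List γ)) : List β → ZeroTree R (List γ)
  | [] => ret []
  | b :: l => (f b).bind fun r => (collect f l).bind fun r' => ret (r ++ r')

theorem collect_spec {f : β → ZeroTree R (List γ)} {post : β → List γ → Finset (FieldTerm R) → Prop}
    (hmono : ∀ b r G G', G ⊆ G' → post b r G → post b r G') {c : ℕ} (l : List β) :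
    ∀ {G : Finset (FieldTerm R)}, Closed (G : Set (FieldTerm R)) →
      (∀ b ∈ l, ∀ G', G ⊆ G' → Closed (G' : Set (FieldTerm R)) → Spec mem (f b) G' c (post b)) →
      Spec mem (collect f l) G (l.length * c) fun r G' =>
        (∀ v ∈ r, ∃ b ∈ l, ∃ r', post b r' G' ∧ v ∈ r') ∧
        ∀ b ∈ l, ∃ r', post b r' G' ∧ ∀ v ∈ r', v ∈ r := by
  induction l with
  | nil => intro G hG _; exact spec_ret (Ext.pure hG (by simp))
  | cons b l ih =>
    intro G hG h
    rw [List.length_cons, Nat.succ_mul, add_comm]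
    refine (h b (by simp) G subset_rfl hG).bind fun r G₁ hs₁ hc₁ hr => ?_
    rw [← add_zero (l.length * c)]
    refine (ih hc₁ fun b' hb' G' hs' => h b' (by simp [hb']) G' (hs₁.trans hs')).bind
      fun r' G₂ hs₂ hc₂ hr' => spec_ret (Ext.pure hc₂ ⟨fun v hv => ?_, fun b' hb' => ?_⟩)
    · rcases List.mem_append.1 hv with hv | hv
      · exact ⟨b, by simp, r, hmono _ _ _ _ hs₂ hr, hv⟩
      · obtain ⟨b', hb', q, hq, hvq⟩ := hr'.1 v hv
        exact ⟨b', by simp [hb'], q, hq, hvq⟩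
    · rcases List.mem_cons.1 hb' with rfl | hb'
      · exact ⟨r, hmono _ _ _ _ hs₂ hr, fun v hv => List.mem_append_left _ hv⟩
      · obtain ⟨q, hq, hvq⟩ := hr'.2 b' hb'
        exact ⟨q, hq, fun v hv => List.mem_append_right _ (hvq v hv)⟩

end ZeroTree

/-! ### Absorbing sums into powers -/

section Numerals

/-- Four summands of at most Z^(q-1) each are absorbed by one more factor Z ≥ 4. All cost bounds of
the decoder are simplified in this way. -/
theorem add_pow_le_pow {Z : ℕ} (hZ : 4 ≤ Z) {a b c e x y z w : ℕ} {q : ℕ} (hx : x ≤ Z ^ a)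
    (hy : y ≤ Z ^ b) (hz : z ≤ Z ^ c) (hw : w ≤ Z ^ e) (ha : a < q) (hb : b < q) (hc : c < q)
    (he : e < q) : x + y + z + w ≤ Z ^ q := by
  obtain ⟨q, rfl⟩ : ∃ q', q = q' + 1 := ⟨q - 1, by omega⟩
  have h : ∀ j, j < q + 1 → Z ^ j ≤ Z ^ q := fun j hj => Nat.pow_le_pow_right (by omega) (by omega)
  have h1 := h a ha
  have h2 := h b hb
  have h3 := h c hc
  have h4 := h e he
  rw [pow_succ]
  nlinarith

end Numerals

/-! ### Terms for the interpolation coefficients and their cost -/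

namespace Decoder

open FieldTerm

variable {k s n : ℕ}

/-- The input registers of a decoder. -/
abbrev Inp (k s n : ℕ) : Type := Fin n ⊕ EntryIndex k s n

/-- An entry of the received word. -/
noncomputable def recvTerm (a : Fin k → Fin n) (v : Fin k →₀ ℕ) : FieldTerm (Inp k s n) :=
  if h : v.degree < s then var (Sum.inr (a, ⟨v, h⟩)) else zero

theorem avail_recvTerm (S : Set (FieldTerm (Inp k s n))) (a : Fin k → Fin n) (v : Fin k →₀ ℕ) :
    Avail S (recvTerm a v) := by
  unfold recvTerm
  split_ifs <;> trivial

/-- A jet of a monomial at a grid point. -/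
noncomputable def monTerm (a : Fin k → Fin n) (u μ : Fin k →₀ ℕ) : FieldTerm (Inp k s n) :=
  prodOver Finset.univ fun i =>
    op .mul (binTerm (μ i) (u i)) (powTerm (var (Sum.inl (a i))) (μ i - u i))

/-- A product of binomial coefficients. -/
noncomputable def multiTerm (v e : Fin k →₀ ℕ) : FieldTerm (Inp k s n) :=
  prodOver Finset.univ fun i => binTerm (v i) (e i)

/-- An interpolation coefficient, for given jets `y`. -/
noncomputable def interpTerm (y : (Fin k →₀ ℕ) → FieldTerm (Inp k s n)) (a : Fin k → Fin n)
    (u e μ : Fin k →₀ ℕ) : FieldTerm (Inp k s n) :=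
  sumOver (Finset.HasAntidiagonal.antidiagonal u) fun p =>
    op .mul (monTerm a p.1 μ) (op .mul (multiTerm (p.2 + e) e) (y (p.2 + e)))

section Eval

variable {F : Type*} [Field F] (mem : Inp k s n → F)

/-- The received jets, extended by zero to all orders. -/
noncomputable def recv (a : Fin k → Fin n) (v : Fin k →₀ ℕ) : F :=
  if h : v.degree < s then mem (Sum.inr (a, ⟨v, h⟩)) else 0

/-- A point of the grid. -/
def point (a : Fin k → Fin n) : Fin k → F := fun i => mem (Sum.inl (a i))

theorem eval_recvTerm (a : Fin k → Fin n) (v : Fin k →₀ ℕ) :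
    (recvTerm a v).eval mem = recv mem a v := by
  unfold recvTerm recv
  split_ifs <;> rfl

theorem eval_monTerm (a : Fin k → Fin n) (u μ : Fin k →₀ ℕ) :
    (monTerm a u μ).eval mem = jet (point mem a) u (monomial μ 1) := by
  rw [jet_monomial, monTerm, eval_prodOver]
  refine Finset.prod_congr rfl fun i _ => ?_
  simp [FieldTerm.eval, FieldOp.eval, eval_binTerm, eval_powTerm, point]

theorem eval_multiTerm (v e : Fin k →₀ ℕ) :
    (multiTerm (s := s) (n := n) v e).eval mem = (multiChoose v e : F) := by
  rw [multiTerm, eval_prodOver, multiChoose, Nat.cast_prod]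
  exact Finset.prod_congr rfl fun i _ => eval_binTerm mem _ _

theorem eval_interpTerm (y : (Fin k →₀ ℕ) → FieldTerm (Inp k s n)) (a : Fin k → Fin n)
    (u e μ : Fin k →₀ ℕ) : (interpTerm y a u e μ).eval mem =
      interpCoeff (point mem a) u e μ fun v => (y v).eval mem := by
  rw [interpTerm, eval_sumOver, interpCoeff]
  refine Finset.sum_congr rfl fun p _ => ?_
  simp [FieldTerm.eval, FieldOp.eval, eval_monTerm, eval_multiTerm]

end Eval

section Cost

variable {G : Finset (FieldTerm (Inp k s n))} {Z : ℕ}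

theorem ext_monTerm (hZ : 4 ≤ Z) (hk : k + 1 ≤ Z) (hG : Closed (G : Set (FieldTerm (Inp k s n))))
    (a : Fin k → Fin n) {u μ : Fin k →₀ ℕ} (hu : ∀ i, u i < Z) (hμ : ∀ i, μ i < Z) :
    Ext G (Z ^ 5) fun G' => Avail (G' : Set (FieldTerm (Inp k s n))) (monTerm a u μ) := by
  have h1 : ∀ i ∈ (Finset.univ : Finset (Fin k)), ∀ G', G ⊆ G' →
      Closed (G' : Set (FieldTerm (Inp k s n))) → Ext G' (Z ^ 2 + Z + 1) fun G'' =>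
        Avail (G'' : Set (FieldTerm (Inp k s n)))
          (op .mul (binTerm (μ i) (u i)) (powTerm (var (Sum.inl (a i))) (μ i - u i))) := by
    intro i _ G₁ _ hc₁
    refine Ext.bind (T := Z ^ 2 + Z) (P := fun G' =>
      Avail (G' : Set (FieldTerm (Inp k s n))) (binTerm (μ i) (u i)) ∧
        Avail (G' : Set (FieldTerm (Inp k s n))) (powTerm (var (Sum.inl (a i))) (μ i - u i)))
      ?_ fun G' _ hc h => ext_op hc _ h.1 h.2
    refine Ext.bind (T := Z ^ 2) ((ext_binTerm hc₁ (μ i) (u i)).imp ?_ fun _ _ h => h (u i) le_rfl)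
      fun G' _ hc h => ?_
    · rw [pow_two]; exact Nat.mul_le_mul (hμ i) (hu i)
    · refine (ext_powTerm hc (x := var (Sum.inl (a i))) trivial (μ i - u i)).imp ?_
        fun _ hs h' => ⟨h.mono' hs, h'⟩
      have := hμ i
      omega
  refine (ext_prodOver hG h1).imp ?_ fun _ _ h => h
  rw [Finset.card_univ, Fintype.card_fin]
  have h2 : Z ^ 2 + Z + 1 + 0 ≤ Z ^ 3 :=
    add_pow_le_pow hZ (a := 2) (b := 1) (c := 0) (e := 0) le_rfl (by simp) (by simp) (by simp)
      (by omega) (by omega) (by omega) (by omega)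
  calc k * (Z ^ 2 + Z + 1) + (k + 1) ≤ Z * Z ^ 3 + Z :=
        add_le_add (Nat.mul_le_mul (by omega) (by omega)) hk
    _ = Z ^ 4 + Z + 0 + 0 := by ring
    _ ≤ Z ^ 5 := add_pow_le_pow hZ (a := 4) (b := 1) (c := 0) (e := 0) le_rfl (by simp) (by simp)
        (by simp) (by omega) (by omega) (by omega) (by omega)

theorem ext_multiTerm (hZ : 4 ≤ Z) (hk : k + 1 ≤ Z) (hG : Closed (G : Set (FieldTerm (Inp k s n))))
    {v e : Fin k →₀ ℕ} (hv : ∀ i, v i < Z) (he : ∀ i, e i < Z) :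
    Ext G (Z ^ 5) fun G' => Avail (G' : Set (FieldTerm (Inp k s n))) (multiTerm v e) := by
  have h1 : ∀ i ∈ (Finset.univ : Finset (Fin k)), ∀ G', G ⊆ G' →
      Closed (G' : Set (FieldTerm (Inp k s n))) → Ext G' (Z ^ 2) fun G'' =>
        Avail (G'' : Set (FieldTerm (Inp k s n))) (binTerm (v i) (e i)) := by
    intro i _ G₁ _ hc₁
    refine (ext_binTerm hc₁ (v i) (e i)).imp ?_ fun _ _ h => h (e i) le_rfl
    rw [pow_two]; exact Nat.mul_le_mul (hv i) (he i)
  refine (ext_prodOver hG h1).imp ?_ fun _ _ h => h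
  rw [Finset.card_univ, Fintype.card_fin]
  calc k * Z ^ 2 + (k + 1) ≤ Z * Z ^ 2 + Z :=
        add_le_add (Nat.mul_le_mul (by omega) (by omega)) hk
    _ = Z ^ 3 + Z + 0 + 0 := by ring
    _ ≤ Z ^ 5 := add_pow_le_pow hZ (a := 3) (b := 1) (c := 0) (e := 0) le_rfl (by simp) (by simp)
        (by simp) (by omega) (by omega) (by omega) (by omega)

theorem card_antidiagonal_le {u : Fin k →₀ ℕ} (hu : u.degree < s) :
    (Finset.HasAntidiagonal.antidiagonal u).card ≤ Fintype.card (DerivIndex k s) := by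
  classical
  have hp : ∀ p ∈ Finset.HasAntidiagonal.antidiagonal u, p.1.degree < s := by
    intro p hp
    have : p.1.degree + p.2.degree = u.degree := by
      rw [← map_add, Finset.HasAntidiagonal.mem_antidiagonal.1 hp]
    omega
  rw [← Finset.card_univ]
  refine Finset.card_le_card_of_injOn
    (fun p => if h : p.1.degree < s then (⟨p.1, h⟩ : DerivIndex k s) else ⟨u, hu⟩)
    (fun _ _ => Finset.mem_coe.2 (Finset.mem_univ _)) fun p hp₁ q hq₁ h => ?_
  have h1 := hp p hp₁
  have h2 := hp q hq₁
  simp only [h1, h2, dif_pos, Subtype.mk.injEq] at h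
  have h3 := Finset.HasAntidiagonal.mem_antidiagonal.1 (Finset.mem_coe.1 hp₁)
  have h4 := Finset.HasAntidiagonal.mem_antidiagonal.1 (Finset.mem_coe.1 hq₁)
  refine Prod.ext h ?_
  rw [← h4, h] at h3
  exact add_left_cancel h3

/-- The jets y are left abstract because two kinds occur: received entries, which are free, and jets
of monomials. -/
theorem ext_interpTerm (hZ : 4 ≤ Z) (hk : k + 1 ≤ Z) (hs : s ≤ Z)
    (hcard : Fintype.card (DerivIndex k s) ≤ Z)
    (hG : Closed (G : Set (FieldTerm (Inp k s n))))
    {y : (Fin k →₀ ℕ) → FieldTerm (Inp k s n)} (a : Fin k → Fin n) {u e μ : Fin k →₀ ℕ}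
    (hue : u.degree + e.degree < s) (hμ : ∀ i, μ i < Z)
    (hy : ∀ v : Fin k →₀ ℕ, v.degree < s → ∀ G', G ⊆ G' →
      Closed (G' : Set (FieldTerm (Inp k s n))) →
      Ext G' (Z ^ 5) fun G'' => Avail (G'' : Set (FieldTerm (Inp k s n))) (y v)) :
    Ext G (Z ^ 8) fun G' =>
      Avail (G' : Set (FieldTerm (Inp k s n))) (interpTerm y a u e μ) := by
  have hlt : ∀ w : Fin k →₀ ℕ, w.degree < s → ∀ i, w i < Z := fun w hw i =>
    ((Finsupp.le_degree i w).trans_lt hw).trans_le hs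
  have h1 : ∀ p ∈ Finset.HasAntidiagonal.antidiagonal u, ∀ G', G ⊆ G' →
      Closed (G' : Set (FieldTerm (Inp k s n))) →
      Ext G' (Z ^ 5 + (Z ^ 5 + (Z ^ 5 + (1 + 1)))) fun G'' =>
        Avail (G'' : Set (FieldTerm (Inp k s n)))
          (op .mul (monTerm a p.1 μ) (op .mul (multiTerm (p.2 + e) e) (y (p.2 + e)))) := by
    intro p hp G₁ hs₁ hc₁
    have hdeg : p.1.degree + p.2.degree = u.degree := by
      rw [← map_add, Finset.HasAntidiagonal.mem_antidiagonal.1 hp]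
    have hpe : (p.2 + e).degree < s := by rw [map_add]; omega
    refine (ext_monTerm hZ hk hc₁ a (hlt p.1 (by omega)) hμ).bind fun G₂ hs₂ hc₂ h₂ => ?_
    refine (ext_multiTerm hZ hk hc₂ (hlt _ hpe) (hlt e (by omega))).bind
      fun G₃ hs₃ hc₃ h₃ => ?_
    refine (hy _ hpe G₃ (hs₁.trans (hs₂.trans hs₃)) hc₃).bind fun G₄ hs₄ hc₄ h₄ => ?_
    exact (ext_op hc₄ .mul (h₃.mono' hs₄) h₄).bind fun G₅ hs₅ hc₅ h₅ =>
      ext_op hc₅ .mul (h₂.mono' (hs₃.trans (hs₄.trans hs₅))) h₅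
  refine (ext_sumOver hG h1).imp ?_ fun _ _ h => h
  have hanti := (card_antidiagonal_le (u := u) (s := s) (by omega)).trans hcard
  have h2 : Z ^ 5 + Z ^ 5 + Z ^ 5 + 2 ≤ Z ^ 6 :=
    add_pow_le_pow hZ (a := 5) (b := 5) (c := 5) (e := 1) le_rfl le_rfl le_rfl (by simp; omega)
      (by omega) (by omega) (by omega) (by omega)
  calc _ ≤ Z * Z ^ 6 + Z := add_le_add (Nat.mul_le_mul hanti (by omega)) hanti
    _ = Z ^ 7 + Z + 0 + 0 := by ring
    _ ≤ Z ^ 8 := add_pow_le_pow hZ (a := 7) (b := 1) (c := 0) (e := 0) le_rfl (by simp) (by simp)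
        (by simp) (by omega) (by omega) (by omega) (by omega)

end Cost

end Decoder

theorem card_derivIndex_mono (k : ℕ) {s s' : ℕ} (h : s ≤ s') :
    Fintype.card (DerivIndex k s) ≤ Fintype.card (DerivIndex k s') :=
  Fintype.card_le_of_injective (fun e => ⟨e.1, e.2.trans_le h⟩) fun e e' h => by
    simpa [Subtype.ext_iff] using h

section Linear

variable {F : Type*} [Field F] {k : ℕ}

theorem jet_diffOp_polyOf {m b d : ℕ} (Q : DerivIndex k m × DerivIndex k b → F)
    (c : DerivIndex k d → F) (a : Fin k → F) (u : Fin k →₀ ℕ) :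
    jet a u (diffOp Q (polyOf c)) = ∑ κ, (∑ p, Q p *
      interpCoeff a u p.1.1 p.2.1 fun v => jet a v (monomial κ.1 1)) * c κ := by
  rw [jet_diffOp]
  simp only [Finset.sum_mul]
  rw [Finset.sum_comm]
  refine Finset.sum_congr rfl fun p _ => ?_
  simp only [interpCoeff, jet_polyOf, Finset.mul_sum, Finset.sum_mul]
  rw [Finset.sum_comm]
  refine Finset.sum_congr rfl fun q _ => Finset.sum_congr rfl fun κ _ => by ring

end Linear

/-! ### Linear equations for the candidate space -/

namespace Decoder

open FieldTerm ZeroTree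

variable {k s n : ℕ} {F : Type*} [Field F]

/-- The linear equations that define the interpolating operators. -/
noncomputable def interpRows (k s n m D : ℕ) :
    List (DerivIndex k (m + 1) × DerivIndex k (D + 1) → FieldTerm (Inp k s n)) :=
  (Finset.univ : Finset ((Fin k → Fin n) × DerivIndex k (s - m))).toList.map fun q p =>
    interpTerm (recvTerm q.1) q.1 q.2.1 p.1.1 p.2.1

/-- The linear equation that an operator imposes on the coefficients of a polynomial. -/
noncomputable def operatorRow (d : ℕ) {m D : ℕ}
    (Q : DerivIndex k (m + 1) × DerivIndex k (D + 1) → FieldTerm (Inp k s n))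
    (q : (Fin k → Fin n) × DerivIndex k (s - m)) :
    Option (DerivIndex k (d + 1)) → FieldTerm (Inp k s n)
  | none => zero
  | some κ => dot Q fun p =>
      interpTerm (fun v => monTerm q.1 v κ.1) q.1 q.2.1 p.1.1 p.2.1

/-- The linear equations imposed by a list of operators. -/
noncomputable def operatorRows (d : ℕ) {m D : ℕ}
    (Qs : List (DerivIndex k (m + 1) × DerivIndex k (D + 1) → FieldTerm (Inp k s n))) :
    List (Option (DerivIndex k (d + 1)) → FieldTerm (Inp k s n)) :=
  Qs.flatMap fun Q => (Finset.univ : Finset ((Fin k → Fin n) × DerivIndex k (s - m))).toList.map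
    fun q => operatorRow d Q q

/-- Linear equations that define the candidate space. -/
noncomputable def candidateRows (k s n d m D : ℕ) :
    ZeroTree (Inp k s n) (List (Option (DerivIndex k (d + 1)) → FieldTerm (Inp k s n))) :=
  if d < s then ret [] else (kernel (interpRows k s n m D)).bind fun Qs => ret (operatorRows d Qs)

/-- The enumeration of the grid coordinates that the input describes. -/
def coord (mem : Inp k s n → F) : Fin n → F := fun i => mem (Sum.inl i)

/-- The space of all polynomials that the decoder takes into account. -/
noncomputable abbrev space (mem : Inp k s n → F) (d m D : ℕ) :
    Submodule F (MvPolynomial (Fin k) F) :=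
  candidateSpace (coord mem) m D s d (recv mem)

theorem mem_interpolants_iff (mem : Inp k s n → F) {m D : ℕ}
    (Q : DerivIndex k (m + 1) × DerivIndex k (D + 1) → F) :
    Q ∈ interpolants (coord mem) m D s (recv mem) ↔
      ∀ row ∈ interpRows k s n m D, ∑ i, (row i).eval mem * Q i = 0 := by
  simp only [interpRows, List.forall_mem_map, eval_interpTerm, Finset.mem_toList,
    Finset.mem_univ, true_implies, eval_recvTerm, interpolants, Set.mem_ofPred_eq, Prod.forall]
  refine forall_congr' fun a => forall_congr' fun u => ?_
  rw [Finset.sum_congr rfl fun p _ => mul_comm (Q p) _]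
  rfl

theorem sum_operatorRow (mem : Inp k s n → F) {d m D : ℕ}
    (Q : DerivIndex k (m + 1) × DerivIndex k (D + 1) → FieldTerm (Inp k s n))
    (q : (Fin k → Fin n) × DerivIndex k (s - m)) (w : Option (DerivIndex k (d + 1)) → F) :
    ∑ i, (operatorRow d Q q i).eval mem * w i = jet (point mem q.1) q.2.1
      (diffOp (fun p => (Q p).eval mem) (polyOf fun κ => w (some κ))) := by
  rw [jet_diffOp_polyOf, Fintype.sum_option]
  simp [operatorRow, FieldTerm.eval, eval_dot, eval_interpTerm, eval_monTerm]

/-- For fixed f the jets of Q f are linear in Q, so it suffices to impose the conditions for the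
operators in a spanning list. -/
theorem polyOf_mem_space_iff (mem : Inp k s n → F) {d m D : ℕ} (hds : ¬d < s)
    {Qs : List (DerivIndex k (m + 1) × DerivIndex k (D + 1) → FieldTerm (Inp k s n))}
    (hQs : ∀ v, v ∈ spanOf mem Qs ↔
      ∀ row ∈ interpRows k s n m D, ∑ i, (row i).eval mem * v i = 0)
    (w : Option (DerivIndex k (d + 1)) → F) :
    (polyOf fun κ => w (some κ)) ∈ space mem d m D ↔
      ∀ row ∈ operatorRows d Qs, ∑ i, (row i).eval mem * w i = 0 := by
  have h1 : (∀ row ∈ operatorRows d Qs, ∑ i, (row i).eval mem * w i = 0) ↔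
      ∀ Q ∈ Qs, ∀ q : (Fin k → Fin n) × DerivIndex k (s - m), jet (point mem q.1) q.2.1
        (diffOp (fun p => (Q p).eval mem) (polyOf fun κ => w (some κ))) = 0 := by
    simp only [operatorRows, List.mem_flatMap, forall_exists_index, and_imp]
    constructor
    · intro h Q hQ q
      rw [← sum_operatorRow]
      exact h _ Q hQ (List.mem_map.2 ⟨q, by simp, rfl⟩)
    · rintro h row Q hQ hrow
      obtain ⟨q, -, rfl⟩ := List.mem_map.1 hrow
      rw [sum_operatorRow]
      exact h Q hQ q
  rw [h1, space, candidateSpace, if_neg hds]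
  constructor
  · rintro ⟨-, h⟩ Q hQ q
    refine h _ ?_ q.1 q.2
    rw [mem_interpolants_iff, ← hQs]
    exact Submodule.subset_span ⟨Q, hQ, rfl⟩
  · refine fun h => ⟨totalDegree_polyOf_le _, fun Q hQ a u => ?_⟩
    rw [mem_interpolants_iff, ← hQs] at hQ
    refine Submodule.span_induction (p := fun Q _ => jet (fun i => coord mem (a i)) u.1
      (diffOp Q (polyOf fun κ => w (some κ))) = 0) ?_ ?_ ?_ ?_ hQ
    · rintro _ ⟨b, hb, rfl⟩
      exact h b hb (a, u)
    · simp [jet_diffOp]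
    · intro x y _ _ hx hy
      rw [jet_diffOp] at hx hy ⊢
      simp only [Pi.add_apply, add_mul, Finset.sum_add_distrib, hx, hy, add_zero]
    · intro c x _ hx
      rw [jet_diffOp] at hx ⊢
      simp only [Pi.smul_apply, smul_eq_mul, mul_assoc, ← Finset.mul_sum, hx, mul_zero]

/-- A bound for all parameters of the decoder. -/
structure Bounded (Z k s n d m D : ℕ) : Prop where
  four_le : 4 ≤ Z
  dim : k + 1 ≤ Z
  deg : d + 1 ≤ Z
  grid : n ^ k ≤ Z
  coeffs : Fintype.card (DerivIndex k (d + 1)) + 1 ≤ Z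
  order : s ≤ d → s ≤ Z
  interpDeg : s ≤ d → D + 1 ≤ Z
  jets : s ≤ d → Fintype.card (DerivIndex k s) ≤ Z
  operators : s ≤ d → Fintype.card (DerivIndex k (m + 1)) ≤ Z
  interpCoeffs : s ≤ d → Fintype.card (DerivIndex k (D + 1)) ≤ Z

variable {G : Finset (FieldTerm (Inp k s n))} {Z d m D : ℕ}

theorem Bounded.card_grid_prod (h : Bounded Z k s n d m D) (hsd : s ≤ d) :
    Fintype.card ((Fin k → Fin n) × DerivIndex k (s - m)) ≤ Z ^ 2 := by
  rw [Fintype.card_prod, pow_two]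
  refine Nat.mul_le_mul (by simpa using h.grid) ?_
  exact (card_derivIndex_mono k (Nat.sub_le s m)).trans (h.jets hsd)

theorem Bounded.card_operators_prod (h : Bounded Z k s n d m D) (hsd : s ≤ d) :
    Fintype.card (DerivIndex k (m + 1) × DerivIndex k (D + 1)) ≤ Z ^ 2 := by
  rw [Fintype.card_prod, pow_two]
  exact Nat.mul_le_mul (h.operators hsd) (h.interpCoeffs hsd)

theorem ext_interpRows (h : Bounded Z k s n d m D) (hsd : s ≤ d)
    (hG : Closed (G : Set (FieldTerm (Inp k s n)))) :
    Ext G (Z ^ 12) fun G' => ∀ row ∈ interpRows k s n m D, ∀ i,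
      Avail (G' : Set (FieldTerm (Inp k s n))) (row i) := by
  refine (ext_finset (P := fun (q : (Fin k → Fin n) × DerivIndex k (s - m)) G' =>
      ∀ p : DerivIndex k (m + 1) × DerivIndex k (D + 1),
    Avail (G' : Set (FieldTerm (Inp k s n)))
      (interpTerm (recvTerm q.1) q.1 q.2.1 p.1.1 p.2.1))
    (fun _ _ _ hs h p => (h p).mono' hs) (c := Z ^ 10) Finset.univ hG fun q _ G₁ hs₁ hc₁ => ?_).imp
    ?_ fun G' _ h => ?_
  · refine (ext_finset (P := fun (p : DerivIndex k (m + 1) × DerivIndex k (D + 1)) G' =>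
      Avail (G' : Set (FieldTerm (Inp k s n))) (interpTerm (recvTerm q.1) q.1 q.2.1 p.1.1 p.2.1))
      (fun _ _ _ hs h => h.mono' hs) (c := Z ^ 8) Finset.univ hc₁
      fun (p : DerivIndex k (m + 1) × DerivIndex k (D + 1)) _ G₂ hs₂ hc₂ => ?_).imp ?_
      fun G' _ h p => h p (Finset.mem_univ p)
    · refine ext_interpTerm (y := recvTerm q.1) (u := q.2.1) (e := p.1.1) (μ := p.2.1) h.four_le h.dim (h.order hsd) (h.jets hsd) hc₂ _ ?_ ?_ ?_
      · have h1 := q.2.2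
        have h2 := p.1.2
        omega
      · exact fun i => (p.2.coord_lt i).trans_le (h.interpDeg hsd)
      · exact fun v _ G' _ hc => (Ext.pure hc (avail_recvTerm _ _ _)).imp (Nat.zero_le _)
          fun _ _ h => h
    · rw [Finset.card_univ]
      calc _ ≤ Z ^ 2 * Z ^ 8 := Nat.mul_le_mul_right _ (h.card_operators_prod hsd)
        _ = Z ^ 10 := by ring
  · rw [Finset.card_univ]
    calc _ ≤ Z ^ 2 * Z ^ 10 := Nat.mul_le_mul_right _ (h.card_grid_prod hsd)
      _ = Z ^ 12 := by ring
  · intro row hrow i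
    obtain ⟨q, -, rfl⟩ := List.mem_map.1 hrow
    exact h q (Finset.mem_univ q) i

theorem length_interpRows (h : Bounded Z k s n d m D) (hsd : s ≤ d) :
    (interpRows k s n m D).length ≤ Z ^ 2 := by
  rw [interpRows, List.length_map, Finset.length_toList, Finset.card_univ]
  exact h.card_grid_prod hsd

theorem ext_operatorRows (h : Bounded Z k s n d m D) (hsd : s ≤ d)
    (hG : Closed (G : Set (FieldTerm (Inp k s n))))
    {Qs : List (DerivIndex k (m + 1) × DerivIndex k (D + 1) → FieldTerm (Inp k s n))}
    (hl : Qs.length ≤ Z ^ 2)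
    (hQs : ∀ Q ∈ Qs, ∀ p, Avail (G : Set (FieldTerm (Inp k s n))) (Q p)) :
    Ext G (Z ^ 16) fun G' => ∀ row ∈ operatorRows d Qs, ∀ i,
      Avail (G' : Set (FieldTerm (Inp k s n))) (row i) := by
  have hZ := h.four_le
  refine (ext_list (P := fun Q G' => ∀ q : (Fin k → Fin n) × DerivIndex k (s - m),
    ∀ i, Avail (G' : Set (FieldTerm (Inp k s n))) (operatorRow d Q q i))
    (fun _ _ _ hs h q i => (h q i).mono' hs) (c := Z ^ 14) Qs hG fun Q hQ G₁ hs₁ hc₁ => ?_).imp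
    ?_ fun G' _ h => ?_
  · refine (ext_finset (P := fun q G' => ∀ i,
      Avail (G' : Set (FieldTerm (Inp k s n))) (operatorRow d Q q i))
      (fun _ _ _ hs h i => (h i).mono' hs) (c := Z ^ 12) Finset.univ hc₁
      fun q _ G₂ hs₂ hc₂ => ?_).imp ?_ fun G' _ h q => h q (Finset.mem_univ q)
    · refine (ext_finset (P := fun κ G' =>
        Avail (G' : Set (FieldTerm (Inp k s n))) (operatorRow d Q q (some κ)))
        (fun _ _ _ hs h => h.mono' hs) (c := Z ^ 10 + 2 * Z ^ 2) Finset.univ hc₂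
        fun κ _ G₃ hs₃ hc₃ => ?_).imp ?_ fun G' _ h i => ?_
      · refine (Ext.bind (T := Z ^ 10) (T' := 2 * Z ^ 2) ((ext_finset
          (fun _ _ _ hs h => h.mono' hs) (c := Z ^ 8) Finset.univ hc₃
          fun (p : DerivIndex k (m + 1) × DerivIndex k (D + 1)) _ G₄ hs₄ hc₄ =>
            ext_interpTerm (y := fun v => monTerm q.1 v κ.1) (u := q.2.1) (e := p.1.1)
              (μ := p.2.1) hZ h.dim (h.order hsd) (h.jets hsd) hc₄ q.1 ?_ ?_ ?_).imp
          ?_ fun _ _ h => h) fun G' hs hc hp => ?_)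
        · have h1 := q.2.2
          have h2 := p.1.2
          omega
        · exact fun i => (p.2.coord_lt i).trans_le (h.interpDeg hsd)
        · exact fun v hv G' _ hc => ext_monTerm hZ h.dim hc _
            (fun i => ((Finsupp.le_degree i v).trans_lt hv).trans_le (h.order hsd))
            fun i => (κ.coord_lt i).trans_le h.deg
        · rw [Finset.card_univ]
          calc _ ≤ Z ^ 2 * Z ^ 8 := Nat.mul_le_mul_right _ (h.card_operators_prod hsd)
            _ = Z ^ 10 := by ring
        · refine (ext_dot hc (fun p => (hQs Q hQ p).mono'
            (hs₁.trans (hs₂.trans (hs₃.trans hs)))) fun p => hp p (Finset.mem_univ p)).imp ?_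
            fun _ _ h => h
          exact Nat.mul_le_mul_left _ (h.card_operators_prod hsd)
      · rw [Finset.card_univ]
        have h1 : Z ^ 10 + Z ^ 2 + Z ^ 2 + 0 ≤ Z ^ 11 :=
          add_pow_le_pow hZ (a := 10) (b := 2) (c := 2) (e := 0) le_rfl le_rfl le_rfl (by simp)
            (by omega) (by omega) (by omega) (by omega)
        have h2 := h.coeffs
        calc _ ≤ Z * Z ^ 11 := Nat.mul_le_mul (by omega) (by omega)
          _ = Z ^ 12 := by ring
      · match i with
        | none => trivial
        | some κ => exact h κ (Finset.mem_univ κ)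
    · rw [Finset.card_univ]
      calc _ ≤ Z ^ 2 * Z ^ 12 := Nat.mul_le_mul_right _ (h.card_grid_prod hsd)
        _ = Z ^ 14 := by ring
  · calc _ ≤ Z ^ 2 * Z ^ 14 := Nat.mul_le_mul_right _ hl
      _ = Z ^ 16 := by ring
  · intro row hrow i
    obtain ⟨Q, hQ, hrow⟩ := List.mem_flatMap.1 hrow
    obtain ⟨q, -, rfl⟩ := List.mem_map.1 hrow
    exact h Q hQ q i

theorem length_operatorRows (h : Bounded Z k s n d m D) (hsd : s ≤ d)
    {Qs : List (DerivIndex k (m + 1) × DerivIndex k (D + 1) → FieldTerm (Inp k s n))}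
    (hl : Qs.length ≤ Z ^ 2) : (operatorRows d Qs).length ≤ Z ^ 4 := by
  simp only [operatorRows, List.length_flatMap, List.length_map, Finset.length_toList,
    Finset.card_univ, List.map_const', List.sum_replicate, smul_eq_mul]
  calc _ ≤ Z ^ 2 * Z ^ 2 := Nat.mul_le_mul hl (h.card_grid_prod hsd)
    _ = Z ^ 4 := by ring

/-- For d < s no equation is needed; otherwise one kernel computation finds the operators, and their
conditions on the coefficients of f are written down. -/
theorem candidateRows_spec (mem : Inp k s n → F) (h : Bounded Z k s n d m D)
    (hG : Closed (G : Set (FieldTerm (Inp k s n)))) :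
    Spec mem (candidateRows k s n d m D) G (Z ^ 17) fun rows G' =>
      rows.length ≤ Z ^ 4 ∧
      (∀ row ∈ rows, ∀ i, Avail (G' : Set (FieldTerm (Inp k s n))) (row i)) ∧
      ∀ w : Option (DerivIndex k (d + 1)) → F, (polyOf fun κ => w (some κ)) ∈ space mem d m D ↔
        ∀ row ∈ rows, ∑ i, (row i).eval mem * w i = 0 := by
  have hZ := h.four_le
  unfold candidateRows
  split_ifs with hds
  · refine spec_ret ((Ext.pure hG ⟨by simp, by simp, fun w => ?_⟩).imp (Nat.zero_le _)
      fun _ _ h => h)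
    simp [space, candidateSpace, hds]
  · have hsd : s ≤ d := not_lt.1 hds
    have hT : Z ^ 12 + Z ^ 8 + Z ^ 16 + 0 ≤ Z ^ 17 :=
      add_pow_le_pow hZ (a := 12) (b := 8) (c := 16) (e := 0) le_rfl le_rfl le_rfl (by simp)
        (by omega) (by omega) (by omega) (by omega)
    refine Spec.imp (T := Z ^ 12 + (Z ^ 8 + Z ^ 16)) ?_ (by omega) fun _ _ _ h => h
    refine Spec.ofExt (ext_interpRows h hsd hG) fun G₁ hs₁ hc₁ hrows => ?_
    refine Spec.bind ((kernel_spec mem _ hc₁ hrows).imp ?_ fun _ _ _ h => h)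
      fun Qs G₂ hs₂ hc₂ hQs => spec_ret ?_
    · have h1 := h.card_operators_prod hsd
      set c := Fintype.card (DerivIndex k (m + 1) × DerivIndex k (D + 1))
      have h2 : 4 * c + 1 ≤ Z ^ 2 * 4 + 1 := by omega
      have h3 : Z ^ 2 * 4 + 1 ≤ Z ^ 3 + Z ^ 1 := by
        rw [pow_succ Z 2]
        refine add_le_add (Nat.mul_le_mul_left _ hZ) (by simp; omega)
      calc _ ≤ 1 + Z ^ 2 * (Z ^ 2 * (Z ^ 3 + Z ^ 1)) :=
            Nat.add_le_add_left (Nat.mul_le_mul (length_interpRows h hsd)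
              (Nat.mul_le_mul h1 (h2.trans h3))) 1
        _ = Z ^ 7 + Z ^ 5 + 1 + 0 := by ring
        _ ≤ Z ^ 8 := add_pow_le_pow hZ (a := 7) (b := 5) (c := 0) (e := 0) le_rfl le_rfl
            (by simp) (by simp) (by omega) (by omega) (by omega) (by omega)
    · obtain ⟨hl, hav, hsp⟩ := hQs
      have hl' : Qs.length ≤ Z ^ 2 := hl.trans_le (h.card_operators_prod hsd)
      exact (ext_operatorRows h hsd hc₂ hl' hav).imp le_rfl fun G₃ _ h' =>
        ⟨length_operatorRows h hsd hl', h', fun w => polyOf_mem_space_iff mem hds hsp w⟩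

end Decoder

/-! ### Solving for candidates, verification, and the whole procedure -/

namespace Decoder

open FieldTerm ZeroTree

variable {k s n : ℕ} {F : Type*} [Field F]

open Classical in
/-- The points at which the jets of a polynomial agree with the received jets. -/
noncomputable def agreeSet (mem : Inp k s n → F) (f : MvPolynomial (Fin k) F) :
    Finset (Fin k → Fin n) :=
  {a | ∀ v : Fin k →₀ ℕ, v.degree < s → jet (point mem a) v f = recv mem a v}

theorem mem_agreeSet {mem : Inp k s n → F} {f : MvPolynomial (Fin k) F} {a : Fin k → Fin n} :
    a ∈ agreeSet mem f ↔
      ∀ v : Fin k →₀ ℕ, v.degree < s → jet (point mem a) v f = recv mem a v := by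
  classical
  simp [agreeSet]

/-- The condition that a polynomial agrees with the received word at the points of a tuple, as
linear equations for a scaling factor of the received word and the coefficients. -/
noncomputable def tupleRows (d : ℕ) {t : ℕ} (τ : Fin t → Fin k → Fin n) :
    List (Option (DerivIndex k (d + 1)) → FieldTerm (Inp k s n)) :=
  (Finset.univ : Finset (Fin t × DerivIndex k (min s (d + 1)))).toList.map fun q i =>
    i.elim (op .sub zero (recvTerm (τ q.1) q.2.1)) fun κ => monTerm (τ q.1) q.2.1 κ.1

/-- The coefficients of the polynomial that is determined by the values at a tuple of points. -/
noncomputable def candidate {d t : ℕ}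
    (rows : List (Option (DerivIndex k (d + 1)) → FieldTerm (Inp k s n)))
    (τ : Fin t → Fin k → Fin n) :
    ZeroTree (Inp k s n) (Option (DerivIndex k (d + 1) → FieldTerm (Inp k s n))) :=
  (kernel (rows ++ tupleRows d τ)).bind fun B => (findFirst (fun b => b none) B).bind fun o =>
    ret (o.map fun b κ => op .div (b (some κ)) (b none))

/-- The entries of the encoding of the polynomial with given coefficients. -/
noncomputable def encodeTerm {d : ℕ} (c : DerivIndex k (d + 1) → FieldTerm (Inp k s n))
    (q : EntryIndex k s n) : FieldTerm (Inp k s n) :=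
  if q.2.1.degree < d + 1 then dot c fun κ => monTerm q.1 q.2.1 κ.1 else zero

/-- The difference between an entry of the encoding and the corresponding received entry. -/
noncomputable def differTerm {d : ℕ} (c : DerivIndex k (d + 1) → FieldTerm (Inp k s n))
    (q : EntryIndex k s n) : FieldTerm (Inp k s n) :=
  if q.2.1.degree < d + 1 then op .sub (encodeTerm c q) (recvTerm q.1 q.2.1)
  else recvTerm q.1 q.2.1

/-- Check at a point whether a polynomial agrees with the received word. -/
noncomputable def agreesAt {d : ℕ} (c : DerivIndex k (d + 1) → FieldTerm (Inp k s n))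
    (a : Fin k → Fin n) : ZeroTree (Inp k s n) (List (Fin k → Fin n)) :=
  (findFirst (fun e => differTerm c (a, e)) (Finset.univ : Finset (DerivIndex k s)).toList).bind
    fun o => ret (if o = none then [a] else [])

open Classical in
/-- Return the encoding of a polynomial if it agrees with the received word at sufficiently many
points. -/
noncomputable def verify (T : ℕ) {d : ℕ} (c : DerivIndex k (d + 1) → FieldTerm (Inp k s n)) :
    ZeroTree (Inp k s n) (List (EntryIndex k s n → FieldTerm (Inp k s n))) :=
  (collect (agreesAt c) (Finset.univ : Finset (Fin k → Fin n)).toList).bind fun l =>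
    ret (if T ≤ l.toFinset.card then [encodeTerm c] else [])

/-- The attempt to find a codeword from a tuple of points. -/
noncomputable def attempt (T : ℕ) {d t : ℕ}
    (rows : List (Option (DerivIndex k (d + 1)) → FieldTerm (Inp k s n)))
    (τ : Fin t → Fin k → Fin n) :
    ZeroTree (Inp k s n) (List (EntryIndex k s n → FieldTerm (Inp k s n))) :=
  (candidate rows τ).bind fun
    | none => ret []
    | some c => verify T c

/-- Find all codewords that are determined by one of the given tuples. -/
noncomputable def decode (T d m D : ℕ) {t : ℕ} (τs : List (Fin t → Fin k → Fin n)) :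
    ZeroTree (Inp k s n) (List (EntryIndex k s n → FieldTerm (Inp k s n))) :=
  (candidateRows k s n d m D).bind fun rows => collect (attempt T rows) τs

theorem eval_dot_monTerm (mem : Inp k s n → F) {d : ℕ}
    (c : DerivIndex k (d + 1) → FieldTerm (Inp k s n)) (a : Fin k → Fin n) (e : Fin k →₀ ℕ) :
    (dot c fun κ => monTerm a e κ.1).eval mem =
      jet (point mem a) e (polyOf fun κ => (c κ).eval mem) := by
  simp only [eval_dot, jet_polyOf, eval_monTerm]

theorem eval_encodeTerm (mem : Inp k s n → F) {d : ℕ}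
    (c : DerivIndex k (d + 1) → FieldTerm (Inp k s n)) (q : EntryIndex k s n) :
    (encodeTerm c q).eval mem =
      jet (point mem q.1) q.2.1 (polyOf fun κ => (c κ).eval mem) := by
  unfold encodeTerm
  split_ifs with h
  · exact eval_dot_monTerm mem c q.1 q.2.1
  · exact (jet_eq_zero_of_degree (totalDegree_polyOf_le _) _ (by omega)).symm

theorem eval_differTerm_eq_zero_iff (mem : Inp k s n → F) {d : ℕ}
    (c : DerivIndex k (d + 1) → FieldTerm (Inp k s n)) (q : EntryIndex k s n) :
    (differTerm c q).eval mem = 0 ↔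
      jet (point mem q.1) q.2.1 (polyOf fun κ => (c κ).eval mem) = recv mem q.1 q.2.1 := by
  unfold differTerm
  split_ifs with h
  · simp only [FieldTerm.eval, FieldOp.eval, eval_encodeTerm, eval_recvTerm, sub_eq_zero]
  · rw [jet_eq_zero_of_degree (totalDegree_polyOf_le _) _ (by omega), eval_recvTerm, eq_comm]

variable {G : Finset (FieldTerm (Inp k s n))} {Z d m D : ℕ}

/-- Entries of order above d are zero in the encoding, and their comparison with the received word
is a free zero test of an input register. Only orders up to d cost operations, which makes the bound
independent of s. -/
theorem ext_encodeTerm (h : Bounded Z k s n d m D)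
    (hG : Closed (G : Set (FieldTerm (Inp k s n))))
    {c : DerivIndex k (d + 1) → FieldTerm (Inp k s n)}
    (hc : ∀ κ, Avail (G : Set (FieldTerm (Inp k s n))) (c κ)) :
    Ext G (Z ^ 9) fun G' => ∀ q,
      Avail (G' : Set (FieldTerm (Inp k s n))) (encodeTerm c q) ∧
      Avail (G' : Set (FieldTerm (Inp k s n))) (differTerm c q) := by
  classical
  have hZ := h.four_le
  have hcard := h.coeffs
  refine (ext_finset (P := fun (a : Fin k → Fin n) G' => ∀ e : DerivIndex k s,
      Avail (G' : Set (FieldTerm (Inp k s n))) (encodeTerm c (a, e)) ∧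
      Avail (G' : Set (FieldTerm (Inp k s n))) (differTerm c (a, e)))
    (fun _ _ _ hs h e => ⟨(h e).1.mono' hs, (h e).2.mono' hs⟩) (c := Z ^ 8) Finset.univ hG
    fun a _ G₁ hs₁ hc₁ => ?_).imp ?_ fun G' _ h q => h q.1 (Finset.mem_univ _) q.2
  · refine (ext_finset (P := fun (e : DerivIndex k s) G' =>
      Avail (G' : Set (FieldTerm (Inp k s n))) (encodeTerm c (a, e)) ∧
      Avail (G' : Set (FieldTerm (Inp k s n))) (differTerm c (a, e)))
      (fun _ _ _ hs h => ⟨h.1.mono' hs, h.2.mono' hs⟩) (c := Z ^ 7)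
      (Finset.univ.filter fun e => e.1.degree < d + 1) hc₁
      fun e he G₂ hs₂ hc₂ => ?_).imp ?_ fun G' _ h e => ?_
    · have hed : e.1.degree < d + 1 := (Finset.mem_filter.1 he).2
      refine (Ext.bind (ext_finset (P := fun (κ : DerivIndex k (d + 1)) G' =>
        Avail (G' : Set (FieldTerm (Inp k s n))) (monTerm a e.1 κ.1))
        (fun _ _ _ hs h => h.mono' hs) (c := Z ^ 5) Finset.univ hc₂ fun κ _ G₃ _ hc₃ =>
          ext_monTerm hZ h.dim hc₃ a
            (fun i => ((Finsupp.le_degree i e.1).trans_lt hed).trans_le h.deg)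
            fun i => (κ.coord_lt i).trans_le h.deg)
        (T' := 2 * Fintype.card (DerivIndex k (d + 1)) + 1) fun G₃ hs₃ hc₃ hmon => ?_).imp ?_
          fun _ _ h => h
      · refine (ext_dot hc₃ (fun κ => (hc κ).mono' (hs₁.trans (hs₂.trans hs₃)))
          fun κ => hmon κ (Finset.mem_univ κ)).bind fun G₄ hs₄ hc₄ hdot => ?_
        have he' : Avail (G₄ : Set (FieldTerm (Inp k s n))) (encodeTerm c (a, e)) := by
          simpa only [encodeTerm, if_pos hed] using hdot
        refine (ext_op hc₄ .sub he' (avail_recvTerm _ a e.1)).imp le_rfl fun G₅ hs₅ h' =>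
          ⟨he'.mono' hs₅, ?_⟩
        simpa only [differTerm, if_pos hed] using h'
      · rw [Finset.card_univ]
        set N := Fintype.card (DerivIndex k (d + 1))
        calc N * Z ^ 5 + (2 * N + 1) ≤ Z * Z ^ 5 + (2 * Z) :=
              add_le_add (Nat.mul_le_mul_right _ (by omega)) (by omega)
          _ = Z ^ 6 + Z + Z + 0 := by ring
          _ ≤ Z ^ 7 := add_pow_le_pow hZ (a := 6) (b := 1) (c := 1) (e := 0) le_rfl (by simp)
              (by simp) (by simp) (by omega) (by omega) (by omega) (by omega)
    · have : (Finset.univ.filter fun e : DerivIndex k s => e.1.degree < d + 1).card ≤ Z := by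
        refine le_trans ?_ (le_trans (Nat.le_succ _) hcard)
        rw [← Fintype.card_subtype]
        exact Fintype.card_le_of_injective (fun e => ⟨e.1.1, e.2⟩) fun e e' h => by
          simpa [Subtype.ext_iff] using h
      calc _ ≤ Z * Z ^ 7 := Nat.mul_le_mul_right _ this
        _ = Z ^ 8 := by ring
    · by_cases hed : e.1.degree < d + 1
      · exact h e (by simpa using hed)
      · simp only [encodeTerm, differTerm, if_neg hed]
        exact ⟨trivial, avail_recvTerm _ _ _⟩
  · rw [Finset.card_univ]
    have h1 := h.grid
    calc _ ≤ Z * Z ^ 8 := Nat.mul_le_mul_right _ (by simpa using h1)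
      _ = Z ^ 9 := by ring

theorem mem_agreeSet_iff {mem : Inp k s n → F} {c : DerivIndex k (d + 1) → FieldTerm (Inp k s n)}
    {a : Fin k → Fin n} : a ∈ agreeSet mem (polyOf fun κ => (c κ).eval mem) ↔
      ∀ e : DerivIndex k s, (differTerm c (a, e)).eval mem = 0 := by
  simp only [mem_agreeSet, eval_differTerm_eq_zero_iff]
  exact ⟨fun h e => h e.1 e.2, fun h v hv => h ⟨v, hv⟩⟩

theorem agreesAt_spec (mem : Inp k s n → F) (hG : Closed (G : Set (FieldTerm (Inp k s n))))
    {c : DerivIndex k (d + 1) → FieldTerm (Inp k s n)} (a : Fin k → Fin n)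
    (hc : ∀ e, Avail (G : Set (FieldTerm (Inp k s n))) (differTerm c (a, e))) :
    Spec mem (agreesAt c a) G 0 fun l _ => ∀ b, b ∈ l ↔
      b = a ∧ a ∈ agreeSet mem (polyOf fun κ => (c κ).eval mem) := by
  obtain ⟨h1, h2, h3⟩ := findFirst_spec mem (fun e => differTerm c (a, e))
    (Finset.univ : Finset (DerivIndex k s)).toList
  refine Spec.bind (T := 0) (T' := 0) (p := fun o _ => o = (findFirst
    (fun e => differTerm c (a, e)) (Finset.univ : Finset (DerivIndex k s)).toList).run mem)
    (Ext.pure hG ⟨fun t ht => ?_, rfl⟩) fun o G' hs hc' ho => spec_ret (Ext.pure hc' fun b => ?_)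
  · obtain ⟨e, -, rfl⟩ := h3 t ht
    exact hc e
  · rw [mem_agreeSet_iff]
    split_ifs with hn
    · have := h1 (ho.symm.trans hn)
      simp only [List.mem_singleton]
      exact ⟨fun h => ⟨h, fun e => this e (by simp)⟩, fun h => h.1⟩
    · obtain ⟨e, rfl⟩ := Option.ne_none_iff_exists'.1 hn
      have := (h2 e ho.symm).2
      simp only [List.not_mem_nil, false_iff, not_and]
      exact fun _ h => this (h e)

open Classical in
theorem verify_spec (mem : Inp k s n → F) (h : Bounded Z k s n d m D) (T : ℕ)
    (hG : Closed (G : Set (FieldTerm (Inp k s n))))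
    {c : DerivIndex k (d + 1) → FieldTerm (Inp k s n)}
    (hc : ∀ κ, Avail (G : Set (FieldTerm (Inp k s n))) (c κ)) :
    Spec mem (verify T c) G (Z ^ 9) fun l G' =>
      (∀ q, Avail (G' : Set (FieldTerm (Inp k s n))) (encodeTerm c q)) ∧
      l = if T ≤ (agreeSet mem (polyOf fun κ => (c κ).eval mem)).card then [encodeTerm c]
        else [] := by
  refine Spec.imp (T := Z ^ 9 + ((Finset.univ : Finset (Fin k → Fin n)).toList.length * 0 + 0))
    ?_ (by simp) fun _ _ _ h => h
  refine Spec.ofExt (ext_encodeTerm h hG hc) fun G₁ hs₁ hc₁ hav => ?_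
  refine (collect_spec (post := fun a l _ => ∀ b, b ∈ l ↔
      b = a ∧ a ∈ agreeSet mem (polyOf fun κ => (c κ).eval mem)) (fun _ _ _ _ _ h => h) _ hc₁
      fun a _ G' hs hc' => agreesAt_spec mem hc' a fun e => (hav (a, e)).2.mono' hs).bind
    fun l G₂ hs₂ hc₂ hl => spec_ret (Ext.pure hc₂ ⟨fun q => (hav q).1.mono' hs₂, ?_⟩)
  have : l.toFinset = agreeSet mem (polyOf fun κ => (c κ).eval mem) := by
    ext a
    rw [List.mem_toFinset]
    constructor
    · intro ha
      obtain ⟨b, -, r, hr, hb⟩ := hl.1 a ha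
      obtain ⟨rfl, h⟩ := (hr a).1 hb
      exact h
    · intro ha
      obtain ⟨r, hr, hr'⟩ := hl.2 a (by simp)
      exact hr' a ((hr a).2 ⟨rfl, ha⟩)
  rw [this]

theorem sum_tupleRow (mem : Inp k s n → F) {t : ℕ} (τ : Fin t → Fin k → Fin n)
    (w : Option (DerivIndex k (d + 1)) → F) :
    (∀ row ∈ tupleRows (s := s) d τ, ∑ i, (row i).eval mem * w i = 0) ↔
      ∀ i, ∀ e : DerivIndex k (min s (d + 1)),
        jet (point mem (τ i)) e.1 (polyOf fun κ => w (some κ)) = w none * recv mem (τ i) e.1 := by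
  simp only [tupleRows, List.forall_mem_map, Finset.mem_toList, Finset.mem_univ, true_implies,
    Prod.forall, Fintype.sum_option, Option.elim, FieldTerm.eval, FieldOp.eval, eval_recvTerm,
    eval_monTerm, jet_polyOf]
  refine forall_congr' fun i => forall_congr' fun e => ?_
  rw [Finset.sum_congr rfl fun κ _ => mul_comm _ (w (some κ))]
  constructor
  · intro h
    linear_combination h
  · intro h
    linear_combination h

theorem candidate_spec (mem : Inp k s n → F) (h : Bounded Z k s n d m D) {t : ℕ} (ht : t ≤ Z)
    (hG : Closed (G : Set (FieldTerm (Inp k s n))))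
    {rows : List (Option (DerivIndex k (d + 1)) → FieldTerm (Inp k s n))}
    (hl : rows.length ≤ Z ^ 4)
    (hrows : ∀ row ∈ rows, ∀ i, Avail (G : Set (FieldTerm (Inp k s n))) (row i))
    (hspace : ∀ w : Option (DerivIndex k (d + 1)) → F,
      (polyOf fun κ => w (some κ)) ∈ space mem d m D ↔
        ∀ row ∈ rows, ∑ i, (row i).eval mem * w i = 0) (τ : Fin t → Fin k → Fin n) :
    Spec mem (candidate rows τ) G (Z ^ 11) fun o G' =>
      (∀ c ∈ o, ∀ κ, Avail (G' : Set (FieldTerm (Inp k s n))) (c κ)) ∧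
      ∀ f ∈ space mem d m D, (∀ i, τ i ∈ agreeSet mem f) →
        space mem d m D ⊓ ⨅ i, vanishing (point mem (τ i)) s = ⊥ →
        ∃ c, o = some c ∧ (polyOf fun κ => (c κ).eval mem) = f := by
  have hZ := h.four_le
  have hcard := h.coeffs
  have hmin : Fintype.card (DerivIndex k (min s (d + 1))) ≤ Z :=
    (card_derivIndex_mono k (min_le_right _ _)).trans (by omega)
  have hq : Fintype.card (Fin t × DerivIndex k (min s (d + 1))) ≤ Z ^ 2 := by
    rw [Fintype.card_prod, Fintype.card_fin, pow_two]
    exact Nat.mul_le_mul ht hmin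
  have hT : Z ^ 9 + Z ^ 10 + Z + 0 ≤ Z ^ 11 :=
    add_pow_le_pow hZ (a := 9) (b := 10) (c := 1) (e := 0) le_rfl le_rfl (by simp) (by simp)
      (by omega) (by omega) (by omega) (by omega)
  refine Spec.imp (T := Z ^ 9 + (Z ^ 10 + (0 + Z))) ?_ (by omega) fun _ _ _ h => h
  have hext : Ext G (Z ^ 9) fun G' => ∀ row ∈ rows ++ tupleRows d τ, ∀ i,
      Avail (G' : Set (FieldTerm (Inp k s n))) (row i) := by
    refine (ext_finset (P := fun (q : Fin t × DerivIndex k (min s (d + 1))) G' =>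
      Avail (G' : Set (FieldTerm (Inp k s n))) (op .sub zero (recvTerm (τ q.1) q.2.1)) ∧
      ∀ κ : DerivIndex k (d + 1),
        Avail (G' : Set (FieldTerm (Inp k s n))) (monTerm (τ q.1) q.2.1 κ.1))
      (fun _ _ _ hs h => ⟨h.1.mono' hs, fun κ => (h.2 κ).mono' hs⟩) (c := Z ^ 7) Finset.univ hG
      fun q _ G₁ hs₁ hc₁ => ?_).imp ?_ fun G' hs h' row hrow i => ?_
    · refine ((ext_op hc₁ .sub (x := zero) trivial (avail_recvTerm _ (τ q.1) q.2.1)).bind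
        (T' := Z ^ 6) fun G₂ hs₂ hc₂ h₂ => (ext_finset (P := fun (κ : DerivIndex k (d + 1)) G' =>
          Avail (G' : Set (FieldTerm (Inp k s n))) (monTerm (τ q.1) q.2.1 κ.1))
          (fun _ _ _ hs h => h.mono' hs) (c := Z ^ 5) Finset.univ hc₂ fun κ _ G₃ _ hc₃ =>
          ext_monTerm hZ h.dim hc₃ _ ?_ fun i => (κ.coord_lt i).trans_le h.deg).imp ?_
            fun G₃ hs₃ h₃ => ⟨h₂.mono' hs₃, fun κ => h₃ κ (Finset.mem_univ κ)⟩).imp ?_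
            fun _ _ h => h
      · exact fun i => (q.2.coord_lt i).trans_le ((min_le_right _ _).trans h.deg)
      · rw [Finset.card_univ]
        calc _ ≤ Z * Z ^ 5 := Nat.mul_le_mul_right _ (by omega)
          _ = Z ^ 6 := by ring
      · have : 1 + Z ^ 6 + 0 + 0 ≤ Z ^ 7 :=
          add_pow_le_pow hZ (a := 0) (b := 6) (c := 0) (e := 0) (by simp) le_rfl (by simp)
            (by simp) (by omega) (by omega) (by omega) (by omega)
        omega
    · rw [Finset.card_univ]
      calc _ ≤ Z ^ 2 * Z ^ 7 := Nat.mul_le_mul_right _ hq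
        _ = Z ^ 9 := by ring
    · rcases List.mem_append.1 hrow with hrow | hrow
      · exact (hrows row hrow i).mono' hs
      · obtain ⟨q, -, rfl⟩ := List.mem_map.1 hrow
        match i with
        | none => exact (h' q (Finset.mem_univ q)).1
        | some κ => exact (h' q (Finset.mem_univ q)).2 κ
  refine Spec.ofExt hext fun G₁ hs₁ hc₁ hav₁ => ?_
  refine ((kernel_spec mem _ hc₁ hav₁).imp ?_ fun _ _ _ h => h).bind fun B G₂ hs₂ hc₂ hB => ?_
  · have h1 : (rows ++ tupleRows d τ).length ≤ Z ^ 5 := by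
      rw [List.length_append]
      have : (tupleRows (s := s) d τ).length ≤ Z ^ 2 := by
        rw [tupleRows, List.length_map, Finset.length_toList, Finset.card_univ]
        exact hq
      have := add_pow_le_pow hZ hl this (Nat.zero_le (Z ^ 0)) (Nat.zero_le (Z ^ 0)) (q := 5)
        (by omega) (by omega) (by omega) (by omega)
      omega
    rw [Fintype.card_option]
    set N := Fintype.card (DerivIndex k (d + 1)) + 1
    have h2 : 4 * N + 1 ≤ Z ^ 2 + Z ^ 1 := by rw [pow_two]; nlinarith
    calc _ ≤ 1 + Z ^ 5 * (Z * (Z ^ 2 + Z ^ 1)) :=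
          Nat.add_le_add_left (Nat.mul_le_mul h1 (Nat.mul_le_mul hcard h2)) 1
      _ = Z ^ 8 + Z ^ 7 + 1 + 0 := by ring
      _ ≤ Z ^ 10 := add_pow_le_pow hZ (a := 8) (b := 7) (c := 0) (e := 0) le_rfl le_rfl
          (by simp) (by simp) (by omega) (by omega) (by omega) (by omega)
  obtain ⟨-, hBav, hspan⟩ := hB
  obtain ⟨h1, h2, h3⟩ := findFirst_spec mem
    (fun b : Option (DerivIndex k (d + 1)) → FieldTerm (Inp k s n) => b none) B
  refine Spec.bind (p := fun o _ => o = (findFirst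
    (fun b : Option (DerivIndex k (d + 1)) → FieldTerm (Inp k s n) => b none) B).run mem)
    (Ext.pure hc₂ ⟨fun t ht => ?_, rfl⟩) fun o G₃ hs₃ hc₃ ho => spec_ret ?_
  · obtain ⟨b, hb, rfl⟩ := h3 t ht
    exact hBav b hb none
  have hsol : ∀ w : Option (DerivIndex k (d + 1)) → F, w ∈ spanOf mem B ↔
      (polyOf fun κ => w (some κ)) ∈ space mem d m D ∧
      ∀ i, ∀ e : DerivIndex k (min s (d + 1)),
        jet (point mem (τ i)) e.1 (polyOf fun κ => w (some κ)) =
          w none * recv mem (τ i) e.1 := by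
    intro w
    rw [hspan, hspace, ← sum_tupleRow]
    simp only [List.mem_append, or_imp, forall_and]
  have havail : Ext G₃ Z fun G' => ∀ b ∈ o, ∀ κ,
      Avail (G' : Set (FieldTerm (Inp k s n))) (op .div (b (some κ)) (b none)) := by
    match o, ho with
    | none, _ => exact (Ext.pure hc₃ (by simp)).imp (Nat.zero_le _) fun _ _ h => h
    | some b, ho =>
      obtain ⟨hb, -⟩ := h2 b ho.symm
      refine (ext_finset (P := fun (κ : DerivIndex k (d + 1)) G' =>
        Avail (G' : Set (FieldTerm (Inp k s n))) (op .div (b (some κ)) (b none)))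
        (fun _ _ _ hs h => h.mono' hs) (c := 1) Finset.univ hc₃ fun κ _ G' hs hc =>
          ext_op hc .div ((hBav b hb _).mono' (hs₃.trans hs))
            ((hBav b hb _).mono' (hs₃.trans hs))).imp ?_ fun G' _ h b' hb' κ => ?_
      · rw [Finset.card_univ]; omega
      · obtain rfl := Option.some.inj hb'
        exact h κ (Finset.mem_univ κ)
  refine havail.imp le_rfl fun G₄ _ hav₄ => ⟨?_, fun f hf hτ hbot => ?_⟩
  · intro c hc κ
    obtain ⟨b, hb, rfl⟩ := Option.mem_map.1 hc
    exact hav₄ b hb κ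
  · have hfd := totalDegree_le_of_mem_candidateSpace hf
    -- The sought polynomial is a solution with scale one, so some spanning vector has nonzero
    -- scale.
    have hw : (fun i : Option (DerivIndex k (d + 1)) => i.elim 1 fun κ => coeff κ.1 f) ∈
        spanOf mem B := by
      rw [hsol]
      simp only [Option.elim, polyOf_coeff hfd, one_mul]
      exact ⟨hf, fun i e => mem_agreeSet.1 (hτ i) e.1 (e.2.trans_le (min_le_left _ _))⟩
    match o, ho with
    | none, ho =>
      exfalso
      have hzero : ∀ w ∈ spanOf mem B, w none = 0 := by
        intro w hw
        refine Submodule.span_induction (p := fun w _ => w none = 0) ?_ rfl ?_ ?_ hw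
        · rintro _ ⟨b, hb, rfl⟩
          exact h1 ho.symm b hb
        · intro x y _ _ hx hy
          rw [Pi.add_apply, hx, hy, add_zero]
        · intro c x _ hx
          rw [Pi.smul_apply, hx, smul_zero]
      exact one_ne_zero (hzero _ hw)
    | some b, ho =>
      obtain ⟨hb, hb0⟩ := h2 b ho.symm
      refine ⟨_, rfl, ?_⟩
      have hbs : (((b none).eval mem)⁻¹ • fun i => (b i).eval mem) ∈ spanOf mem B :=
        Submodule.smul_mem _ _ (Submodule.subset_span ⟨b, hb, rfl⟩)
      rw [hsol] at hbs
      simp only [Pi.smul_apply, smul_eq_mul, inv_mul_cancel₀ hb0, one_mul] at hbs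
      have heq : (polyOf fun κ => (op FieldOp.div (b (some κ)) (b none)).eval mem) =
          polyOf fun κ => ((b none).eval mem)⁻¹ * (b (some κ)).eval mem := by
        congr 1
        ext1 κ
        simp only [FieldTerm.eval, FieldOp.eval, div_eq_inv_mul]
      -- The difference of the candidate and f lies in the space and vanishes to order s on the
      -- tuple: orders up to d by the equations, higher orders because both degrees are at most d.
      rw [heq, ← sub_eq_zero, ← Submodule.mem_bot F, ← hbot]
      refine Submodule.mem_inf.2 ⟨Submodule.sub_mem _ hbs.1 hf, ?_⟩
      refine (Submodule.mem_iInf _).2 fun i => mem_vanishing.2 fun e he => ?_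
      rw [map_sub, mem_agreeSet.1 (hτ i) e he]
      by_cases hed : e.degree < d + 1
      · rw [hbs.2 i ⟨e, lt_min he hed⟩, sub_self]
      · rw [← mem_agreeSet.1 (hτ i) e he, jet_eq_zero_of_degree hfd _ (by omega),
          jet_eq_zero_of_degree (totalDegree_polyOf_le _) _ (by omega), sub_zero]

theorem attempt_spec (mem : Inp k s n → F) (h : Bounded Z k s n d m D) {t : ℕ} (ht : t ≤ Z)
    (T : ℕ) (hG : Closed (G : Set (FieldTerm (Inp k s n))))
    {rows : List (Option (DerivIndex k (d + 1)) → FieldTerm (Inp k s n))}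
    (hl : rows.length ≤ Z ^ 4)
    (hrows : ∀ row ∈ rows, ∀ i, Avail (G : Set (FieldTerm (Inp k s n))) (row i))
    (hspace : ∀ w : Option (DerivIndex k (d + 1)) → F,
      (polyOf fun κ => w (some κ)) ∈ space mem d m D ↔
        ∀ row ∈ rows, ∑ i, (row i).eval mem * w i = 0) (τ : Fin t → Fin k → Fin n) :
    Spec mem (attempt T rows τ) G (Z ^ 12) fun r G' =>
      (∀ v ∈ r, (∀ q, Avail (G' : Set (FieldTerm (Inp k s n))) (v q)) ∧
        ∃ f : MvPolynomial (Fin k) F, f.totalDegree ≤ d ∧ T ≤ (agreeSet mem f).card ∧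
          ∀ q, (v q).eval mem = jet (point mem q.1) q.2.1 f) ∧
      ∀ f ∈ space mem d m D, T ≤ (agreeSet mem f).card → (∀ i, τ i ∈ agreeSet mem f) →
        space mem d m D ⊓ ⨅ i, vanishing (point mem (τ i)) s = ⊥ →
        ∃ v ∈ r, ∀ q, (v q).eval mem = jet (point mem q.1) q.2.1 f := by
  have hT : Z ^ 11 + Z ^ 9 + 0 + 0 ≤ Z ^ 12 :=
    add_pow_le_pow h.four_le (a := 11) (b := 9) (c := 0) (e := 0) le_rfl le_rfl (by simp)
      (by simp) (by omega) (by omega) (by omega) (by omega)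
  refine Spec.imp (T := Z ^ 11 + Z ^ 9) ?_ (by omega) fun _ _ _ h => h
  refine (candidate_spec mem h ht hG hl hrows hspace τ).bind fun o G₁ hs₁ hc₁ => ?_
  rintro ⟨hav, hfind⟩
  match o with
  | none =>
    refine spec_ret ((Ext.pure hc₁ ⟨by simp, fun f hf _ hτ hbot => ?_⟩).imp (Nat.zero_le _)
      fun _ _ h => h)
    obtain ⟨c, hc, -⟩ := hfind f hf hτ hbot
    cases hc
  | some c =>
    refine (verify_spec mem h T hc₁ (hav c rfl)).imp le_rfl fun r G₂ _ hr => ?_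
    obtain ⟨hav₂, rfl⟩ := hr
    refine ⟨fun v hv => ?_, fun f hf hT hτ hbot => ?_⟩
    · split_ifs at hv with hT
      · rw [List.mem_singleton.1 hv]
        exact ⟨hav₂, _, totalDegree_polyOf_le _, hT, eval_encodeTerm mem c⟩
      · simp at hv
    · obtain ⟨c', hc', hf'⟩ := hfind f hf hτ hbot
      obtain rfl := Option.some.inj hc'
      rw [hf', if_pos hT]
      exact ⟨_, List.mem_singleton.2 rfl, fun q => by rw [eval_encodeTerm, hf']⟩

/-- Soundness of the output is unconditional, by verification; only completeness depends on the
sampled tuples. -/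
theorem decode_spec (mem : Inp k s n → F) (h : Bounded Z k s n d m D) {t : ℕ} (ht : t ≤ Z)
    (T : ℕ) (hG : Closed (G : Set (FieldTerm (Inp k s n)))) {τs : List (Fin t → Fin k → Fin n)}
    (hτs : τs.length ≤ Z) :
    Spec mem (decode T d m D τs) G (Z ^ 18) fun r G' =>
      (∀ v ∈ r, (∀ q, Avail (G' : Set (FieldTerm (Inp k s n))) (v q)) ∧
        ∃ f : MvPolynomial (Fin k) F, f.totalDegree ≤ d ∧ T ≤ (agreeSet mem f).card ∧
          ∀ q, (v q).eval mem = jet (point mem q.1) q.2.1 f) ∧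
      ∀ f ∈ space mem d m D, T ≤ (agreeSet mem f).card →
        (∃ τ ∈ τs, (∀ i, τ i ∈ agreeSet mem f) ∧
          space mem d m D ⊓ ⨅ i, vanishing (point mem (τ i)) s = ⊥) →
        ∃ v ∈ r, ∀ q, (v q).eval mem = jet (point mem q.1) q.2.1 f := by
  have hT : Z ^ 17 + Z ^ 13 + 0 + 0 ≤ Z ^ 18 :=
    add_pow_le_pow h.four_le (a := 17) (b := 13) (c := 0) (e := 0) le_rfl le_rfl (by simp)
      (by simp) (by omega) (by omega) (by omega) (by omega)
  refine Spec.imp (T := Z ^ 17 + Z ^ 13) ?_ (by omega) fun _ _ _ h => h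
  refine (candidateRows_spec mem h hG).bind fun rows G₁ hs₁ hc₁ => ?_
  rintro ⟨hl, hav, hspace⟩
  refine Spec.imp (collect_spec (fun τ r G G' hs hr =>
    ⟨fun v hv => ⟨fun q => ((hr.1 v hv).1 q).mono' hs, (hr.1 v hv).2⟩, hr.2⟩) τs hc₁
    fun τ _ G' hs hc => attempt_spec mem h ht T hc hl (fun row hrow i => (hav row hrow i).mono' hs)
      hspace τ) ?_ fun r G₂ _ hr => ⟨fun v hv => ?_, fun f hf hTf => ?_⟩
  · calc _ ≤ Z * Z ^ 12 := Nat.mul_le_mul_right _ hτs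
      _ = Z ^ 13 := by ring
  · obtain ⟨τ, -, r', hr', hv'⟩ := hr.1 v hv
    exact hr'.1 v hv'
  · rintro ⟨τ, hτ, hτA, hbot⟩
    obtain ⟨r', hr', hsub⟩ := hr.2 τ hτ
    obtain ⟨v, hv, hvf⟩ := hr'.2 f hf hTf hτA hbot
    exact ⟨v, hsub v hv, hvf⟩

end Decoder

/-! ### Hitting all of a family of disjoint large sets -/

section Sampling

variable {ι T : Type*} [Fintype T] [Nonempty T] {I : Finset ι} {A : ι → Finset T} {p : ℝ}

theorem card_mul_le_one_of_pairwiseDisjoint (hA : (I : Set ι).PairwiseDisjoint A)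
    (hp : ∀ i ∈ I, p * Fintype.card T ≤ (A i).card) : I.card * p ≤ 1 := by
  classical
  have h1 : ((I.biUnion A).card : ℝ) ≤ Fintype.card T := by exact_mod_cast Finset.card_le_univ _
  rw [Finset.card_biUnion hA] at h1
  push_cast at h1
  have h2 := Finset.sum_le_sum hp
  rw [Finset.sum_const, nsmul_eq_mul, ← mul_assoc] at h2
  have h3 : (0 : ℝ) < Fintype.card T := by exact_mod_cast Fintype.card_pos
  exact le_of_mul_le_mul_right (by linarith) h3

/-- A sequence of random samples meets each of a family of disjoint large sets. -/
theorem le_card_forall_exists_mem (hA : (I : Set ι).PairwiseDisjoint A) (h0 : 0 < p) (h1 : p ≤ 1)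
    (hp : ∀ i ∈ I, p * Fintype.card T ≤ (A i).card) {M : ℕ} (hM : 1 / p * Real.log (3 / p) ≤ M) :
    2 / 3 * (Fintype.card T : ℝ) ^ M ≤ {σ : Fin M → T | ∀ i ∈ I, ∃ j, σ j ∈ A i}.ncard := by
  classical
  -- One set is missed by all M samples with probability at most (1-p)^M ≤ e^(-pM) ≤ p/3.
  -- Disjointness leaves at most 1/p sets, so the union bound gives 1/3.
  have hmiss : ∀ i ∈ I, ((Fintype.piFinset fun _ : Fin M => (A i)ᶜ).card : ℝ) ≤
      p / 3 * (Fintype.card T : ℝ) ^ M := by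
    intro i hi
    rw [Fintype.card_piFinset_const, Finset.card_compl]
    push_cast [Finset.card_le_univ]
    have h2 : (Fintype.card T : ℝ) - (A i).card ≤ (1 - p) * Fintype.card T := by
      linarith [hp i hi]
    have h3 : (0 : ℝ) ≤ (Fintype.card T : ℝ) - (A i).card :=
      sub_nonneg.2 (by exact_mod_cast Finset.card_le_univ _)
    refine (pow_le_pow_left₀ h3 h2 M).trans ?_
    rw [mul_pow]
    refine mul_le_mul_of_nonneg_right ?_ (by positivity)
    have h4 := pow_le_pow_left₀ (by linarith) (Real.one_sub_le_exp_neg p) M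
    rw [← Real.exp_nat_mul] at h4
    refine h4.trans ?_
    have h5 : Real.log (3 / p) ≤ M * p := by
      have := mul_le_mul_of_nonneg_right hM h0.le
      field_simp at this
      linarith
    have h6 : Real.exp (M * -p) ≤ Real.exp (-Real.log (3 / p)) := Real.exp_le_exp.2 (by linarith)
    refine h6.trans_eq ?_
    rw [Real.exp_neg, Real.exp_log (by positivity), inv_div]
  have hcompl : {σ : Fin M → T | ∀ i ∈ I, ∃ j, σ j ∈ A i} =
      ((I.biUnion fun i => Fintype.piFinset fun _ : Fin M => (A i)ᶜ)ᶜ : Finset (Fin M → T)) := by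
    ext σ
    simp
  rw [hcompl, Set.ncard_coe_finset, Finset.card_compl, Nat.cast_sub (Finset.card_le_univ _)]
  have h2 : ((I.biUnion fun i => Fintype.piFinset fun _ : Fin M => (A i)ᶜ).card : ℝ) ≤
      ∑ i ∈ I, p / 3 * (Fintype.card T : ℝ) ^ M := by
    refine (Nat.cast_le.2 Finset.card_biUnion_le).trans ?_
    push_cast
    exact Finset.sum_le_sum hmiss
  rw [Finset.sum_const, nsmul_eq_mul] at h2
  have h3 := card_mul_le_one_of_pairwiseDisjoint hA hp
  have h4 : I.card * p * ((Fintype.card T : ℝ) ^ M / 3) ≤ 1 * ((Fintype.card T : ℝ) ^ M / 3) :=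
    mul_le_mul_of_nonneg_right h3 (by positivity)
  have h5 : (Fintype.card (Fin M → T) : ℝ) = (Fintype.card T : ℝ) ^ M := by
    simp
  rw [h5]
  linarith

end Sampling

/-! ### Close polynomials: their number, and the samples that determine them -/

/-- A lower bound for the probability that a random tuple of points determines a given close
codeword. -/
noncomputable def successProb (ε : ℝ) (k : ℕ) : ℝ := ε ^ tupleLength ε k / 2

/-- The number of random tuples that the decoder uses. -/
noncomputable def numTrials (ε : ℝ) (k : ℕ) : ℕ :=
  ⌈1 / successProb ε k * Real.log (3 / successProb ε k)⌉₊

theorem successProb_pos {ε : ℝ} (h0 : 0 < ε) (k : ℕ) : 0 < successProb ε k := by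
  unfold successProb; positivity

theorem successProb_le_one {ε : ℝ} (h0 : 0 < ε) (h1 : ε ≤ 1) (k : ℕ) : successProb ε k ≤ 1 := by
  have := pow_le_one₀ h0.le h1 (n := tupleLength ε k)
  unfold successProb
  linarith

namespace Decoder

variable {k s n : ℕ} {F : Type*} [Field F]

/-- The polynomials of degree at most `d` that agree with the received word at `T` points. -/
def closePolys (mem : Inp k s n → F) (d T : ℕ) : Set (MvPolynomial (Fin k) F) :=
  {f | f.totalDegree ≤ d ∧ T ≤ (agreeSet mem f).card}

/-- The tuples of points that determine a given polynomial. -/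
def goodTuples (mem : Inp k s n → F) (d m D t : ℕ) (f : MvPolynomial (Fin k) F) :
    Set (Fin t → Fin k → Fin n) :=
  {τ | (∀ i, τ i ∈ agreeSet mem f) ∧ space mem d m D ⊓ ⨅ i, vanishing (point mem (τ i)) s = ⊥}

theorem eq_of_mem_goodTuples {mem : Inp k s n → F} {d m D t : ℕ} {f g : MvPolynomial (Fin k) F}
    (hf : f ∈ space mem d m D) (hg : g ∈ space mem d m D) {τ : Fin t → Fin k → Fin n}
    (hτf : τ ∈ goodTuples mem d m D t f) (hτg : τ ∈ goodTuples mem d m D t g) : f = g := by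
  rw [← sub_eq_zero, ← Submodule.mem_bot F, ← hτf.2]
  refine Submodule.mem_inf.2 ⟨Submodule.sub_mem _ hf hg, (Submodule.mem_iInf _).2 fun i =>
    mem_vanishing.2 fun e he => ?_⟩
  rw [map_sub, mem_agreeSet.1 (hτf.1 i) e he, mem_agreeSet.1 (hτg.1 i) e he, sub_self]

/-- The sets of good tuples of distinct close polynomials are disjoint and each has density at least
p = `successProb`. Packing bounds the list, and random sampling hits all of the sets. -/
theorem closePolys_determined {mem : Inp k s n → F} (hx : Function.Injective (coord mem)) {ε : ℝ}
    (h0 : 0 < ε) (h1 : ε ≤ 1 / 2) {d T : ℕ} (hs : 4 * interpOrder ε k / ε ≤ s) (hd : d < s * n)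
    (hchar : ringChar F = 0 ∨ d < ringChar F)
    (hT : ((d : ℝ) / (s * n) + ε) * n ^ k ≤ T) :
    (closePolys mem d T).Finite ∧ (closePolys mem d T).ncard * successProb ε k ≤ 1 ∧
    (∀ f ∈ closePolys mem d T, f ∈ space mem d (interpOrder ε k) (interpDegree ε s n)) ∧
    2 / 3 * (Fintype.card (Fin (tupleLength ε k) → Fin k → Fin n) : ℝ) ^ numTrials ε k ≤
      {σ : Fin (numTrials ε k) → Fin (tupleLength ε k) → Fin k → Fin n |
        ∀ f ∈ closePolys mem d T, ∃ j, σ j ∈ goodTuples mem d (interpOrder ε k)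
          (interpDegree ε s n) (tupleLength ε k) f}.ncard := by
  classical
  set m := interpOrder ε k
  set D := interpDegree ε s n
  set t := tupleLength ε k with ht
  have hn : 1 ≤ n := Nat.pos_of_ne_zero (by rintro rfl; omega)
  have : NeZero n := ⟨by omega⟩
  have hpp := successProb_pos h0 k
  have hp1 := successProb_le_one h0 (h1.trans (by norm_num)) k
  have hclose : ∀ f ∈ closePolys mem d T, f ∈ space mem d m D ∧
      successProb ε k * Fintype.card (Fin t → Fin k → Fin n) ≤
        (goodTuples mem d m D t f).toFinset.card := by
    rintro f ⟨hfd, hfT⟩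
    have := close_mem_candidateSpace_and_le_card hx h0 h1 hn hs hd hchar (recv mem) hfd
      (A := agreeSet mem f) (hT.trans (by exact_mod_cast hfT)) fun a ha v hv =>
        mem_agreeSet.1 ha v hv
    refine ⟨this.1, ?_⟩
    rw [← Set.ncard_eq_toFinset_card']
    refine le_trans (le_of_eq ?_) this.2
    simp [successProb, ht]
  have hdisj : ∀ I : Finset (MvPolynomial (Fin k) F), (I : Set _) ⊆ closePolys mem d T →
      (I : Set _).PairwiseDisjoint fun f => (goodTuples mem d m D t f).toFinset := by
    intro I hI f hf g hg hfg
    refine Finset.disjoint_left.2 fun τ h h' => hfg ?_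
    exact eq_of_mem_goodTuples (hclose f (hI hf)).1 (hclose g (hI hg)).1 (by simpa using h)
      (by simpa using h')
  have hcard : ∀ I : Finset (MvPolynomial (Fin k) F), (I : Set _) ⊆ closePolys mem d T →
      I.card * successProb ε k ≤ 1 := fun I hI =>
    card_mul_le_one_of_pairwiseDisjoint (hdisj I hI) fun f hf => (hclose f (hI hf)).2
  have hfin : (closePolys mem d T).Finite := by
    by_contra hinf
    -- Over an infinite field finiteness is not automatic; the packing bound for finite subsets
    -- already excludes an infinite set.
    obtain ⟨I, hI, hIc⟩ := Set.Infinite.exists_subset_card_eq hinf (⌊1 / successProb ε k⌋₊ + 1)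
    have h2 := hcard I hI
    rw [hIc, ← le_div_iff₀ hpp] at h2
    have h3 := Nat.lt_floor_add_one (1 / successProb ε k)
    push_cast at h2
    linarith
  refine ⟨hfin, ?_, fun f hf => (hclose f hf).1, ?_⟩
  · rw [Set.ncard_eq_toFinset_card _ hfin]
    exact hcard _ (by simp)
  · have := le_card_forall_exists_mem (hdisj hfin.toFinset (by simp)) hpp hp1
      (fun f hf => (hclose f (by simpa using hf)).2) (M := numTrials ε k) (Nat.le_ceil _)
    simpa using this

/-- Two polynomials with agreement above R + 1/2 share more than a fraction 2R of the points, while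
the difference of distinct ones vanishes to order s on at most a fraction R. -/
theorem closePolys_subsingleton {mem : Inp k s n → F} (hx : Function.Injective (coord mem)) {ε : ℝ}
    (h1 : 1 / 2 < ε) {d T : ℕ} (hd : d < s * n)
    (hT : ((d : ℝ) / (s * n) + ε) * n ^ k ≤ T) : (closePolys mem d T).Subsingleton := by
  classical
  rintro f ⟨hfd, hfT⟩ g ⟨hgd, hgT⟩
  by_contra hne
  have hn : 0 < n := Nat.pos_of_ne_zero (by rintro rfl; omega)
  have hs : 0 < s := Nat.pos_of_ne_zero (by rintro rfl; omega)
  set I := agreeSet mem f ∩ agreeSet mem g with hI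
  have hsz := mul_sum_vanishing_le hx (sub_ne_zero.2 hne)
    ((totalDegree_sub f g).trans (max_le hfd hgd)) (fun a => if a ∈ I then s else 0) (by
      intro a
      split_ifs with ha
      · intro e he
        obtain ⟨haf, hag⟩ := Finset.mem_inter.1 ha
        rw [map_sub]
        exact sub_eq_zero.2 ((mem_agreeSet.1 haf e he).trans (mem_agreeSet.1 hag e he).symm)
      · exact VanishesTo.zero_order _ _)
  rw [Finset.sum_ite_mem, Finset.univ_inter, Finset.sum_const, smul_eq_mul] at hsz
  have hcard : (agreeSet mem f).card + (agreeSet mem g).card ≤ n ^ k + I.card := by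
    rw [← Finset.card_union_add_card_inter]
    refine Nat.add_le_add_right ((Finset.card_le_univ _).trans_eq (by simp)) _
  have hsz' : (n : ℝ) * (I.card * s) ≤ d * n ^ k := by exact_mod_cast hsz
  have hcard' : (T : ℝ) + T ≤ n ^ k + I.card := by exact_mod_cast (by omega : T + T ≤ n ^ k + I.card)
  have hnr : (0 : ℝ) < n := by exact_mod_cast hn
  have hsr : (0 : ℝ) < s := by exact_mod_cast hs
  have hN : (0 : ℝ) < (n : ℝ) ^ k := by positivity
  have h2 : (I.card : ℝ) ≤ d / (s * n) * n ^ k := by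
    rw [div_mul_eq_mul_div, le_div_iff₀ (by positivity)]
    linarith
  have h3 : (0 : ℝ) ≤ d / (s * n) * n ^ k := by positivity
  nlinarith

end Decoder

/-! ### The randomized decoder and its correctness -/

namespace Decoder

open FieldTerm ZeroTree

variable {k s n : ℕ} {F : Type*} [Field F] {S : Finset F}

/-- The input of a decoder without the working registers. -/
def input (en : Fin n ≃ S) (P : Word S k s) : Inp k s n → F :=
  fun r => decoderInput en P (Sum.inl r)

theorem holds_decoderInput (en : Fin n ≃ S) (P : Word S k s) :
    Holds (input en P) [] (decoderInput en P) :=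
  ⟨fun _ => rfl, rfl, by simp⟩

theorem coord_input_injective (en : Fin n ≃ S) (P : Word S k s) :
    Function.Injective (coord (input en P)) := fun i j h => by
  have : (en i : F) = en j := h
  simpa using this

theorem point_input (en : Fin n ≃ S) (P : Word S k s) (a : Fin k → Fin n) :
    point (input en P) a = fun i => (en (a i) : F) := rfl

theorem recv_input (en : Fin n ≃ S) (P : Word S k s) (a : Fin k → Fin n) (e : DerivIndex k s) :
    recv (input en P) a e.1 = P (fun i => en (a i)) e := by
  rw [recv, dif_pos e.2]
  rfl

theorem toWord_eq_encode (en : Fin n ≃ S) (P : Word S k s) {v : EntryIndex k s n → F}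
    {f : MvPolynomial (Fin k) F} (h : ∀ q, v q = jet (point (input en P) q.1) q.2.1 f) :
    toWord en v = encode S s f := by
  ext a e
  rw [toWord, h, encode_eq, point_input]
  simp

theorem mem_agreeSet_input {en : Fin n ≃ S} {P : Word S k s} {f : MvPolynomial (Fin k) F}
    {a : Fin k → Fin n} : a ∈ agreeSet (input en P) f ↔
      encode S s f (fun i => en (a i)) = P fun i => en (a i) := by
  rw [mem_agreeSet, funext_iff]
  constructor
  · intro h e
    rw [encode_eq, ← recv_input en P a e, ← h e.1 e.2, point_input]
  · intro h v hv
    rw [recv_input en P a ⟨v, hv⟩, ← h ⟨v, hv⟩, encode_eq, point_input]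

theorem agreement_encode (en : Fin n ≃ S) (P : Word S k s) (f : MvPolynomial (Fin k) F) :
    agreement (encode S s f) P = ((agreeSet (input en P) f).card : ℝ) / (n : ℝ) ^ k := by
  have hcard : S.card = n := by
    simpa using (Fintype.card_congr en).symm
  have himage : {a : Fin k → S | encode S s f a = P a} =
      (fun (a : Fin k → Fin n) i => en (a i)) '' (agreeSet (input en P) f : Set (Fin k → Fin n)) := by
    ext a
    constructor
    · intro h
      refine ⟨fun i => en.symm (a i), ?_, by simp⟩
      rw [Finset.mem_coe, mem_agreeSet_input]
      simpa using h
    · rintro ⟨b, hb, rfl⟩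
      exact mem_agreeSet_input.1 hb
  rw [agreement, himage, Set.ncard_image_of_injective _ fun a b h => ?_, Set.ncard_coe_finset,
    hcard]
  ext1 i
  exact en.injective (congrFun h i)

/-- The number of agreements that corresponds to a fraction. -/
noncomputable def threshold (θ : ℝ) (n k : ℕ) : ℕ := ⌈θ * (n : ℝ) ^ k⌉₊

theorem closeCodewords_eq_image (en : Fin n ≃ S) (hn : 0 < n) (d : ℕ) (P : Word S k s) (θ : ℝ) :
    closeCodewords S s d P θ = encode S s '' closePolys (input en P) d (threshold θ n k) := by
  have hN : (0 : ℝ) < (n : ℝ) ^ k := by positivity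
  have key : ∀ f : MvPolynomial (Fin k) F, θ ≤ agreement (encode S s f) P ↔
      threshold θ n k ≤ (agreeSet (input en P) f).card := fun f => by
    rw [agreement_encode en, le_div_iff₀ hN, threshold, Nat.ceil_le]
  ext c
  constructor
  · rintro ⟨⟨f, hf, rfl⟩, hθ⟩
    exact ⟨f, ⟨hf, (key f).1 hθ⟩, rfl⟩
  · rintro ⟨f, ⟨hf, hT⟩, rfl⟩
    exact ⟨⟨f, hf, rfl⟩, (key f).2 hT⟩

/-- The decoder for a given choice of the sampled tuples. -/
noncomputable def decodeTree (k s n d : ℕ) (ε : ℝ) (T : ℕ)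
    (σ : Fin (numTrials ε k) → Fin (tupleLength ε k) → Fin k → Fin n) :
    CompTree (DecoderReg k s n) (EntryIndex k s n) :=
  (decode T d (interpOrder ε k) (interpDegree ε s n) (List.ofFn σ)).compile []

section Correctness

variable {d : ℕ} {ε : ℝ} {Z T : ℕ}

/-- The deterministic part: the cost bound holds for every sample, and the output is exact as soon
as each close polynomial is determined by one of the sampled tuples. -/
theorem decodeTree_correct (en : Fin n ≃ S) (P : Word S k s)
    (h : Bounded Z k s n d (interpOrder ε k) (interpDegree ε s n))
    (ht : tupleLength ε k ≤ Z) (hM : numTrials ε k ≤ Z)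
    (σ : Fin (numTrials ε k) → Fin (tupleLength ε k) → Fin k → Fin n) :
    ((decodeTree k s n d ε T σ).opCount (decoderInput en P) ≤ Z ^ 18) ∧
    ((∀ f ∈ closePolys (input en P) d T,
      f ∈ space (input en P) d (interpOrder ε k) (interpDegree ε s n) ∧
      ∃ j, σ j ∈ goodTuples (input en P) d (interpOrder ε k) (interpDegree ε s n)
        (tupleLength ε k) f) →
      decoded en P (decodeTree k s n d ε T σ) = encode S s '' closePolys (input en P) d T) := by
  obtain ⟨G, -, hG, hcard, htests, hsound, hcomplete⟩ := decode_spec (G := ∅) (input en P) h ht T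
    (by simp [Closed]) (τs := List.ofFn σ) (by simpa using hM)
  have hcomp := compile_spec hG (decode T d (interpOrder ε k) (interpDegree ε s n) (List.ofFn σ))
    (holds_decoderInput en P) List.nodup_nil (by simp) htests fun v hv => (hsound v hv).1
  refine ⟨by simpa [decodeTree] using hcomp.2.trans hcard, fun hσ => ?_⟩
  rw [decoded, decodeTree, hcomp.1]
  ext c
  constructor
  · rintro ⟨w, hw, rfl⟩
    obtain ⟨v, hv, rfl⟩ := List.mem_map.1 hw
    obtain ⟨-, f, hfd, hfT, hf⟩ := hsound v hv
    exact ⟨f, ⟨hfd, hfT⟩, (toWord_eq_encode en P hf).symm⟩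
  · rintro ⟨f, hf, rfl⟩
    obtain ⟨hfV, j, hj⟩ := hσ f hf
    obtain ⟨v, hv, hvf⟩ := hcomplete f hfV hf.2
      ⟨σ j, (List.mem_ofFn' _ _).2 ⟨j, rfl⟩, hj.1, hj.2⟩
    exact ⟨_, List.mem_map.2 ⟨v, hv, rfl⟩, (toWord_eq_encode en P hvf).symm⟩

end Correctness

/-- The randomized decoder. -/
noncomputable def decoder (k s d : ℕ) {n : ℕ} (hn : 0 < n) (ε : ℝ) (T : ℕ) :
    RandCompTree (DecoderReg k s n) (EntryIndex k s n) where
  numSeeds := Fintype.card (Fin (numTrials ε k) → Fin (tupleLength ε k) → Fin k → Fin n)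
  numSeeds_pos := by
    have : NeZero n := ⟨hn.ne'⟩
    exact Fintype.card_pos
  tree ω := decodeTree k s n d ε T ((Fintype.equivFin _).symm ω)

/-- Seeds are in bijection with samples, so the fraction of good samples from
`closePolys_determined` is a lower bound for the success probability. -/
theorem decoder_correct (hn : 0 < n) {ε : ℝ} (h0 : 0 < ε) (h1 : ε ≤ 1 / 2) {d : ℕ}
    (hs : 4 * interpOrder ε k / ε ≤ s) (hd : d < s * n) {T : ℕ}
    (hT : ((d : ℝ) / (s * n) + ε) * n ^ k ≤ T) {Z : ℕ}
    (h : Bounded Z k s n d (interpOrder ε k) (interpDegree ε s n))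
    (ht : tupleLength ε k ≤ Z) (hM : numTrials ε k ≤ Z)
    (hchar : ringChar F = 0 ∨ d < ringChar F) (en : Fin n ≃ S) (P : Word S k s) :
    (∀ ω, ((decoder k s d hn ε T).tree ω).opCount (decoderInput en P) ≤ Z ^ 18) ∧
    2 / 3 ≤ (decoder k s d hn ε T).prob fun t =>
      decoded en P t = encode S s '' closePolys (input en P) d T := by
  refine ⟨fun ω => (decodeTree_correct en P h ht hM _).1, ?_⟩
  obtain ⟨-, -, hspace, hprob⟩ := closePolys_determined (coord_input_injective en P) h0 h1 hs hd
    hchar hT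
  have hpos : (0 : ℝ) < (decoder k s d hn ε T).numSeeds := by
    exact_mod_cast (decoder k s d hn ε T).numSeeds_pos
  rw [RandCompTree.prob, le_div_iff₀ hpos]
  have hcard : ((decoder k s d hn ε T).numSeeds : ℝ) =
      (Fintype.card (Fin (tupleLength ε k) → Fin k → Fin n) : ℝ) ^ numTrials ε k := by
    simp [decoder]
  rw [hcard]
  refine hprob.trans ?_
  rw [← Set.ncard_image_of_injective _ (Fintype.equivFin
    (Fin (numTrials ε k) → Fin (tupleLength ε k) → Fin k → Fin n)).injective]
  refine Nat.cast_le.2 (Set.ncard_le_ncard ?_ (Set.toFinite _))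
  rintro _ ⟨σ, hσ, rfl⟩
  have : (decoder k s d hn ε T).tree (Fintype.equivFin _ σ) = decodeTree k s n d ε T σ := by
    simp [decoder]
  change decoded en P ((decoder k s d hn ε T).tree (Fintype.equivFin _ σ)) = _
  rw [this]
  exact (decodeTree_correct en P h ht hM σ).2 fun f hf => ⟨hspace f hf, hσ f hf⟩

/-! ### Grids with a single point -/

/-- Decoding on a grid with a single point. -/
noncomputable def singleDecode (k s d T : ℕ) :
    ZeroTree (Inp k s 1) (List (EntryIndex k s 1 → FieldTerm (Inp k s 1))) :=
  (findFirst (fun q => if d < q.2.1.degree then var (Sum.inr q) else zero)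
    (Finset.univ : Finset (EntryIndex k s 1)).toList).bind fun o =>
      ret (if o = none ∧ T ≤ 1 then [fun q => var (Sum.inr q)] else [])

/-- The decoder for a grid with a single point. -/
noncomputable def singleDecoder (k s d T : ℕ) :
    RandCompTree (DecoderReg k s 1) (EntryIndex k s 1) where
  numSeeds := 1
  numSeeds_pos := one_pos
  tree _ := (singleDecode k s d T).compile []

/-- Taylor coefficients of order at most d can be prescribed freely at one point: take the
polynomial with these coefficients and translate it. -/
theorem exists_jet_eq_of_forall {d : ℕ} (a : Fin k → F) (y : (Fin k →₀ ℕ) → F)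
    (h : ∀ e, d < e.degree → y e = 0) :
    ∃ f : MvPolynomial (Fin k) F, f.totalDegree ≤ d ∧ ∀ e, jet a e f = y e := by
  refine ⟨translate (-a) (polyOf fun κ : DerivIndex k (d + 1) => y κ.1),
    (totalDegree_translate_le _ _).trans (totalDegree_polyOf_le _), fun e => ?_⟩
  rw [jet_apply, translate_translate_neg]
  by_cases he : e.degree < d + 1
  · exact coeff_polyOf (fun κ : DerivIndex k (d + 1) => y κ.1) ⟨e, he⟩
  · rw [h e (by omega), coeff_eq_zero_of_degree (totalDegree_polyOf_le _) (by omega)]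

/-- Positive agreement with a one-point word means equality, so the only possible output is the
received word. It is a codeword exactly when its entries of order above d vanish, and zero tests
alone decide this. -/
theorem singleDecoder_correct {d T : ℕ} (hT : 1 ≤ T) (en : Fin 1 ≃ S) (P : Word S k s) :
    (∀ ω, ((singleDecoder k s d T).tree ω).opCount (decoderInput en P) = 0) ∧
    2 / 3 ≤ (singleDecoder k s d T).prob fun t =>
      decoded en P t = encode S s '' closePolys (input en P) d T := by
  set f : EntryIndex k s 1 → FieldTerm (Inp k s 1) :=
    fun q => if d < q.2.1.degree then var (Sum.inr q) else zero with hf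
  have hav : ∀ (X : Set (FieldTerm (Inp k s 1))) q, Avail X (f q) := by
    intro X q
    simp only [hf]
    split_ifs <;> trivial
  obtain ⟨h1, h2, h3⟩ := findFirst_spec (input en P) f
    (Finset.univ : Finset (EntryIndex k s 1)).toList
  have hcomp := compile_spec (G := ∅) (by simp [Closed]) (singleDecode k s d T)
    (holds_decoderInput en P) List.nodup_nil (by simp) (fun t ht => by
      rw [singleDecode, tests_bind] at ht
      rcases List.mem_append.1 ht with ht | ht
      · obtain ⟨q, -, rfl⟩ := h3 t ht
        exact hav _ q
      · simp [tests] at ht) (fun v hv q => by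
      rw [singleDecode, run_bind, run] at hv
      split_ifs at hv
      · rw [List.mem_singleton.1 hv]; trivial
      · simp at hv)
  refine ⟨fun ω => by simpa [singleDecoder] using hcomp.2, ?_⟩
  have hcorrect : decoded en P ((singleDecode k s d T).compile []) =
      encode S s '' closePolys (input en P) d T := by
    have hword : toWord en (fun q => input en P (Sum.inr q)) = P := by
      ext a e
      change P (fun i => en (en.symm (a i))) e = P a e
      simp
    have hcard : ∀ g : MvPolynomial (Fin k) F, (agreeSet (input en P) g).card ≤ 1 := fun g =>
      (Finset.card_le_univ _).trans (by simp)
    rw [decoded, hcomp.1, singleDecode, run_bind, run]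
    ext c
    constructor
    · rintro ⟨w, hw, rfl⟩
      obtain ⟨v, hv, rfl⟩ := List.mem_map.1 hw
      split_ifs at hv with hcond
      · obtain ⟨hnone, hT1⟩ := hcond
        rw [List.mem_singleton.1 hv]
        obtain ⟨g, hgd, hg⟩ := exists_jet_eq_of_forall (d := d) (point (input en P) 0)
          (recv (input en P) 0) (by
            intro e he
            unfold recv
            split_ifs with hes
            · have := h1 hnone (0, ⟨e, hes⟩) (by simp)
              simpa [hf, he, FieldTerm.eval] using this
            · rfl)
        have h0 : (0 : Fin k → Fin 1) ∈ agreeSet (input en P) g :=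
          mem_agreeSet.2 fun v _ => hg v
        refine ⟨g, ⟨hgd, hT1.trans (Finset.card_pos.2 ⟨0, h0⟩)⟩, ?_⟩
        symm
        refine toWord_eq_encode en P fun q => ?_
        rw [Subsingleton.elim q.1 0, hg, recv, dif_pos q.2.2]
        simp only [FieldTerm.eval]
        congr 2
        exact Prod.ext (Subsingleton.elim _ _) rfl
      · simp at hv
    · rintro ⟨g, ⟨hgd, hgT⟩, rfl⟩
      obtain ⟨a, ha⟩ := Finset.card_pos.1 (hT.trans hgT)
      have hnone : (findFirst f (Finset.univ : Finset (EntryIndex k s 1)).toList).run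
          (input en P) = none := by
        by_contra hne
        obtain ⟨q, hq⟩ := Option.ne_none_iff_exists'.1 hne
        refine (h2 q hq).2 ?_
        simp only [hf]
        split_ifs with hdq
        · have := mem_agreeSet.1 ha q.2.1 q.2.2
          rw [jet_eq_zero_of_degree hgd _ hdq, recv, dif_pos q.2.2] at this
          simp only [FieldTerm.eval]
          rw [this]
          congr 2
          exact Prod.ext (Subsingleton.elim _ _) rfl
        · rfl
      refine ⟨fun q => input en P (Sum.inr q), List.mem_map.2 ⟨fun q => var (Sum.inr q), ?_, rfl⟩,
        ?_⟩
      · rw [if_pos ⟨hnone, hgT.trans (hcard g)⟩]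
        exact List.mem_singleton.2 rfl
      · rw [hword]
        ext b e
        have hba : (fun i => en (a i)) = b := by
          ext1 i
          rw [← en.apply_symm_apply (b i)]
          congr 1
          exact Subsingleton.elim _ _
        have := mem_agreeSet_input.1 ha
        rw [hba] at this
        exact congrFun this e
  have hall : {ω : Fin (singleDecoder k s d T).numSeeds | decoded en P
      ((singleDecoder k s d T).tree ω) = encode S s '' closePolys (input en P) d T} = Set.univ :=
    Set.eq_univ_of_forall fun ω => hcorrect
  rw [RandCompTree.prob, hall, Set.ncard_univ, Nat.card_eq_fintype_card, Fintype.card_fin]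
  norm_num [singleDecoder]

end Decoder

/-! ### Exponential bounds for the parameters -/

section Estimates

variable {ε : ℝ} {k : ℕ}

theorem two_thirds_le_log (h0 : 0 < ε) (h1 : ε ≤ 1 / 2) : 2 / 3 ≤ Real.log (1 / ε) := by
  have h2 : (2 : ℝ) ≤ 1 / ε := by rw [le_div_iff₀ h0]; linarith
  have := Real.log_le_log (by norm_num) h2
  linarith [Real.log_two_gt_d9]

theorem interpOrder_le_exp (h0 : 0 < ε) (h1 : ε ≤ 1 / 2) (hk : 1 ≤ k) :
    (interpOrder ε k : ℝ) ≤ Real.exp (3 * k * Real.log (1 / ε)) := by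
  set L := Real.log (1 / ε) with hL
  have hk' : (1 : ℝ) ≤ k := by exact_mod_cast hk
  have hLp := two_thirds_le_log h0 h1
  have hexp : Real.exp L = 1 / ε := Real.exp_log (by positivity)
  have h2 : 2 ≤ Real.exp L := by rw [hexp, le_div_iff₀ h0]; linarith
  have h3 : 2 / ε ≤ Real.exp (2 * L) := by
    calc 2 / ε = 2 * Real.exp L := by rw [hexp]; ring
      _ ≤ Real.exp L * Real.exp L := mul_le_mul_of_nonneg_right h2 (Real.exp_pos _).le
      _ = Real.exp (2 * L) := by rw [← Real.exp_add]; ring_nf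
  have h4 : (2 / ε) ^ k ≤ Real.exp (2 * k * L) := by
    calc (2 / ε) ^ k ≤ Real.exp (2 * L) ^ k := pow_le_pow_left₀ (by positivity) h3 k
      _ = Real.exp (2 * k * L) := by rw [← Real.exp_nat_mul]; ring_nf
  have h5 : (1 : ℝ) ≤ (2 / ε) ^ k := one_le_pow₀ (by rw [le_div_iff₀ h0]; linarith)
  calc (interpOrder ε k : ℝ) ≤ (2 / ε) ^ k + 1 := (Nat.ceil_lt_add_one (by positivity)).le
    _ ≤ 2 * Real.exp (2 * k * L) := by linarith
    _ ≤ Real.exp L * Real.exp (2 * k * L) :=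
        mul_le_mul_of_nonneg_right h2 (Real.exp_pos _).le
    _ = Real.exp (L + 2 * k * L) := (Real.exp_add _ _).symm
    _ ≤ _ := Real.exp_le_exp.2 (by nlinarith)

theorem one_le_mul_log_div (h0 : 0 < ε) (h1 : ε ≤ 1 / 2) (hk : 1 ≤ k) :
    1 ≤ k * Real.log (1 / ε) / ε := by
  have hk' : (1 : ℝ) ≤ k := by exact_mod_cast hk
  have := two_thirds_le_log h0 h1
  rw [le_div_iff₀ h0]
  nlinarith

theorem tupleLength_le (h0 : 0 < ε) (h1 : ε ≤ 1 / 2) (hk : 1 ≤ k) :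
    (tupleLength ε k : ℝ) ≤ 10 * (k * Real.log (1 / ε) / ε) := by
  set L := Real.log (1 / ε) with hL
  have hk' : (1 : ℝ) ≤ k := by exact_mod_cast hk
  have hLp := two_thirds_le_log h0 h1
  have hm1 : (1 : ℝ) ≤ interpOrder ε k := by exact_mod_cast one_le_interpOrder h0 k
  have hexp : Real.exp L = 1 / ε := Real.exp_log (by positivity)
  have h2 : 2 ≤ Real.exp L := by rw [hexp, le_div_iff₀ h0]; linarith
  have hlog : Real.log (2 * interpOrder ε k) ≤ 4 * k * L := by
    rw [Real.log_le_iff_le_exp (by positivity)]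
    calc (2 : ℝ) * interpOrder ε k ≤ Real.exp L * Real.exp (3 * k * L) :=
          mul_le_mul h2 (interpOrder_le_exp h0 h1 hk) (by positivity) (by positivity)
      _ = Real.exp (L + 3 * k * L) := (Real.exp_add _ _).symm
      _ ≤ _ := Real.exp_le_exp.2 (by nlinarith)
  have hlog0 : 0 ≤ Real.log (2 * interpOrder ε k) := Real.log_nonneg (by linarith)
  have h3 : (tupleLength ε k : ℝ) ≤ 2 / ε * Real.log (2 * interpOrder ε k) + 1 + 1 := by
    rw [tupleLength]
    push_cast
    have := (Nat.ceil_lt_add_one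
      (show 0 ≤ 2 / ε * Real.log (2 * interpOrder ε k) by positivity)).le
    linarith
  have h4 : 2 / ε * Real.log (2 * interpOrder ε k) ≤ 8 * (k * L / ε) := by
    calc 2 / ε * Real.log (2 * interpOrder ε k) ≤ 2 / ε * (4 * k * L) :=
          mul_le_mul_of_nonneg_left hlog (by positivity)
      _ = _ := by ring
  have := one_le_mul_log_div h0 h1 hk
  linarith

/-- With L = log(1/ε) the left side is 2 exp(Lt), where t ≤ 10kL/ε; the factor 2 ≤ exp(L) raises the
constant to 11. -/
theorem inv_successProb_le_exp (h0 : 0 < ε) (h1 : ε ≤ 1 / 2) (hk : 1 ≤ k) :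
    1 / successProb ε k ≤ Real.exp (11 * ((k : ℝ) ^ 2 / ε * Real.log (1 / ε) ^ 2)) := by
  set L := Real.log (1 / ε) with hL
  have hk' : (1 : ℝ) ≤ k := by exact_mod_cast hk
  have hLp := two_thirds_le_log h0 h1
  have hexp : Real.exp L = 1 / ε := Real.exp_log (by positivity)
  have h2 : 2 ≤ Real.exp L := by rw [hexp, le_div_iff₀ h0]; linarith
  have h3 := tupleLength_le h0 h1 hk
  have h4 := one_le_mul_log_div h0 h1 hk
  rw [← hL] at h3 h4 hLp
  calc 1 / successProb ε k = 2 * Real.exp L ^ tupleLength ε k := by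
        rw [hexp, successProb, div_pow, one_pow]; field_simp
    _ ≤ Real.exp L * Real.exp L ^ tupleLength ε k :=
        mul_le_mul_of_nonneg_right h2 (by positivity)
    _ = Real.exp ((tupleLength ε k + 1) * L) := by
        rw [← Real.exp_nat_mul, ← Real.exp_add]; ring_nf
    _ ≤ _ := by
        refine Real.exp_le_exp.2 ?_
        calc (tupleLength ε k + 1) * L ≤ (11 * (k * L / ε)) * L :=
              mul_le_mul_of_nonneg_right (by linarith) (by linarith)
          _ = 11 * (k / ε * L ^ 2) := by ring
          _ ≤ _ := by
              gcongr
              nlinarith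

theorem one_le_inv_successProb (h0 : 0 < ε) (h1 : ε ≤ 1 / 2) (k : ℕ) :
    (2 : ℝ) ^ tupleLength ε k ≤ 1 / successProb ε k / 2 := by
  have h2 : (2 : ℝ) ≤ 1 / ε := by rw [le_div_iff₀ h0]; linarith
  have : 1 / successProb ε k / 2 = (1 / ε) ^ tupleLength ε k := by
    rw [successProb, div_pow, one_pow]; field_simp
  rw [this]
  exact pow_le_pow_left₀ (by norm_num) h2 _

theorem tupleLength_le_inv_successProb (h0 : 0 < ε) (h1 : ε ≤ 1 / 2) (k : ℕ) :
    (tupleLength ε k : ℝ) ≤ 1 / successProb ε k := by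
  have h2 := one_le_inv_successProb h0 h1 k
  have h3 : (tupleLength ε k : ℝ) < 2 ^ tupleLength ε k := by exact_mod_cast Nat.lt_two_pow_self
  have := successProb_pos h0 k
  have h4 : 0 < 1 / successProb ε k := by positivity
  linarith

/-- With q = 1/p ≥ 2 and log(3q) ≤ 3q - 1, the number of trials is at most q(3q - 1) + 1 ≤ q^4. -/
theorem numTrials_le (h0 : 0 < ε) (h1 : ε ≤ 1 / 2) (k : ℕ) :
    (numTrials ε k : ℝ) ≤ (1 / successProb ε k) ^ 4 := by
  have hp := successProb_pos h0 k
  have h2 := one_le_inv_successProb h0 h1 k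
  have h3 : (1 : ℝ) ≤ 2 ^ tupleLength ε k := one_le_pow₀ (by norm_num)
  set q := 1 / successProb ε k with hq
  have hq2 : 2 ≤ q := by linarith
  have h4 : 3 / successProb ε k = 3 * q := by rw [hq]; ring
  have h5 : Real.log (3 * q) ≤ 3 * q - 1 := Real.log_le_sub_one_of_pos (by linarith)
  have h6 : 0 ≤ Real.log (3 * q) := Real.log_nonneg (by linarith)
  rw [numTrials, h4, ← hq]
  have h7 := (Nat.ceil_lt_add_one (show 0 ≤ q * Real.log (3 * q) by positivity)).le
  have h8 : q * Real.log (3 * q) ≤ q * (3 * q - 1) := mul_le_mul_of_nonneg_left h5 (by linarith)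
  nlinarith [sq_nonneg (q ^ 2 - 4), mul_self_nonneg q]

theorem card_operators_le_exp (h0 : 0 < ε) (h1 : ε ≤ 1 / 2) (hk : 1 ≤ k) :
    (Fintype.card (DerivIndex k (interpOrder ε k + 1)) : ℝ) ≤
      Real.exp (4 * ((k : ℝ) ^ 2 / ε * Real.log (1 / ε) ^ 2)) := by
  set L := Real.log (1 / ε) with hL
  have hk' : (1 : ℝ) ≤ k := by exact_mod_cast hk
  have hLp := two_thirds_le_log h0 h1
  have hm1 : (1 : ℝ) ≤ interpOrder ε k := by exact_mod_cast one_le_interpOrder h0 k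
  have hexp : Real.exp L = 1 / ε := Real.exp_log (by positivity)
  have h2 : 2 ≤ Real.exp L := by rw [hexp, le_div_iff₀ h0]; linarith
  have h3 : (interpOrder ε k : ℝ) + 1 ≤ Real.exp (4 * k * L) := by
    calc (interpOrder ε k : ℝ) + 1 ≤ 2 * interpOrder ε k := by linarith
      _ ≤ Real.exp L * Real.exp (3 * k * L) :=
          mul_le_mul h2 (interpOrder_le_exp h0 h1 hk) (by positivity) (by positivity)
      _ = Real.exp (L + 3 * k * L) := (Real.exp_add _ _).symm
      _ ≤ _ := Real.exp_le_exp.2 (by nlinarith)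
  calc (Fintype.card (DerivIndex k (interpOrder ε k + 1)) : ℝ) ≤ ((interpOrder ε k : ℝ) + 1) ^ k :=
        by exact_mod_cast card_derivIndex_le k _
    _ ≤ Real.exp (4 * k * L) ^ k := pow_le_pow_left₀ (by positivity) h3 k
    _ = Real.exp (4 * (k ^ 2 * L)) := by rw [← Real.exp_nat_mul]; ring_nf
    _ ≤ _ := by
        refine Real.exp_le_exp.2 ?_
        have h4 : 1 ≤ L / ε := by rw [le_div_iff₀ h0]; linarith
        have h5 : (k : ℝ) ^ 2 / ε * L ^ 2 = k ^ 2 * L * (L / ε) := by ring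
        rw [h5]
        have : 0 ≤ (k : ℝ) ^ 2 * L := by positivity
        nlinarith

end Estimates

/-! ### One bound for all parameters of the decoder -/

namespace Decoder

/-- The exponent 88 comes from the number of trials: 1/p ≤ exp(11 ⋯) ≤ Y^22, and there are at most
(1/p)^4 trials. The parameters that involve s are needed only for s ≤ d, where powers of d and n
control them. -/
theorem bounded_floor {ε : ℝ} (h0 : 0 < ε) (h1 : ε ≤ 1 / 2) {k s n d : ℕ} (hk : 1 ≤ k)
    (hn : 2 ≤ n) (hd : d < s * n) {Y : ℝ} (hY : (d : ℝ) ^ (k ^ 2) + n ^ (k ^ 2) + 1 ≤ Y)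
    (hexp : Real.exp ((k : ℝ) ^ 2 / ε * Real.log (1 / ε) ^ 2) ≤ Y ^ 2) :
    Bounded ⌊Y ^ 88⌋₊ k s n d (interpOrder ε k) (interpDegree ε s n) ∧
      tupleLength ε k ≤ ⌊Y ^ 88⌋₊ ∧ numTrials ε k ≤ ⌊Y ^ 88⌋₊ := by
  have hkk : k ≤ k ^ 2 := Nat.le_self_pow (by norm_num) k
  have hs : 1 ≤ s := Nat.pos_of_ne_zero (by rintro rfl; omega)
  have hnr : (2 : ℝ) ≤ n := by exact_mod_cast hn
  have hd0 : (0 : ℝ) ≤ (d : ℝ) ^ (k ^ 2) := by positivity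
  have hnk : (n : ℝ) ^ k ≤ n ^ (k ^ 2) := pow_le_pow_right₀ (by linarith) hkk
  have hn1 : (n : ℝ) ≤ n ^ k := le_self_pow₀ (by linarith) (by omega)
  have hY3 : 3 ≤ Y := by linarith
  have hnkY : (n : ℝ) ^ k ≤ Y := by linarith
  have hdkY : (d : ℝ) ^ k ≤ Y := by
    rcases Nat.eq_zero_or_pos d with rfl | hd0
    · rw [Nat.cast_zero, zero_pow (by omega)]; linarith
    · have : (d : ℝ) ^ k ≤ d ^ (k ^ 2) := pow_le_pow_right₀ (by exact_mod_cast hd0) hkk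
      have : (0 : ℝ) ≤ (n : ℝ) ^ (k ^ 2) := by positivity
      linarith
  have key : ∀ (a j : ℕ), (a : ℝ) ≤ Y ^ j → j ≤ 88 → a ≤ ⌊Y ^ 88⌋₊ := fun a j ha hj =>
    Nat.le_floor (ha.trans (pow_le_pow_right₀ (by linarith) hj))
  have hexpj : ∀ (a : ℝ) (j : ℕ),
      a ≤ Real.exp (j * ((k : ℝ) ^ 2 / ε * Real.log (1 / ε) ^ 2)) → a ≤ Y ^ (2 * j) := by
    intro a j ha
    rw [Real.exp_nat_mul] at ha
    exact ha.trans ((pow_le_pow_left₀ (Real.exp_pos _).le hexp j).trans_eq (pow_mul _ _ _).symm)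
  have hinv : 1 / successProb ε k ≤ Y ^ 22 :=
    hexpj _ 11 (by exact_mod_cast inv_successProb_le_exp h0 h1 hk)
  have hp := successProb_pos h0 k
  have hYpow : ∀ j : ℕ, (1 : ℝ) ≤ Y ^ j := fun j => one_le_pow₀ (by linarith)
  -- Since n ≥ 2, a positive d satisfies d + 1 ≤ nd.
  have hcoef : ((d : ℝ) + 1) ^ k ≤ Y ^ 2 := by
    rcases Nat.eq_zero_or_pos d with rfl | hd0
    · simpa using hYpow 2
    · have hd1 : (1 : ℝ) ≤ d := by exact_mod_cast hd0
      calc ((d : ℝ) + 1) ^ k ≤ (n * d) ^ k := pow_le_pow_left₀ (by positivity) (by nlinarith) k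
        _ = n ^ k * d ^ k := mul_pow _ _ _
        _ ≤ Y * Y := mul_le_mul hnkY hdkY (by positivity) (by linarith)
        _ = Y ^ 2 := (pow_two Y).symm
  have hbase : ∀ x : ℝ, 0 ≤ x → x + 1 ≤ (x + 1) ^ k := fun x hx =>
    le_self_pow₀ (by linarith) (by omega)
  have hdeg : s ≤ d → ((interpDegree ε s n : ℝ) + 1) ^ k ≤ Y ^ 3 := by
    intro hsd
    have hs1 : (1 : ℝ) ≤ s := by exact_mod_cast hs
    have hsd' : (s : ℝ) ≤ d := by exact_mod_cast hsd
    have hD : (interpDegree ε s n : ℝ) ≤ ε * n * s / 2 := Nat.floor_le (by positivity)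
    have h2 : ε * n * s ≤ 1 / 2 * n * s := by gcongr
    have h3 : (n : ℝ) * s ≤ n * d := mul_le_mul_of_nonneg_left hsd' (by linarith)
    have h4 : 1 ≤ (n : ℝ) * d := by nlinarith
    have h5 : (interpDegree ε s n : ℝ) + 1 ≤ n * (n * d) := by nlinarith
    calc ((interpDegree ε s n : ℝ) + 1) ^ k ≤ (n * (n * d)) ^ k :=
          pow_le_pow_left₀ (by positivity) h5 k
      _ = n ^ k * (n ^ k * d ^ k) := by rw [mul_pow, mul_pow]
      _ ≤ Y * (Y * Y) := by
          refine mul_le_mul hnkY ?_ (by positivity) (by linarith)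
          exact mul_le_mul hnkY hdkY (by positivity) (by linarith)
      _ = Y ^ 3 := by ring
  have hsk : s ≤ d → (s : ℝ) ^ k ≤ Y := fun hsd =>
    (pow_le_pow_left₀ (by positivity) (by exact_mod_cast hsd) k).trans hdkY
  have hcast : ∀ b : ℕ, (Fintype.card (DerivIndex k b) : ℝ) ≤ (b : ℝ) ^ k := fun b => by
    exact_mod_cast card_derivIndex_le k b
  refine ⟨⟨?_, ?_, ?_, ?_, ?_, ?_, ?_, ?_, ?_, ?_⟩, ?_, ?_⟩
  · refine key _ 2 ?_ (by norm_num)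
    push_cast
    nlinarith
  · refine key _ 1 ?_ (by norm_num)
    rw [pow_one]
    refine le_trans ?_ hnkY
    have : ((k + 1 : ℕ) : ℝ) ≤ (2 : ℝ) ^ k := by exact_mod_cast Nat.lt_two_pow_self (n := k)
    exact this.trans (pow_le_pow_left₀ (by norm_num) hnr k)
  · refine key _ 2 ?_ (by norm_num)
    push_cast
    exact (hbase d (by positivity)).trans hcoef
  · refine key _ 1 ?_ (by norm_num)
    push_cast
    linarith
  · refine key _ 3 ?_ (by norm_num)
    have h2 := hcast (d + 1)
    push_cast at h2 ⊢
    have h3 := hYpow 2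
    have h4 : Y ^ 3 = Y ^ 2 * Y := pow_succ Y 2
    nlinarith
  · intro hsd
    refine key _ 1 ?_ (by norm_num)
    rw [pow_one]
    exact (le_self_pow₀ (by exact_mod_cast hs) (by omega)).trans (hsk hsd)
  · intro hsd
    refine key _ 3 ?_ (by norm_num)
    push_cast
    exact (hbase _ (by positivity)).trans (hdeg hsd)
  · intro hsd
    refine key _ 1 ?_ (by norm_num)
    rw [pow_one]
    exact (hcast s).trans (hsk hsd)
  · intro _
    exact key _ 8 (hexpj _ 4 (by exact_mod_cast card_operators_le_exp h0 h1 hk)) (by norm_num)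
  · intro hsd
    refine key _ 3 ?_ (by norm_num)
    have h2 := hcast (interpDegree ε s n + 1)
    push_cast at h2
    exact h2.trans (hdeg hsd)
  · exact key _ 22 ((tupleLength_le_inv_successProb h0 h1 k).trans hinv) (by norm_num)
  · refine key _ 88 ((numTrials_le h0 h1 k).trans ?_) le_rfl
    calc (1 / successProb ε k) ^ 4 ≤ (Y ^ 22) ^ 4 := pow_le_pow_left₀ (by positivity) hinv 4
      _ = Y ^ 88 := by ring

/-- The exponential term in the running time dominates the parameters of the decoder. -/
theorem exp_min_le {ε : ℝ} (h0 : 0 < ε) (h1 : ε < 1) {k n : ℕ} (hn : 2 ≤ n) {y : ℝ} (hy : 0 ≤ y) :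
    Real.exp ((k : ℝ) ^ 2 / min ε (1 / 2) * Real.log (1 / min ε (1 / 2)) ^ 2) ≤
      (y + (n : ℝ) ^ (k ^ 2) + Real.exp ((k : ℝ) ^ 2 / ε * Real.log (1 / ε) ^ 3)) ^ 2 := by
  rcases le_total ε (1 / 2) with hε | hε
  · rw [min_eq_left hε]
    have hL := two_thirds_le_log h0 hε
    set L := Real.log (1 / ε)
    have h2 : (k : ℝ) ^ 2 / ε * L ^ 2 ≤ 2 * ((k : ℝ) ^ 2 / ε * L ^ 3) := by
      have : (k : ℝ) ^ 2 / ε * L ^ 3 = (k : ℝ) ^ 2 / ε * L ^ 2 * L := by ring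
      have h3 : 0 ≤ (k : ℝ) ^ 2 / ε * L ^ 2 := by positivity
      nlinarith
    calc _ ≤ Real.exp ((2 : ℕ) * ((k : ℝ) ^ 2 / ε * L ^ 3)) :=
          Real.exp_le_exp.2 (by exact_mod_cast h2)
      _ = Real.exp ((k : ℝ) ^ 2 / ε * L ^ 3) ^ 2 := Real.exp_nat_mul _ _
      _ ≤ _ := pow_le_pow_left₀ (Real.exp_pos _).le
          (le_add_of_nonneg_left (by positivity)) 2
  -- As ε approaches 1 the exponential term tends to 1 and cannot help; n^(k²) ≥ 2^(k²) takes over.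
  -- This is one reason for treating n = 1 apart.
  · rw [min_eq_right hε]
    have hlog : Real.log (1 / (1 / 2)) = Real.log 2 := by norm_num
    rw [hlog]
    have hl1 := Real.log_two_gt_d9
    have hl2 := Real.log_two_lt_d9
    have h2 : (k : ℝ) ^ 2 / (1 / 2) * Real.log 2 ^ 2 ≤ (2 : ℕ) * ((k ^ 2 : ℕ) * Real.log 2) := by
      have h3 : Real.log 2 ^ 2 ≤ Real.log 2 := by nlinarith
      have h4 : (0 : ℝ) ≤ (k : ℝ) ^ 2 := by positivity
      push_cast
      nlinarith
    calc _ ≤ Real.exp ((2 : ℕ) * ((k ^ 2 : ℕ) * Real.log 2)) := Real.exp_le_exp.2 h2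
      _ = ((2 : ℝ) ^ (k ^ 2)) ^ 2 := by
          rw [Real.exp_nat_mul, Real.exp_nat_mul, Real.exp_log (by norm_num)]
      _ ≤ ((n : ℝ) ^ (k ^ 2)) ^ 2 := by
          have : (2 : ℝ) ≤ n := by exact_mod_cast hn
          gcongr
      _ ≤ _ := by
          refine pow_le_pow_left₀ (by positivity) ?_ 2
          have := Real.exp_pos ((k : ℝ) ^ 2 / ε * Real.log (1 / ε) ^ 3)
          linarith

end Decoder

end MultCode

/-! ### Assembly of the theorem -/

open MultCode MultCode.Decoder in
theorem theorem1p4 :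
    ∃ C : ℕ, ∀ ε : ℝ, 0 < ε → ε < 1 → ∀ k : ℕ, 1 ≤ k →
      ∃ s₀ : ℕ, ∀ s : ℕ, s₀ ≤ s → ∀ d n : ℕ, d < s * n →
        ∃ A : MultCode.RandCompTree (MultCode.DecoderReg k s n) (MultCode.EntryIndex k s n),
          ∀ (F : Type*) [Field F], (ringChar F = 0 ∨ d < ringChar F) →
            ∀ (S : Finset F) (en : Fin n ≃ S) (P : MultCode.Word S k s),
              -- every run of the algorithm uses few field operations
              (∀ ω : Fin A.numSeeds,
                ((A.tree ω).opCount (MultCode.decoderInput en P) : ℝ) ≤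
                  C * ((d : ℝ) ^ (k ^ 2) + (n : ℝ) ^ (k ^ 2) +
                    Real.exp (C * ((k : ℝ) ^ 2 / ε * Real.log (1 / ε) ^ 3))) ^ C) ∧
              -- the output is correct with probability at least 2/3
              2 / 3 ≤ A.prob (fun t => MultCode.decoded en P t =
                MultCode.closeCodewords S s d P (1 - MultCode.relDist s d n + ε)) ∧
              -- the list of close codewords is short
              (MultCode.closeCodewords S s d P (1 - MultCode.relDist s d n + ε)).Finite ∧
              ((MultCode.closeCodewords S s d P (1 - MultCode.relDist s d n + ε)).ncard : ℝ) ≤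
                Real.exp (C * ((k : ℝ) ^ 2 / ε * Real.log (1 / ε) ^ 2)) := by
  -- 1584 = 88 · 18: all parameters are at most Y^88, and the decoder needs at most the 18th power
  -- of that bound.
  refine ⟨1584, fun ε h0 h1 k hk => ?_⟩
  set ε' := min ε (1 / 2) with hε'
  have h0' : 0 < ε' := lt_min h0 (by norm_num)
  have h1' : ε' ≤ 1 / 2 := min_le_right _ _
  refine ⟨⌈4 * interpOrder ε' k / ε'⌉₊, fun s hs d n hd => ?_⟩
  have hn : 0 < n := Nat.pos_of_ne_zero (by rintro rfl; omega)
  have hs0 : 0 < s := Nat.pos_of_ne_zero (by rintro rfl; omega)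
  have hs' : 4 * interpOrder ε' k / ε' ≤ s := (Nat.le_ceil _).trans (by exact_mod_cast hs)
  have hnr : (0 : ℝ) < n := by exact_mod_cast hn
  have hsr : (0 : ℝ) < s := by exact_mod_cast hs0
  have hN : (0 : ℝ) < (n : ℝ) ^ k := by positivity
  have hL : 0 < Real.log (1 / ε) := Real.log_pos (by rw [lt_div_iff₀ h0]; linarith)
  set θ := 1 - relDist s d n + ε with hθ
  have hθ' : θ = d / (s * n) + ε := by rw [hθ, relDist]; ring
  set T := threshold θ n k with hT
  have hTε : ((d : ℝ) / (s * n) + ε) * n ^ k ≤ T := by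
    rw [← hθ']; exact Nat.le_ceil _
  -- The threshold is set for ε itself. It is stricter than what ε' requires, so the decoder with
  -- parameter ε' still finds every polynomial above it.
  have hTε' : ((d : ℝ) / (s * n) + ε') * n ^ k ≤ T := by
    refine le_trans ?_ hTε
    have := min_le_left ε (1 / 2)
    gcongr
  have hlist : ∀ (F : Type _) [Field F], (ringChar F = 0 ∨ d < ringChar F) →
      ∀ (S : Finset F) (en : Fin n ≃ S) (P : Word S k s),
      (encode S s '' closePolys (input en P) d T).Finite ∧
      ((encode S s '' closePolys (input en P) d T).ncard : ℝ) ≤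
        Real.exp ((1584 : ℕ) * ((k : ℝ) ^ 2 / ε * Real.log (1 / ε) ^ 2)) := by
    intro F _ hchar S en P
    obtain ⟨hfin, hcard, -⟩ := closePolys_determined (coord_input_injective en P) h0' h1' hs' hd
      hchar hTε'
    refine ⟨hfin.image _, le_trans (Nat.cast_le.2 (Set.ncard_image_le hfin)) ?_⟩
    rcases le_or_gt ε (1 / 2) with hε | hε
    · have hεε : ε' = ε := min_eq_left hε
      rw [hεε] at hcard
      rw [← le_div_iff₀ (successProb_pos h0 k)] at hcard
      refine hcard.trans ((inv_successProb_le_exp h0 hε hk).trans (Real.exp_le_exp.2 ?_))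
      refine mul_le_mul_of_nonneg_right (by norm_num) (by positivity)
    -- For ε > 1/2 the claimed list size can be arbitrarily close to one, so uniqueness has to be
    -- used.
    · have : Finite (closePolys (input en P) d T) := hfin
      have := Set.ncard_le_one_iff_subsingleton.2
        (closePolys_subsingleton (coord_input_injective en P) hε hd hTε)
      refine le_trans (Nat.cast_le.2 this) ?_
      rw [Nat.cast_one]
      exact Real.one_le_exp (by positivity)
  rcases Nat.lt_or_ge n 2 with hn2 | hn2
  · obtain rfl : n = 1 := by omega
    refine ⟨singleDecoder k s d T, fun F _ hchar S en P => ?_⟩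
    have hT1 : 1 ≤ T := Nat.ceil_pos.2 (by rw [hθ']; positivity)
    obtain ⟨hops, hprob⟩ := singleDecoder_correct (d := d) hT1 en P
    rw [closeCodewords_eq_image en hn]
    refine ⟨fun ω => ?_, hprob, hlist F hchar S en P⟩
    rw [hops ω, Nat.cast_zero]
    positivity
  · set Y := (d : ℝ) ^ (k ^ 2) + (n : ℝ) ^ (k ^ 2) +
      Real.exp ((k : ℝ) ^ 2 / ε * Real.log (1 / ε) ^ 3) with hY
    have hY1 : (d : ℝ) ^ (k ^ 2) + n ^ (k ^ 2) + 1 ≤ Y := by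
      rw [hY]
      have := Real.one_le_exp (show 0 ≤ (k : ℝ) ^ 2 / ε * Real.log (1 / ε) ^ 3 by positivity)
      linarith
    obtain ⟨hb, ht, hM⟩ := bounded_floor h0' h1' hk hn2 hd hY1
      (exp_min_le h0 h1 hn2 (by positivity))
    refine ⟨decoder k s d hn ε' T, fun F _ hchar S en P => ?_⟩
    obtain ⟨hops, hprob⟩ := decoder_correct hn h0' h1' hs' hd hTε' hb ht hM hchar en P
    rw [closeCodewords_eq_image en hn]
    refine ⟨fun ω => ?_, hprob, hlist F hchar S en P⟩
    set X := (d : ℝ) ^ (k ^ 2) + (n : ℝ) ^ (k ^ 2) +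
      Real.exp ((1584 : ℕ) * ((k : ℝ) ^ 2 / ε * Real.log (1 / ε) ^ 3)) with hX
    have hY0 : 0 ≤ Y := by positivity
    have hYX : Y ≤ X := by
      rw [hY, hX]
      refine add_le_add_right (Real.exp_le_exp.2 ?_) _
      refine le_mul_of_one_le_left (by positivity) (by norm_num)
    calc (((decoder k s d hn ε' T).tree ω).opCount (decoderInput en P) : ℝ)
        ≤ (⌊Y ^ 88⌋₊ : ℝ) ^ 18 := by exact_mod_cast hops ω
      _ ≤ (Y ^ 88) ^ 18 := pow_le_pow_left₀ (by positivity) (Nat.floor_le (by positivity)) 18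
      _ = Y ^ 1584 := by rw [← pow_mul]
      _ ≤ X ^ 1584 := pow_le_pow_left₀ hY0 hYX _
      _ ≤ (1584 : ℕ) * X ^ 1584 :=
          le_mul_of_one_le_left (pow_nonneg (hY0.trans hYX) _) (by norm_num)
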